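/- A *dimer* is a finite bipartite graph (multiple edges allowed), with nodes coloured white and black, embedded in the oriented torus $T^2=\mathbb R^2/\mathbb Z^2$ such that every face is an open disc. Put $(a,b)\wedge(c,d)=ad-bc$. A *zigzag path* is a closed path of edges that turns alternately to the counterclockwise next edge around white nodes and to the clockwise next edge around black nodes. It is oriented this way, so each edge belongs to two zigzag paths (possibly equal); its *winding* is its class in $H_1(T^2)=\mathbb Z^2$. The dimer is *properly ordered* if no zigzag path has winding zero, no zigzag path intersects itself, no two zigzag paths with the same winding intersect, and around every node the zigzag paths passing through it occur in the circular order of the directions of their windings, these directions being distinct. Let $\gamma_w,\gamma_z$ be closed curves whose windings $g_w,g_z$ form a basis of $\mathbb Z^2$. Give the edge $e$ the weight $c_e\,w^{a(e)}z^{b(e)}$, where $c_e\in\mathbb C^\times$ is arbitrary, $a(e)$ is the number of crossings of $\gamma_w$ with $e$ having the white endpoint on the left of $\gamma_w$ minus the number of those having it on the right, and $b(e)$ is defined likewise by $\gamma_z$. The *Kasteleyn matrix* has rows indexed by the white nodes and columns indexed by the black nodes, and its entries are the sums of the weights of the edges joining the two nodes. The *toric diagram* $\Delta$ is the Newton polygon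 of its determinant. A *$(p,q)$-leg* of $\Delta$ is the outward normal vector $(p,q)$ obtained by a clockwise rotation by $90^\circ$ of a segment joining consecutive lattice points on the boundary of $\Delta$, the boundary being traversed counterclockwise; legs of different segments are counted separately. The *point* of a perfect matching $M$ is $\sum_{e\in M}(a(e),b(e))$. **Theorem.** Let a properly ordered dimer be given. Then there are as many white as black nodes, and for every choice of the basis, the curves and the coefficients $c_e$ the following hold. 1. There is a bijection between the zigzag paths and the $(p,q)$-legs of $\Delta$ such that a zigzag path corresponding to the leg $(p,q)$ has winding $p\,g_w+q\,g_z$. 2. For a ray $\mathcal R$ from the origin that does not have the direction of the winding of any zigzag path, let $M(\mathcal R)$ consist of the edges chosen by the nodes, where a node $v$ chooses its edge between the two zigzag paths through $v$ whose windings make the smallest clockwise and the smallest counterclockwise angle with $\mathcal R$ (the former path just before, the latter just after the edge, counterclockwise around $v$). Then $M(\mathcal R)$ is a perfect matching, and the corners of $\Delta$ are exactly the points of the matchings $M(\mathcal R)$. 3. Let $\mathcal R_1,\mathcal R_2$ be two such rays, and let $\mathbf w$ be the winding of a zigzag path, such that the windings of zigzag paths whose directions lie between $\mathcal R_1$ and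 $\mathcal R_2$, counterclockwise from $\mathcal R_1$, are precisely those equal to $\mathbf w$. Then the points of $M(\mathcal R_1)$ and $M(\mathcal R_2)$ are distinct consecutive corners of $\Delta$, and the second minus the first is $n\,(\mathbf w\wedge g_w,\ \mathbf w\wedge g_z)$, where $n$ is the number of zigzag paths of winding $\mathbf w$. For $g_w=(1,0)$, $g_z=(0,1)$ this is $n$ times $\mathbf w$ rotated by $90^\circ$ counterclockwise. -/

import Mathlib

noncomputable section

/-! ### Plane vectors -/

/-- The wedge product `(a,b) ∧ (c,d) = a d - b c`. -/
def wedge {R : Type*} [CommRing R] (u v : R × R) : R := u.1 * v.2 - u.2 * v.1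

/-- A lattice vector, seen in the real plane. -/
def toReal (u : ℤ × ℤ) : ℝ × ℝ := ((u.1 : ℝ), (u.2 : ℝ))

/-- Two nonzero vectors point in the same direction. -/
def SameDir {R : Type*} [CommRing R] [LinearOrder R] (u v : R × R) : Prop :=
  wedge u v = 0 ∧ 0 < u.1 * v.1 + u.2 * v.2

/-- The directions of `u`, `v`, `w` are pairwise distinct and are met in this cyclic order when one
turns counterclockwise. The three counterclockwise turns `u → v → w → u` then add up to one
revolution, and this happens exactly when at least two of them are positive and less than a half
turn, i.e. have a positive wedge product. -/
def Ccw {R : Type*} [CommRing R] [LinearOrder R] (u v w : R × R) : Prop :=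
  (0 < wedge u v ∧ 0 < wedge v w) ∨ (0 < wedge v w ∧ 0 < wedge w u) ∨
    (0 < wedge w u ∧ 0 < wedge u v)

/-! ### Dimers on the torus -/

/-- The permutation that follows the boundary of a face, keeping the face on the left: walk along
`e` from white to black, return along the edge that is clockwise next to `e` at the black node, and
continue with the edge that is clockwise next to that one at the white node. -/
def facePerm {E : Type*} (rotW rotB : Equiv.Perm E) : Equiv.Perm E := rotW⁻¹ * rotB⁻¹

/-- The closed oriented surface that is glued from the faces of the rotation system is mapped with
degree one to `ℝ² / ℤ²` when the edge `e`, oriented from white to black, is given the displacement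
`disp e`. Each face boundary lifts to a closed polygon in the plane; `x e` is the corner at which the
lifted boundary of the face on the left of `e` starts to follow `e`. The last equation says that the
signed areas of all the lifted face polygons (by the shoelace formula, doubled) add up to the
area of the torus. -/
def IsToral {E : Type*} [Fintype E] (rotW rotB : Equiv.Perm E) (disp : E → ℤ × ℤ) : Prop :=
  ∃ x : E → ℤ × ℤ,
    (∀ e, x (facePerm rotW rotB e) = x e + disp e - disp (rotB⁻¹ e)) ∧
    ∑ e, (wedge (x e) (x e + disp e) +
      wedge (x e + disp e) (x (facePerm rotW rotB e))) = 2

/-- A dimer with set of edges `E`: a finite bipartite graph, multiple edges allowed, embedded in the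
oriented torus `ℝ² / ℤ²` in such a way that all faces are open discs. The embedding is given, up to
isotopy, by the cyclic order of the edges around the nodes and the displacements of the edges. -/
structure Dimer (E : Type*) [Fintype E] where
  /-- the counterclockwise next edge around the white endpoint -/
  rotW : Equiv.Perm E
  /-- the counterclockwise next edge around the black endpoint -/
  rotB : Equiv.Perm E
  /-- the graph is connected -/
  connected : MulAction.IsPretransitive (Subgroup.closure {rotW, rotB}) E
  /-- the surface has Euler characteristic zero -/
  euler : Nat.card (Quotient (Equiv.Perm.SameCycle.setoid rotW)) +
      Nat.card (Quotient (Equiv.Perm.SameCycle.setoid rotB)) +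
      Nat.card (Quotient (Equiv.Perm.SameCycle.setoid (facePerm rotW rotB))) = Fintype.card E
  /-- the displacement of an edge from its white to its black endpoint in the universal cover `ℝ²`,
  once for each node a lift has been fixed as the origin of its `ℤ²`-orbit -/
  disp : E → ℤ × ℤ
  /-- the displacements identify the surface with `ℝ² / ℤ²`, preserving orientations -/
  toral : IsToral rotW rotB disp

namespace Dimer

variable {E : Type*} [Fintype E] (D : Dimer E)

/-- The white nodes: the orbits of the rotation of edges around white endpoints. -/
def White : Type _ := Quotient (Equiv.Perm.SameCycle.setoid D.rotW)

/-- The black nodes. -/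
def Black : Type _ := Quotient (Equiv.Perm.SameCycle.setoid D.rotB)

/-- The white endpoint of an edge. -/
def white (e : E) : D.White := Quotient.mk (Equiv.Perm.SameCycle.setoid D.rotW) e

/-- The black endpoint of an edge. -/
def black (e : E) : D.Black := Quotient.mk (Equiv.Perm.SameCycle.setoid D.rotB) e

instance : Finite D.White := inferInstanceAs (Finite (Quotient _))

instance : Finite D.Black := inferInstanceAs (Finite (Quotient _))

instance : Fintype D.White := Fintype.ofFinite _

instance : Fintype D.Black := Fintype.ofFinite _

instance : DecidableEq D.White := Classical.decEq _

instance : DecidableEq D.Black := Classical.decEq _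

/-! ### Zigzag paths -/

/-- Two steps along a zigzag path: from `e` to the counterclockwise next edge around the white node,
and then to the clockwise next edge around the black node. -/
def zigzagPerm : Equiv.Perm E := D.rotB⁻¹ * D.rotW

/-- Zigzag paths, oriented counterclockwise around white and clockwise around black nodes. The path
through `e`, `rotW e`, `rotB⁻¹ (rotW e)`, … is the cycle of `zigzagPerm` that contains `e`. -/
def ZigzagPath : Type _ := Quotient (Equiv.Perm.SameCycle.setoid D.zigzagPerm)

/-- The zigzag path that turns counterclockwise from `e` to `rotW e` at the white endpoint of `e`.
It runs along `e` from black to white. -/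
def zigOut (e : E) : D.ZigzagPath := Quotient.mk (Equiv.Perm.SameCycle.setoid D.zigzagPerm) e

/-- The other zigzag path through `e`: it turns from `rotW⁻¹ e` to `e` at the white endpoint and then
from `e` to `rotB⁻¹ e` at the black endpoint. It runs along `e` from white to black. -/
def zigIn (e : E) : D.ZigzagPath := D.zigOut (D.rotW⁻¹ e)

instance : Finite D.ZigzagPath := inferInstanceAs (Finite (Quotient _))

instance : DecidableEq D.ZigzagPath := Classical.decEq _

/-- The winding of a zigzag path: its total displacement in the universal cover. -/
def winding (Z : D.ZigzagPath) : ℤ × ℤ :=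
  ∑ e with D.zigOut e = Z, (D.disp (D.rotW e) - D.disp e)

/-- Around the node whose edges, counterclockwise, are `e`, `ρ e`, `ρ (ρ e)`, …, the corresponding
zigzag paths `P e`, `P (ρ e)`, … are in the circular order of the directions of their windings, and
these directions are distinct. The minimal period is the valence of the node. -/
def OrderedAround (ρ : Equiv.Perm E) (P : E → D.ZigzagPath) (e : E) : Prop :=
  (∀ i j : ℕ, i < j → j < Function.minimalPeriod ρ e →
    ¬ SameDir (D.winding (P ((ρ ^ i) e))) (D.winding (P ((ρ ^ j) e)))) ∧
  (∀ i j k : ℕ, i < j → j < k → k < Function.minimalPeriod ρ e →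
    Ccw (D.winding (P ((ρ ^ i) e))) (D.winding (P ((ρ ^ j) e))) (D.winding (P ((ρ ^ k) e))))

/-- Properly ordered dimers: no zigzag path has winding zero, no two zigzag paths with the same
winding intersect (in particular none intersects itself), and around each node the order of the
zigzag paths is the circular order of the directions of their windings. At a white node, `zigOut e`
occupies the corner between `e` and `rotW e`; at a black node, `zigIn e` occupies the corner between
`rotB⁻¹ e` and `e`. -/
structure ProperlyOrdered : Prop where
  winding_ne_zero : ∀ Z : D.ZigzagPath, D.winding Z ≠ 0
  winding_ne : ∀ e, D.winding (D.zigIn e) ≠ D.winding (D.zigOut e)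
  white_ordered : ∀ e, D.OrderedAround D.rotW D.zigOut e
  black_ordered : ∀ e, D.OrderedAround D.rotB D.zigIn e

/-! ### The Kasteleyn matrix -/

/-- The exponent `(a, b)` of the weight of an edge, for curves `γ_w`, `γ_z` with windings `gw`, `gz`:
`a` is the signed number of crossings of `γ_w` with the edge, counted positively if the white
endpoint is on the left of `γ_w`, and likewise for `b`. -/
def exponent (gw gz : ℤ × ℤ) (e : E) : ℤ × ℤ := (wedge (D.disp e) gw, wedge (D.disp e) gz)

/-- The Kasteleyn matrix, with entries in the ring `ℂ[w^±1, z^±1]` of Laurent polynomials: the sum of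
the weights `c e * w ^ a * z ^ b` of all edges that join the two nodes. -/
def kasteleyn (gw gz : ℤ × ℤ) (c : E → ℂ) :
    Matrix D.White D.Black (AddMonoidAlgebra ℂ (ℤ × ℤ)) := fun v b =>
  ∑ e with D.white e = v ∧ D.black e = b, AddMonoidAlgebra.single (D.exponent gw gz e) (c e)

/-- The determinant of the Kasteleyn matrix. The bijection `φ` puts rows and columns in a common
order; it affects the determinant by a sign only. -/
def kasteleynDet (gw gz : ℤ × ℤ) (c : E → ℂ) (φ : D.White ≃ D.Black) :
    AddMonoidAlgebra ℂ (ℤ × ℤ) :=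
  ((D.kasteleyn gw gz c).submatrix id φ).det

end Dimer

/-- The Newton polygon of a Laurent polynomial in two variables. -/
def newtonPolygon (f : AddMonoidAlgebra ℂ (ℤ × ℤ)) : Set (ℝ × ℝ) :=
  convexHull ℝ (toReal '' (f.coeff.support : Set (ℤ × ℤ)))

/-- The toric diagram. -/
def Dimer.toricDiagram {E : Type*} [Fintype E] (D : Dimer E) (gw gz : ℤ × ℤ) (c : E → ℂ)
    (φ : D.White ≃ D.Black) : Set (ℝ × ℝ) :=
  newtonPolygon (D.kasteleynDet gw gz c φ)

/-- The segments that give rise to the `(p,q)`-legs of a lattice polygon `Δ`: `src` and `tgt` are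
consecutive lattice points on the boundary of `Δ`, in counterclockwise order (`Δ` lies on the left of
the directed line from `src` to `tgt`). -/
@[ext]
structure Leg (Δ : Set (ℝ × ℝ)) where
  src : ℤ × ℤ
  tgt : ℤ × ℤ
  src_mem : toReal src ∈ Δ
  tgt_mem : toReal tgt ∈ Δ
  ne : src ≠ tgt
  boundary : ∀ x ∈ Δ, 0 ≤ wedge (toReal tgt - toReal src) (x - toReal src)
  consecutive : ∀ p : ℤ × ℤ, toReal p ∈ segment ℝ (toReal src) (toReal tgt) → p = src ∨ p = tgt

/-- The leg `(p, q)` itself: the outward normal vector obtained by turning the boundary segment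
clockwise by 90 degrees. -/
def Leg.vec {Δ : Set (ℝ × ℝ)} (l : Leg Δ) : ℤ × ℤ := (l.tgt.2 - l.src.2, -(l.tgt.1 - l.src.1))

/-! ### The perfect matchings attached to rays -/

namespace Dimer

variable {E : Type*} [Fintype E] (D : Dimer E)

/-- A set of edges that contains exactly one edge at each node. -/
def IsPerfectMatching (M : Finset E) : Prop :=
  (∀ v : D.White, ∃! e, e ∈ M ∧ D.white e = v) ∧ (∀ b : D.Black, ∃! e, e ∈ M ∧ D.black e = b)

/-- The point of the toric diagram that belongs to a set of edges: the exponent of the product of the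
weights of its edges. -/
def point (gw gz : ℤ × ℤ) (M : Finset E) : ℤ × ℤ := ∑ e ∈ M, D.exponent gw gz e

/-- A winding, seen in the real plane. -/
def windingR (Z : D.ZigzagPath) : ℝ × ℝ := toReal (D.winding Z)

/-- The ray spanned by `r` does not have the direction of the winding of a zigzag path. -/
def IsGenericRay (r : ℝ × ℝ) : Prop := r ≠ 0 ∧ ∀ Z : D.ZigzagPath, ¬ SameDir r (D.windingR Z)

/-- Among the zigzag paths in `S`, none makes a smaller counterclockwise angle with `r` than `Z`. -/
def IsFirstCcw (r : ℝ × ℝ) (S : Set D.ZigzagPath) (Z : D.ZigzagPath) : Prop :=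
  ∀ Y ∈ S, ¬ Ccw r (D.windingR Y) (D.windingR Z)

/-- Among the zigzag paths in `S`, none makes a smaller clockwise angle with `r` than `Z`. -/
def IsFirstCw (r : ℝ × ℝ) (S : Set D.ZigzagPath) (Z : D.ZigzagPath) : Prop :=
  ∀ Y ∈ S, ¬ Ccw (D.windingR Z) (D.windingR Y) r

/-- The zigzag paths that pass through a white node. -/
def pathsAtWhite (v : D.White) : Set D.ZigzagPath := {Z | ∃ e, D.white e = v ∧ D.zigOut e = Z}

/-- The zigzag paths that pass through a black node. -/
def pathsAtBlack (b : D.Black) : Set D.ZigzagPath := {Z | ∃ e, D.black e = b ∧ D.zigIn e = Z}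

open Classical in
/-- The set `M(r)` of the edges chosen by the nodes. A node chooses its edge between the
two zigzag paths through the node whose windings make the smallest clockwise and the smallest
counterclockwise angle with `r`. Counterclockwise around either endpoint of an edge `e`, the path
`zigIn e` comes just before `e` and `zigOut e` just after. -/
def rayMatching (r : ℝ × ℝ) : Finset E :=
  {e | (D.IsFirstCw r (D.pathsAtWhite (D.white e)) (D.zigIn e) ∧
        D.IsFirstCcw r (D.pathsAtWhite (D.white e)) (D.zigOut e)) ∨
      (D.IsFirstCw r (D.pathsAtBlack (D.black e)) (D.zigIn e) ∧
        D.IsFirstCcw r (D.pathsAtBlack (D.black e)) (D.zigOut e))}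

end Dimer

end

/-! ### The circular order of directions -/

section CircularOrder

variable {R : Type*} [CommRing R]

/-! The paths `zigIn e` and `zigOut e` are neighbours at both endpoints of an edge `e`. Because of
the proper ordering, `e` belongs to the matching of a ray exactly when the ray lies in the sector
from the winding of `zigIn e` to that of `zigOut e` (`mem_rayMatching`). The sectors at one node
tile the circle, so every node chooses exactly one edge and both endpoints agree on it.

Matchings are compared through intersection numbers. The number of times a zigzag path Z runs along
an edge is a closed cochain, dual to the cycle Z. The torus has first Betti number two and the
displacements span its cohomology, so this cochain equals the wedge of the displacement with the
winding of Z up to a coboundary. A coboundary has the same sum over all perfect matchings. Hence the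
difference of the numbers of edges that two matchings have on Z is the wedge of the difference of
their displacements with the winding (`sum_crossing_sub`). A perfect matching contains at most half
of the edges of Z, and the matching of a ray next to Z attains this bound. So every zigzag path next
to the ray gives a half plane that contains all displacements and has the displacement of the ray
matching on its boundary. The windings add up to zero and are not all parallel, so the two
neighbours of a ray enclose less than a half turn, and the two half planes meet in a strictly convex
cone with that displacement as apex.

The apex occurs in the determinant because the ray matching is the only perfect matching with its
displacement (`eq_rayMatching_of_totalDisp_eq`), so nothing cancels whatever the coefficients are.
Otherwise the two matchings would contain opposite halves of one zigzag path Z. Exchanging the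
halves in each of them would move the displacement by plus and by minus the winding of Z, and a
strictly convex cone does not contain both directions.

When the ray passes the direction w, edges with `zigOut` of winding w leave and those with `zigIn`
of winding w enter, which changes the displacement by n times w (`totalDisp_sub`). Finally, windings
are primitive (`isCoprime_winding`). Therefore the edge of the polygon that belongs to w consists of
exactly n unit lattice segments, which are the legs to be matched with the n zigzag paths of winding
w. -/

theorem wedge_swap (u v : R × R) : wedge v u = -wedge u v := by
  simp only [wedge]; ring

theorem wedge_self (u : R × R) : wedge u u = 0 := by
  simp only [wedge]; ring

theorem wedge_sub_right (u v w : R × R) : wedge u (v - w) = wedge u v - wedge u w := by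
  simp only [wedge, Prod.fst_sub, Prod.snd_sub]; ring

theorem wedge_sub_left (u v w : R × R) : wedge (u - v) w = wedge u w - wedge v w := by
  simp only [wedge, Prod.fst_sub, Prod.snd_sub]; ring

theorem wedge_smul_right (c : R) (u v : R × R) : wedge u (c • v) = c * wedge u v := by
  simp only [wedge, Prod.smul_fst, Prod.smul_snd, smul_eq_mul]; ring

theorem wedge_sum_left {ι : Type*} (s : Finset ι) (f : ι → R × R) (v : R × R) :
    wedge (∑ i ∈ s, f i) v = ∑ i ∈ s, wedge (f i) v := by
  simp only [wedge, Prod.fst_sum, Prod.snd_sum, Finset.sum_mul, Finset.sum_sub_distrib]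

theorem wedge_sum_right {ι : Type*} (s : Finset ι) (f : ι → R × R) (v : R × R) :
    wedge v (∑ i ∈ s, f i) = ∑ i ∈ s, wedge v (f i) := by
  simp only [wedge, Prod.fst_sum, Prod.snd_sum, Finset.mul_sum, Finset.sum_sub_distrib]

/-- The Plücker relation. -/
theorem wedge_plucker (a b c d : R × R) :
    wedge a b * wedge c d + wedge a c * wedge d b + wedge a d * wedge b c = 0 := by
  simp only [wedge]; ring

variable [LinearOrder R]

theorem Ccw.rotate {u v w : R × R} (h : Ccw u v w) : Ccw v w u := by
  unfold Ccw at *; tauto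

theorem SameDir.symm {u v : R × R} (h : SameDir u v) : SameDir v u :=
  ⟨by rw [wedge_swap u v, h.1, neg_zero], by
    have := h.2; rwa [mul_comm u.1, mul_comm u.2] at this⟩

variable [IsStrictOrderedRing R]

theorem Ccw.not_swap {u v w : R × R} (h : Ccw u v w) : ¬ Ccw u w v := by
  unfold Ccw at *
  rw [wedge_swap v w, wedge_swap u v, wedge_swap w u]
  rintro (h' | h' | h') <;> rcases h with h | h | h <;> linarith [h.1, h.2, h'.1, h'.2]

theorem not_ccw_self_right (u v : R × R) : ¬ Ccw u v v := fun h => h.not_swap h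

theorem not_ccw_self_left (u v : R × R) : ¬ Ccw u u v := fun h =>
  h.rotate.rotate.not_swap h.rotate.rotate

/-- Turning counterclockwise from `r`, being met earlier is a transitive relation. -/
theorem Ccw.trans {r a b c : R × R} (h₁ : Ccw r a b) (h₂ : Ccw r b c) : Ccw r a c := by
  -- Where the signs of the hypotheses do not settle the claim, this relation excludes the wrong
  -- sign of the wedge of `a` and `c`.
  have key := wedge_plucker r a b c
  unfold Ccw at *
  rw [wedge_swap r b] at h₁
  rw [wedge_swap r c] at h₂
  rw [wedge_swap r c, wedge_swap c a]
  rcases h₁ with ⟨h1, h2⟩ | ⟨h1, h2⟩ | ⟨h1, h2⟩ <;> rcases h₂ with ⟨h3, h4⟩ | ⟨h3, h4⟩ | ⟨h3, h4⟩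
  · by_cases hC : wedge r c < 0
    · exact Or.inr (Or.inr ⟨by linarith, h1⟩)
    · refine Or.inl ⟨h1, ?_⟩
      by_contra hZ
      have e1 := mul_pos h1 h4
      have e2 : 0 ≤ wedge r c * wedge a b := mul_nonneg (not_lt.1 hC) h2.le
      have e3 : 0 ≤ wedge r b * wedge c a := mul_nonneg h3.le (by linarith)
      linarith
  · exact Or.inr (Or.inr ⟨h4, h1⟩)
  · exact Or.inr (Or.inr ⟨h3, h1⟩)
  · linarith
  · by_cases hA : 0 < wedge r a
    · exact Or.inr (Or.inr ⟨h4, hA⟩)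
    · refine Or.inr (Or.inl ⟨?_, h4⟩)
      by_contra hZ
      have e1 : wedge r a * wedge b c ≤ 0 := mul_nonpos_of_nonpos_of_nonneg (not_lt.1 hA) h3.le
      have e2 := mul_pos h4 h1
      have e3 : 0 ≤ -wedge r b * wedge c a := mul_nonneg h2.le (by linarith)
      linarith
  · linarith
  · linarith
  · exact Or.inr (Or.inr ⟨h4, h2⟩)
  · linarith

theorem Ccw.trans_right {r a b c : R × R} (h₁ : Ccw r a b) (h₂ : Ccw r b c) : Ccw a b c :=
  (Ccw.trans h₂.rotate h₁.rotate.rotate).rotate.rotate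

theorem normSq_pos {u : R × R} (hu : u ≠ 0) : 0 < u.1 * u.1 + u.2 * u.2 := by
  have h1 := mul_self_nonneg u.1
  have h2 := mul_self_nonneg u.2
  refine lt_of_le_of_ne (by linarith) fun h => hu ?_
  exact Prod.ext (mul_self_eq_zero.1 (by linarith)) (mul_self_eq_zero.1 (by linarith))

/-- By Lagrange's identity nonzero parallel vectors are not orthogonal, so if they do not have the
same direction they are opposite. -/
theorem dot_neg_of_not_sameDir {u v : R × R} (hu : u ≠ 0) (hv : v ≠ 0) (h : ¬ SameDir u v)
    (h0 : wedge u v = 0) : u.1 * v.1 + u.2 * v.2 < 0 := by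
  refine lt_of_le_of_ne (not_lt.1 fun h' => h ⟨h0, h'⟩) fun h1 => ?_
  have key : (u.1 * u.1 + u.2 * u.2) * (v.1 * v.1 + v.2 * v.2)
      = (u.1 * v.1 + u.2 * v.2) ^ 2 + wedge u v ^ 2 := by simp only [wedge]; ring
  have := mul_pos (normSq_pos hu) (normSq_pos hv)
  rw [key, h0, h1] at this
  simp at this

/-- With `Ccw.trans` this turns the order of directions counterclockwise from `r` into a linear
order. It is a sign analysis: `i1`, `i2` compute the wedge and scalar product of `a` and `b` in
coordinates along `r`, and `i3` does so for `r` and `b` along `a`. -/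
theorem ccw_or_ccw {r a b : R × R} (hr : r ≠ 0) (ha : a ≠ 0) (hb : b ≠ 0)
    (hra : ¬ SameDir r a) (hrb : ¬ SameDir r b) (hab : ¬ SameDir a b) :
    Ccw r a b ∨ Ccw r b a := by
  have hrr := normSq_pos hr
  have haa := normSq_pos ha
  have i1 : (r.1 * r.1 + r.2 * r.2) * wedge a b
      = (r.1 * a.1 + r.2 * a.2) * wedge r b - wedge r a * (r.1 * b.1 + r.2 * b.2) := by
    simp only [wedge]; ring
  have i2 : (r.1 * r.1 + r.2 * r.2) * (a.1 * b.1 + a.2 * b.2)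
      = (r.1 * a.1 + r.2 * a.2) * (r.1 * b.1 + r.2 * b.2) + wedge r a * wedge r b := by
    simp only [wedge]; ring
  have i3 : (a.1 * a.1 + a.2 * a.2) * wedge r b
      = (r.1 * a.1 + r.2 * a.2) * wedge a b + wedge r a * (a.1 * b.1 + a.2 * b.2) := by
    simp only [wedge]; ring
  have d1 := dot_neg_of_not_sameDir hr ha hra
  have d2 := dot_neg_of_not_sameDir hr hb hrb
  have d3 : wedge a b = 0 → ¬ 0 < a.1 * b.1 + a.2 * b.2 := fun h h' => hab ⟨h, h'⟩
  unfold Ccw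
  rw [wedge_swap r b, wedge_swap r a, wedge_swap a b]
  generalize hA : wedge r a = A at *
  generalize hB : wedge r b = B at *
  generalize hX : wedge a b = X at *
  generalize r.1 * r.1 + r.2 * r.2 = rr at *
  generalize a.1 * a.1 + a.2 * a.2 = aa at *
  generalize r.1 * a.1 + r.2 * a.2 = ra at *
  generalize r.1 * b.1 + r.2 * b.2 = rb at *
  generalize a.1 * b.1 + a.2 * b.2 = ab at *
  rcases lt_trichotomy A 0 with hA | hA | hA <;> rcases lt_trichotomy B 0 with hB | hB | hB
  · rcases lt_trichotomy X 0 with hX | hX | hX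
    · exact Or.inr (Or.inr (Or.inl ⟨by linarith, by linarith⟩))
    · rw [hX] at i3
      refine absurd ?_ (d3 hX)
      by_contra hab
      have := mul_neg_of_pos_of_neg haa hB
      have := mul_nonneg_of_nonpos_of_nonpos hA.le (not_lt.1 hab)
      linarith
    · exact Or.inl (Or.inr (Or.inl ⟨by linarith, by linarith⟩))
  · have hX : X < 0 := by
      have := mul_pos_of_neg_of_neg hA (d2 hB)
      by_contra hX
      have := mul_nonneg hrr.le (not_lt.1 hX)
      rw [hB] at i1; linarith
    exact Or.inr (Or.inr (Or.inl ⟨by linarith, by linarith⟩))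
  · exact Or.inr (Or.inr (Or.inr ⟨by linarith, hB⟩))
  · have hX : 0 < X := by
      have := mul_pos_of_neg_of_neg (d1 hA) hB
      rw [hA] at i1
      exact pos_of_mul_pos_right (b := X) (a := rr) (by linarith) hrr.le
    exact Or.inl (Or.inr (Or.inl ⟨hX, by linarith⟩))
  · have hX : X = 0 := by
      rw [hA, hB] at i1
      have : rr * X = 0 := by linarith
      exact (mul_eq_zero.1 this).resolve_left hrr.ne'
    refine absurd ?_ (d3 hX)
    have := mul_pos_of_neg_of_neg (d1 hA) (d2 hB)
    rw [hA, hB] at i2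
    exact pos_of_mul_pos_right (b := ab) (a := rr) (by linarith) hrr.le
  · have hX : X < 0 := by
      have := mul_neg_of_neg_of_pos (d1 hA) hB
      by_contra hX
      have := mul_nonneg hrr.le (not_lt.1 hX)
      rw [hA] at i1; linarith
    exact Or.inr (Or.inl ⟨hB, by linarith⟩)
  · exact Or.inl (Or.inr (Or.inr ⟨by linarith, hA⟩))
  · have hX : 0 < X := by
      have := mul_neg_of_pos_of_neg hA (d2 hB)
      rw [hB] at i1
      exact pos_of_mul_pos_right (b := X) (a := rr) (by linarith) hrr.le
    exact Or.inl (Or.inl ⟨hA, hX⟩)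
  · rcases lt_trichotomy X 0 with hX | hX | hX
    · exact Or.inr (Or.inl ⟨hB, by linarith⟩)
    · rw [hX] at i3
      refine absurd ?_ (d3 hX)
      have := mul_pos haa hB
      exact pos_of_mul_pos_right (b := ab) (a := A) (by linarith) hA.le
    · exact Or.inl (Or.inl ⟨hA, hX⟩)

/-- If the counterclockwise turn from `u` to `w` is less than a half turn, then the directions
in between span an angle less than a half turn with both. -/
theorem Ccw.wedge_pos {u v w : R × R} (h : Ccw u v w) (huw : 0 < wedge u w) :
    0 < wedge u v ∧ 0 < wedge v w := by
  have := wedge_swap u w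
  unfold Ccw at h
  rcases h with h | h | h
  · exact h
  · linarith [h.2]
  · linarith [h.1]

end CircularOrder

/-! ### Lattice vectors in the real plane -/

theorem wedge_toReal (u v : ℤ × ℤ) : wedge (toReal u) (toReal v) = (wedge u v : ℤ) := by
  simp [wedge, toReal]

theorem sameDir_toReal {u v : ℤ × ℤ} : SameDir (toReal u) (toReal v) ↔ SameDir u v := by
  unfold SameDir
  rw [wedge_toReal]
  simp only [toReal]
  norm_cast

theorem ccw_toReal {u v w : ℤ × ℤ} : Ccw (toReal u) (toReal v) (toReal w) ↔ Ccw u v w := by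
  simp only [Ccw, wedge_toReal, Int.cast_pos]

theorem toReal_injective : Function.Injective toReal := fun u v h => by
  simp only [toReal, Prod.mk.injEq, Int.cast_inj] at h
  exact Prod.ext h.1 h.2

theorem toReal_ne_zero {u : ℤ × ℤ} (h : u ≠ 0) : toReal u ≠ 0 := fun h' =>
  h (toReal_injective (by rw [h']; ext <;> simp [toReal]))

theorem toReal_add (u v : ℤ × ℤ) : toReal (u + v) = toReal u + toReal v := by
  simp [toReal]

theorem toReal_sub (u v : ℤ × ℤ) : toReal (u - v) = toReal u - toReal v := by
  simp [toReal]

theorem toReal_nsmul (n : ℕ) (u : ℤ × ℤ) : toReal (n • u) = (n : ℝ) • toReal u := by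
  simp [toReal]

theorem toReal_zsmul (n : ℤ) (u : ℤ × ℤ) : toReal (n • u) = (n : ℝ) • toReal u := by
  simp [toReal]

theorem perm_apply_inv {E : Type*} (f : Equiv.Perm E) (x : E) : f (f⁻¹ x) = x :=
  f.apply_symm_apply x

theorem perm_inv_apply {E : Type*} (f : Equiv.Perm E) (x : E) : f⁻¹ (f x) = x :=
  f.symm_apply_apply x

/-! ### Vectors ordered cyclically around a node -/

theorem Equiv.Perm.SameCycle.exists_pow_lt_minimalPeriod {E : Type*} [Finite E] {ρ : Equiv.Perm E}
    {e e' : E} (h : ρ.SameCycle e e') :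
    ∃ k < Function.minimalPeriod ρ e, (ρ ^ k) e = e' := by
  obtain ⟨k, hk⟩ := h.exists_nat_pow_eq
  have hpos : 0 < Function.minimalPeriod ρ e :=
    Function.minimalPeriod_pos_of_mem_periodicPts (ρ.injective.mem_periodicPts e)
  refine ⟨k % Function.minimalPeriod ρ e, Nat.mod_lt _ hpos, ?_⟩
  rw [← Equiv.Perm.iterate_eq_pow, Function.iterate_mod_minimalPeriod_eq,
    Equiv.Perm.iterate_eq_pow, hk]

/-- Being met earlier when turning from `r` is a strict partial order (equal directions are
incomparable), so finite nonempty sets have extremal elements. -/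
theorem exists_last_ccw {ι : Type*} [Finite ι] (r : ℝ × ℝ) (V : ι → ℝ × ℝ) {S : Set ι}
    (hS : S.Nonempty) : ∃ i ∈ S, ∀ j ∈ S, ¬ Ccw r (V i) (V j) := by
  let lt : ι → ι → Prop := fun a b => Ccw r (V b) (V a)
  have : IsTrans ι lt := ⟨fun a b c h1 h2 => Ccw.trans h2 h1⟩
  have : Std.Irrefl lt := ⟨fun a h => not_ccw_self_right _ _ h⟩
  exact (Finite.wellFounded_of_trans_of_irrefl lt).has_min S hS

/-- Each orbit of `ρ` consists of at least two elements, whose vectors `V` have distinct directions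
and are in the circular order. -/
structure CyclicallyOrdered {E : Type*} (ρ : Equiv.Perm E) (V : E → ℝ × ℝ) : Prop where
  vec_ne_zero : ∀ e, V e ≠ 0
  apply_ne : ∀ e, ρ e ≠ e
  not_sameDir : ∀ e e', ρ.SameCycle e e' → e ≠ e' → ¬ SameDir (V e) (V e')
  ccw : ∀ e e', ρ.SameCycle e e' → e' ≠ e → e' ≠ ρ e → Ccw (V e) (V (ρ e)) (V e')

namespace CyclicallyOrdered

variable {E : Type*} {ρ : Equiv.Perm E} {V : E → ℝ × ℝ}

theorem not_sameDir_apply (h : CyclicallyOrdered ρ V) (e : E) : ¬ SameDir (V e) (V (ρ e)) :=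
  h.not_sameDir e (ρ e) (Equiv.Perm.SameCycle.refl ρ e).apply_right (h.apply_ne e).symm

theorem ccw_or_ccw (h : CyclicallyOrdered ρ V) {r : ℝ × ℝ} (hr : r ≠ 0)
    (hrV : ∀ e, ¬ SameDir r (V e)) {e e' : E} (hs : ρ.SameCycle e e') (hne : e ≠ e') :
    Ccw r (V e) (V e') ∨ Ccw r (V e') (V e) :=
  _root_.ccw_or_ccw hr (h.vec_ne_zero e) (h.vec_ne_zero e') (hrV e) (hrV e')
    (h.not_sameDir e e' hs hne)

/-- If `r` lies between the vectors of `e` and `ρ e`, then no vector of the orbit does. -/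
theorem first_of_ccw (h : CyclicallyOrdered ρ V) {r : ℝ × ℝ} {e y : E}
    (hs : ρ.SameCycle e y) (hc : Ccw (V e) r (V (ρ e))) :
    ¬ Ccw (V e) (V y) r ∧ ¬ Ccw r (V y) (V (ρ e)) := by
  have hc' : Ccw r (V (ρ e)) (V e) := hc.rotate
  have key : y ≠ e → y ≠ ρ e → ¬ Ccw (V (ρ e)) (V e) (V y) := fun h1 h2 h3 =>
    h3.not_swap (h.ccw e y hs h1 h2).rotate
  constructor
  · intro h1
    have h1' : Ccw r (V e) (V y) := h1.rotate.rotate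
    by_cases hy : y = e
    · subst hy; exact not_ccw_self_right _ _ h1'
    by_cases hy' : y = ρ e
    · subst hy'; exact h1'.not_swap hc'
    exact key hy hy' (hc'.trans_right h1')
  · intro h1
    by_cases hy : y = e
    · subst hy; exact h1.not_swap hc'
    by_cases hy' : y = ρ e
    · subst hy'; exact not_ccw_self_right _ _ h1
    exact key hy hy' (h1.trans_right hc').rotate

/-- The sector containing `r` starts at the vector that is met last when turning counterclockwise
from `r`: its successor is met before it, hence just after `r`. Uniqueness holds because no vector
of the orbit enters the sector of `r`. -/
theorem existsUnique_ccw [Finite E] (h : CyclicallyOrdered ρ V) {r : ℝ × ℝ} (hr : r ≠ 0)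
    (hrV : ∀ e, ¬ SameDir r (V e)) (e₀ : E) :
    ∃! e, ρ.SameCycle e₀ e ∧ Ccw (V e) r (V (ρ e)) := by
  obtain ⟨e, he, hmax⟩ := exists_last_ccw r V (S := {e | ρ.SameCycle e₀ e}) ⟨e₀, .refl _ _⟩
  replace he : ρ.SameCycle e₀ e := he
  replace hmax (y : E) (hy : ρ.SameCycle e₀ y) : ¬ Ccw r (V e) (V y) := hmax y hy
  refine ⟨e, ⟨he, ?_⟩, ?_⟩
  · have := h.ccw_or_ccw hr hrV (Equiv.Perm.SameCycle.refl ρ e).apply_right (h.apply_ne e).symm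
    exact (this.resolve_left (hmax _ he.apply_right)).rotate.rotate
  · rintro e' ⟨he', hc⟩
    by_contra hne
    have := (h.first_of_ccw (he'.symm.trans he) hc).1
    rcases h.ccw_or_ccw hr hrV (he'.symm.trans he) hne with h1 | h1
    · exact this h1.rotate
    · exact hmax _ he' h1

end CyclicallyOrdered

namespace Dimer

variable {E : Type*} [Fintype E] {D : Dimer E}

theorem OrderedAround.not_sameDir {ρ : Equiv.Perm E} {P : E → D.ZigzagPath} {e e' : E}
    (h : D.OrderedAround ρ P e) (hs : ρ.SameCycle e e') (hne : e ≠ e') :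
    ¬ SameDir (D.windingR (P e)) (D.windingR (P e')) := by
  obtain ⟨k, hk, rfl⟩ := hs.exists_pow_lt_minimalPeriod
  have hk0 : 0 < k := Nat.pos_of_ne_zero fun h0 => hne (by simp [h0])
  simpa only [windingR, sameDir_toReal, pow_zero, Equiv.Perm.coe_one, id_eq] using h.1 0 k hk0 hk

theorem OrderedAround.ccw {ρ : Equiv.Perm E} {P : E → D.ZigzagPath} {e e' : E}
    (h : D.OrderedAround ρ P e) (hs : ρ.SameCycle e e') (hne : e' ≠ e) (hne' : e' ≠ ρ e) :
    Ccw (D.windingR (P e)) (D.windingR (P (ρ e))) (D.windingR (P e')) := by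
  obtain ⟨k, hk, rfl⟩ := hs.exists_pow_lt_minimalPeriod
  have hk0 : k ≠ 0 := fun h0 => hne (by simp [h0])
  have hk1 : k ≠ 1 := fun h0 => hne' (by simp [h0])
  simpa only [windingR, ccw_toReal, pow_zero, pow_one, Equiv.Perm.coe_one, id_eq] using
    h.2 0 1 k one_pos (by omega) hk

/-! ### Zigzag paths through an edge -/

variable (D)

theorem zigOut_eq_zigOut {e e' : E} :
    D.zigOut e = D.zigOut e' ↔ D.zigzagPerm.SameCycle e e' := Quotient.eq

theorem white_eq_white {e e' : E} : D.white e = D.white e' ↔ D.rotW.SameCycle e e' := Quotient.eq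

theorem black_eq_black {e e' : E} : D.black e = D.black e' ↔ D.rotB.SameCycle e e' := Quotient.eq

theorem white_rotW (e : E) : D.white (D.rotW e) = D.white e :=
  D.white_eq_white.2 (Equiv.Perm.SameCycle.refl _ _).apply_left

theorem black_rotB (e : E) : D.black (D.rotB e) = D.black e :=
  D.black_eq_black.2 (Equiv.Perm.SameCycle.refl _ _).apply_left

theorem white_rotW_inv (e : E) : D.white (D.rotW⁻¹ e) = D.white e := by
  rw [← white_rotW, perm_apply_inv]

theorem black_rotB_inv (e : E) : D.black (D.rotB⁻¹ e) = D.black e := by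
  rw [← black_rotB, perm_apply_inv]

theorem zigOut_zigzagPerm (e : E) : D.zigOut (D.zigzagPerm e) = D.zigOut e :=
  D.zigOut_eq_zigOut.2 (Equiv.Perm.SameCycle.refl _ _).apply_left

/-- Together with `zigIn_rotB`: both rotations carry the edges with `zigOut e = Z` to the edges with
`zigIn e = Z`. These are the two halves of `Z`. -/
theorem zigIn_rotW (e : E) : D.zigIn (D.rotW e) = D.zigOut e := by
  simp [zigIn]

theorem zigOut_rotB_inv (e : E) : D.zigOut (D.rotB⁻¹ e) = D.zigIn e := by
  have := D.zigOut_zigzagPerm (D.rotW⁻¹ e)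
  rwa [zigzagPerm, Equiv.Perm.mul_apply, perm_apply_inv] at this

theorem zigIn_rotB (e : E) : D.zigIn (D.rotB e) = D.zigOut e := by
  rw [← zigOut_rotB_inv, perm_inv_apply]

theorem zigOut_rotW_inv (e : E) : D.zigOut (D.rotW⁻¹ e) = D.zigIn e := rfl

theorem white_surjective : Function.Surjective D.white := Quotient.mk_surjective

theorem black_surjective : Function.Surjective D.black := Quotient.mk_surjective

theorem zigOut_surjective : Function.Surjective D.zigOut := Quotient.mk_surjective

variable {D}

namespace ProperlyOrdered

theorem windingR_ne_zero (hD : D.ProperlyOrdered) (Z : D.ZigzagPath) : D.windingR Z ≠ 0 :=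
  toReal_ne_zero (hD.winding_ne_zero Z)

theorem zigIn_ne_zigOut (hD : D.ProperlyOrdered) (e : E) : D.zigIn e ≠ D.zigOut e := fun h =>
  hD.winding_ne e (by rw [h])

theorem cyclicallyOrdered_white (hD : D.ProperlyOrdered) :
    CyclicallyOrdered D.rotW fun e => D.windingR (D.zigOut e) where
  vec_ne_zero e := hD.windingR_ne_zero _
  apply_ne e h := hD.zigIn_ne_zigOut e (by rw [← D.zigIn_rotW, h])
  not_sameDir e _ hs hne := (hD.white_ordered e).not_sameDir hs hne
  ccw e _ hs hne hne' := (hD.white_ordered e).ccw hs hne hne'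

theorem cyclicallyOrdered_black (hD : D.ProperlyOrdered) :
    CyclicallyOrdered D.rotB fun e => D.windingR (D.zigIn e) where
  vec_ne_zero e := hD.windingR_ne_zero _
  apply_ne e h := hD.zigIn_ne_zigOut e (by rw [← D.zigIn_rotB, h])
  not_sameDir e _ hs hne := (hD.black_ordered e).not_sameDir hs hne
  ccw e _ hs hne hne' := (hD.black_ordered e).ccw hs hne hne'

theorem not_sameDir (hD : D.ProperlyOrdered) (e : E) :
    ¬ SameDir (D.windingR (D.zigIn e)) (D.windingR (D.zigOut e)) := by
  have := hD.cyclicallyOrdered_white.not_sameDir_apply (D.rotW⁻¹ e)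
  simpa only [zigOut_rotW_inv, perm_apply_inv] using this

theorem ccw_or_ccw (hD : D.ProperlyOrdered) {r : ℝ × ℝ} (hr : D.IsGenericRay r)
    {Y Z : D.ZigzagPath} (h : ¬ SameDir (D.windingR Y) (D.windingR Z)) :
    Ccw r (D.windingR Y) (D.windingR Z) ∨ Ccw r (D.windingR Z) (D.windingR Y) :=
  _root_.ccw_or_ccw hr.1 (hD.windingR_ne_zero _) (hD.windingR_ne_zero _) (hr.2 _) (hr.2 _) h

/-- The matching of a ray consists of the edges such that the ray lies between the windings of the
two zigzag paths through the edge. -/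
theorem mem_rayMatching (hD : D.ProperlyOrdered) {r : ℝ × ℝ} (hr : D.IsGenericRay r) {e : E} :
    e ∈ D.rayMatching r ↔ Ccw (D.windingR (D.zigIn e)) r (D.windingR (D.zigOut e)) := by
  have key (S : Set D.ZigzagPath) (hS : D.zigIn e ∈ S) (h : D.IsFirstCcw r S (D.zigOut e)) :
      Ccw (D.windingR (D.zigIn e)) r (D.windingR (D.zigOut e)) :=
    ((hD.ccw_or_ccw hr (hD.not_sameDir e)).resolve_left (h _ hS)).rotate.rotate
  simp only [rayMatching, Finset.mem_filter, Finset.mem_univ, true_and]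
  constructor
  · rintro (h | h)
    · exact key (D.pathsAtWhite (D.white e)) ⟨_, D.white_rotW_inv e, rfl⟩ h.2
    · exact key (D.pathsAtBlack (D.black e)) ⟨e, rfl, rfl⟩ h.2
  · intro h
    -- The choice of the white endpoint already follows from the sector condition, and so does not
    -- depend on which endpoint chose the edge.
    left
    have h' : Ccw (D.windingR (D.zigOut (D.rotW⁻¹ e))) r
        (D.windingR (D.zigOut (D.rotW (D.rotW⁻¹ e)))) := by
      simpa only [zigOut_rotW_inv, perm_apply_inv] using h
    constructor
    · rintro _ ⟨y, hy, rfl⟩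
      exact (hD.cyclicallyOrdered_white.first_of_ccw (y := y)
        (D.white_eq_white.1 (by rw [hy, white_rotW_inv])) h').1
    · rintro _ ⟨y, hy, rfl⟩
      have := (hD.cyclicallyOrdered_white.first_of_ccw (y := y)
        (D.white_eq_white.1 (by rw [hy, white_rotW_inv])) h').2
      simpa only [perm_apply_inv] using this

theorem isPerfectMatching_rayMatching (hD : D.ProperlyOrdered) {r : ℝ × ℝ}
    (hr : D.IsGenericRay r) : D.IsPerfectMatching (D.rayMatching r) := by
  constructor
  · intro v
    obtain ⟨e₀, rfl⟩ := D.white_surjective v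
    obtain ⟨e, ⟨h1, h2⟩, h3⟩ :=
      hD.cyclicallyOrdered_white.existsUnique_ccw hr.1 (fun e => hr.2 _) e₀
    -- At a white node the sector found at `e` runs from `zigOut e = zigIn (rotW e)` to `zigOut
    -- (rotW e)`, so it belongs to the edge `rotW e`. At a black node it belongs to `e` itself.
    refine ⟨D.rotW e, ⟨(hD.mem_rayMatching hr).2 (by rwa [zigIn_rotW]), ?_⟩, ?_⟩
    · rw [white_rotW, D.white_eq_white.2 h1]
    · rintro e' ⟨h4, h5⟩
      rw [← h3 (D.rotW⁻¹ e') ⟨D.white_eq_white.1 (by rw [white_rotW_inv, h5]), by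
        simpa only [zigOut_rotW_inv, perm_apply_inv] using (hD.mem_rayMatching hr).1 h4⟩,
        perm_apply_inv]
  · intro b
    obtain ⟨e₀, rfl⟩ := D.black_surjective b
    obtain ⟨e, ⟨h1, h2⟩, h3⟩ :=
      hD.cyclicallyOrdered_black.existsUnique_ccw hr.1 (fun e => hr.2 _) e₀
    refine ⟨e, ⟨(hD.mem_rayMatching hr).2 (by rwa [zigIn_rotB] at h2), ?_⟩, ?_⟩
    · rw [D.black_eq_black.2 h1]
    · rintro e' ⟨h4, h5⟩
      exact h3 e' ⟨D.black_eq_black.1 h5.symm, by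
        rw [zigIn_rotB]; exact (hD.mem_rayMatching hr).1 h4⟩

end ProperlyOrdered

end Dimer

/-! ### Cellular cohomology of the torus -/

namespace Dimer

variable {E : Type*} [Fintype E] (D : Dimer E)

/-- A property of edges that is invariant under both rotations holds for all edges or for none. -/
theorem forall_of_invariant {P : E → Prop} (hW : ∀ e, P (D.rotW e) ↔ P e)
    (hB : ∀ e, P (D.rotB e) ↔ P e) {e : E} (he : P e) (e' : E) : P e' := by
  have := D.connected
  obtain ⟨⟨g, hg⟩, rfl⟩ := MulAction.exists_smul_eq (Subgroup.closure {D.rotW, D.rotB}) e e'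
  have key : ∀ a, P (g a) ↔ P a := by
    induction hg using Subgroup.closure_induction with
    | mem x hx =>
      rcases hx with rfl | rfl
      · exact hW
      · exact hB
    | one => intro a; rfl
    | mul x y _ _ hx hy => intro a; rw [Equiv.Perm.mul_apply, hx, hy]
    | inv x _ hx => intro a; rw [← hx, perm_apply_inv]
  exact (key e).2 he

/-- The function `x` on the edges, seen as the corners at the white nodes of the faces to the left of
the edges, is a primitive of the cochain `α` along the boundary of every face. -/
def IsPrimitive {R : Type*} [CommRing R] (x α : E → R) : Prop :=
  ∀ e, x (facePerm D.rotW D.rotB e) = x e + α e - α (D.rotB⁻¹ e)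

/-- The jumps across the edges of the primitive of a cochain. They form a cycle, which is Poincaré
dual to the cochain. -/
def jump {R : Type*} [CommRing R] (x : E → R) (e : E) : R := x e - x (D.rotW⁻¹ e)

/-! ### The intersection pairing of closed cochains -/

section Pairing

variable {D} {R : Type*} [CommRing R]

/-- The corners at the black endpoint carry the values `x e + α e`, so the jump between the two
sides of an edge can be measured at either end. -/
theorem IsPrimitive.jump_eq {x α : E → R} (h : D.IsPrimitive x α) (e : E) :
    D.jump x e = (x e + α e) - (x (D.rotB e) + α (D.rotB e)) := by
  have := h (D.rotB e)
  rw [facePerm, Equiv.Perm.mul_apply, perm_inv_apply] at this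
  rw [jump, this]; ring

theorem IsPrimitive.sum_jump_mul {x α : E → R} (h : D.IsPrimitive x α) (β : E → R) :
    ∑ e, D.jump x e * β e = ∑ e, (x e + α e) * (β e - β (D.rotB⁻¹ e)) := by
  have h1 := Equiv.sum_comp D.rotB fun e => (x e + α e) * β (D.rotB⁻¹ e)
  simp only [perm_inv_apply] at h1
  simp only [h.jump_eq, sub_mul, mul_sub, Finset.sum_sub_distrib, h1]

/-- Around each white node and around each black node the jumps telescope to zero: they form a
cycle. -/
theorem IsPrimitive.sum_jump_mul_coboundary {x α : E → R} (h : D.IsPrimitive x α)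
    (g : D.White → R) (g' : D.Black → R) :
    ∑ e, D.jump x e * (g' (D.black e) - g (D.white e)) = 0 := by
  have h1 := Equiv.sum_comp D.rotW fun e => x (D.rotW⁻¹ e) * g (D.white e)
  simp only [perm_inv_apply, white_rotW] at h1
  have h2 : ∑ e, D.jump x e * g' (D.black e) = 0 := by
    rw [h.sum_jump_mul]; simp only [black_rotB_inv, sub_self, mul_zero, Finset.sum_const_zero]
  simp only [mul_sub, Finset.sum_sub_distrib, h2]
  simp only [jump, sub_mul, Finset.sum_sub_distrib, h1, sub_self]

/-- The intersection pairing is antisymmetric. -/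
theorem IsPrimitive.sum_jump_mul_swap {x α y β : E → R} (hx : D.IsPrimitive x α)
    (hy : D.IsPrimitive y β) : ∑ e, D.jump x e * β e = -∑ e, D.jump y e * α e := by
  rw [hx.sum_jump_mul, hy.sum_jump_mul, eq_neg_iff_add_eq_zero, ← Finset.sum_add_distrib]
  have h1 := Equiv.sum_comp (facePerm D.rotW D.rotB) fun e => x e * y e
  have h2 := Equiv.sum_comp D.rotB⁻¹ fun e => α e * β e
  -- The two pairings add up to the change of `x * y` along the faces plus the change of `α * β`
  -- under the black rotation. Both changes sum to zero.
  have h3 : ∑ e, ((x (facePerm D.rotW D.rotB e) * y (facePerm D.rotW D.rotB e) - x e * y e) +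
      (α e * β e - α (D.rotB⁻¹ e) * β (D.rotB⁻¹ e))) = 0 := by
    rw [Finset.sum_add_distrib, Finset.sum_sub_distrib, Finset.sum_sub_distrib, h1, h2, sub_self,
      sub_self, add_zero]
  rw [← h3]
  refine Finset.sum_congr rfl fun e _ => ?_
  rw [hx e, hy e]; ring

theorem isPrimitive_coboundary (g : D.White → R) (g' : D.Black → R) :
    D.IsPrimitive (fun e => g (D.white e)) fun e => g' (D.black e) - g (D.white e) := fun e => by
  simp only [facePerm, Equiv.Perm.mul_apply, white_rotW_inv, black_rotB_inv]; ring

theorem IsPrimitive.add {x α y β : E → R} (hx : D.IsPrimitive x α) (hy : D.IsPrimitive y β) :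
    D.IsPrimitive (x + y) (α + β) := fun e => by
  simp only [Pi.add_apply, hx e, hy e]; ring

theorem IsPrimitive.smul {x α : E → R} (hx : D.IsPrimitive x α) (c : R) :
    D.IsPrimitive (c • x) (c • α) := fun e => by
  simp only [Pi.smul_apply, smul_eq_mul, hx e]; ring

end Pairing

/-! ### The displacements as a basis of the first cohomology -/

/-- The first component of the displacement. -/
def dispX (e : E) : ℝ := (D.disp e).1

/-- The second component of the displacement. -/
def dispY (e : E) : ℝ := (D.disp e).2

/-- The shoelace sum in `IsToral` is the difference of the pairings of the two coordinates taken in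
both orders. By antisymmetry it is twice one pairing, which is therefore 1. -/
theorem exists_isPrimitive_disp : ∃ x y : E → ℝ, D.IsPrimitive x D.dispX ∧
    D.IsPrimitive y D.dispY ∧ ∑ e, D.jump x e * D.dispY e = 1 := by
  obtain ⟨x, hx, harea⟩ := D.toral
  have h1 : D.IsPrimitive (fun e => ((x e).1 : ℝ)) D.dispX := fun e => by
    simp [hx e, dispX]
  have h2 : D.IsPrimitive (fun e => ((x e).2 : ℝ)) D.dispY := fun e => by
    simp [hx e, dispY]
  refine ⟨_, _, h1, h2, ?_⟩
  have h3 := h1.sum_jump_mul_swap h2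
  have h4 : ∑ e, D.jump (fun e => ((x e).1 : ℝ)) e * D.dispY e
      - ∑ e, D.jump (fun e => ((x e).2 : ℝ)) e * D.dispX e = 2 := by
    rw [h1.sum_jump_mul, h2.sum_jump_mul, ← Finset.sum_sub_distrib]
    have := congrArg (Int.cast : ℤ → ℝ) harea
    push_cast at this
    rw [← this]
    refine Finset.sum_congr rfl fun e _ => ?_
    simp only [hx e, wedge, dispX, dispY, Prod.fst_add, Prod.snd_add, Prod.fst_sub, Prod.snd_sub]
    push_cast
    ring
  linarith

theorem nonempty_edge {E : Type*} [Fintype E] (D : Dimer E) : Nonempty E := by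
  obtain ⟨x, -, -, -, h⟩ := D.exists_isPrimitive_disp
  by_contra hE
  rw [not_nonempty_iff] at hE
  simp at h

/-- The faces: the orbits of the permutation that follows the boundaries of the faces. -/
def Face : Type _ := Quotient (Equiv.Perm.SameCycle.setoid (facePerm D.rotW D.rotB))

/-- The face to the left of an edge. -/
def face (e : E) : D.Face :=
  Quotient.mk (Equiv.Perm.SameCycle.setoid (facePerm D.rotW D.rotB)) e

instance : Finite D.Face := inferInstanceAs (Finite (Quotient _))

noncomputable instance : Fintype D.Face := Fintype.ofFinite _

noncomputable instance : DecidableEq D.Face := Classical.decEq _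

theorem face_surjective : Function.Surjective D.face := Quotient.mk_surjective

theorem face_facePerm (e : E) : D.face (facePerm D.rotW D.rotB e) = D.face e :=
  Quotient.sound (s := Equiv.Perm.SameCycle.setoid (facePerm D.rotW D.rotB))
    (Equiv.Perm.SameCycle.refl _ _).apply_left

/-- The integral of a cochain over the boundaries of the faces. -/
noncomputable def faceIntegral : (E → ℝ) →ₗ[ℝ] (D.Face → ℝ) where
  toFun α f := ∑ e with D.face e = f, (α e - α (D.rotB⁻¹ e))
  map_add' α β := by
    ext f
    simp only [Pi.add_apply, ← Finset.sum_add_distrib]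
    exact Finset.sum_congr rfl fun e _ => by ring
  map_smul' c α := by
    ext f
    simp only [Pi.smul_apply, smul_eq_mul, RingHom.id_apply, Finset.mul_sum]
    exact Finset.sum_congr rfl fun e _ => by ring

variable {D} in
theorem IsPrimitive.faceIntegral_eq_zero {x α : E → ℝ} (h : D.IsPrimitive x α) :
    D.faceIntegral α = 0 := by
  ext f
  have h1 := Equiv.sum_comp (facePerm D.rotW D.rotB) fun e => if D.face e = f then x e else 0
  simp only [face_facePerm] at h1
  change ∑ e with D.face e = f, (α e - α (D.rotB⁻¹ e)) = 0
  rw [Finset.sum_filter]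
  have h2 : ∑ e, ((if D.face e = f then x (facePerm D.rotW D.rotB e) else 0) -
      if D.face e = f then x e else 0) = 0 := by
    rw [Finset.sum_sub_distrib, h1, sub_self]
  refine Eq.trans (Finset.sum_congr rfl fun e _ => ?_) h2
  split_ifs
  · rw [h e]; ring
  · rw [sub_zero]

/-- A functional that vanishes on all face integrals is constant on faces, since the indicator of an
edge compares the faces on its two sides and the graph is connected. So the range has codimension at
most one. -/
theorem card_face_le : Nat.card D.Face ≤ Module.finrank ℝ (LinearMap.range D.faceIntegral) + 1 := by
  classical
  have h1 := Subspace.finrank_add_finrank_dualAnnihilator_eq (LinearMap.range D.faceIntegral)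
  have h2 : Module.finrank ℝ (LinearMap.range D.faceIntegral).dualAnnihilator ≤ 1 := by
    let s : Module.Dual ℝ (D.Face → ℝ) := ∑ f, LinearMap.proj f
    have key : ∀ ψ ∈ (LinearMap.range D.faceIntegral).dualAnnihilator, ∃ c : ℝ, c • s = ψ := by
      intro ψ hψ
      have hψ' (f : D.Face → ℝ) : ψ f = ∑ i, f i * ψ (Pi.single i 1) := by
        conv_lhs => rw [pi_eq_sum_univ' f, map_sum]
        simp only [map_smul, smul_eq_mul]
      have hB (e : E) : ψ (Pi.single (D.face (D.rotB e)) 1) = ψ (Pi.single (D.face e) 1) := by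
        have h3 := (Submodule.mem_dualAnnihilator ψ).1 hψ _
          (LinearMap.mem_range_self D.faceIntegral (Pi.single e 1))
        rw [hψ'] at h3
        have h4 : ∀ i, D.faceIntegral (Pi.single e 1) i =
            (if D.face e = i then 1 else 0) - if D.face (D.rotB e) = i then 1 else 0 := by
          intro i
          change ∑ e' with D.face e' = i, _ = _
          rw [Finset.sum_sub_distrib]
          congr 1
          · simp [Pi.single_apply]
          · rw [Finset.sum_filter, Finset.sum_eq_single (D.rotB e)]
            · simp
            · intro b _ hb
              have : D.rotB⁻¹ b ≠ e := fun h => hb (by rw [← h, perm_apply_inv])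
              rw [Pi.single_eq_of_ne this, ite_self]
            · simp
        simp only [h4, sub_mul, Finset.sum_sub_distrib, ite_mul, one_mul, zero_mul,
          Finset.sum_ite_eq, Finset.mem_univ, if_true] at h3
        linarith
      have hW (e : E) : ψ (Pi.single (D.face (D.rotW e)) 1) = ψ (Pi.single (D.face e) 1) := by
        have := D.face_facePerm (D.rotB (D.rotW e))
        rw [facePerm, Equiv.Perm.mul_apply, perm_inv_apply, perm_inv_apply] at this
        rw [this, hB]
      obtain ⟨e₀⟩ := D.nonempty_edge
      refine ⟨ψ (Pi.single (D.face e₀) 1), LinearMap.ext fun f => ?_⟩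
      have hc (i : D.Face) : ψ (Pi.single i 1) = ψ (Pi.single (D.face e₀) 1) := by
        obtain ⟨e, rfl⟩ := D.face_surjective i
        exact D.forall_of_invariant
          (P := fun e => ψ (Pi.single (D.face e) 1) = ψ (Pi.single (D.face e₀) 1))
          (fun e => by rw [hW]) (fun e => by rw [hB]) rfl e
      rw [hψ' f]
      simp only [hc, ← Finset.sum_mul, s, LinearMap.smul_apply, LinearMap.sum_apply,
        LinearMap.proj_apply, smul_eq_mul]
      ring
    refine (Submodule.finrank_mono (t := ℝ ∙ s) fun ψ hψ =>
      Submodule.mem_span_singleton.2 (key ψ hψ)).trans ?_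
    exact (finrank_span_le_card ({s} : Set (Module.Dual ℝ (D.Face → ℝ)))).trans (by simp)
  have h3 : Module.finrank ℝ (D.Face → ℝ) = Nat.card D.Face := by
    rw [Module.finrank_fintype_fun_eq_card, Nat.card_eq_fintype_card]
  omega

/-- The coboundary of a function on the nodes, plus a combination of the displacements. -/
noncomputable def coboundaryAddDisp :
    ((D.White → ℝ) × (D.Black → ℝ)) × ℝ × ℝ →ₗ[ℝ] (E → ℝ) where
  toFun t := (fun e => t.1.2 (D.black e) - t.1.1 (D.white e)) +
    (t.2.1 • D.dispX + t.2.2 • D.dispY)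
  map_add' t t' := by ext e; simp; ring
  map_smul' c t := by ext e; simp; ring

/-- Pairing a relation with the cycles dual to the displacements kills its coboundary part and
forces `a = b = 0`. What remains is a potential equal at both ends of each edge, hence constant by
connectedness. -/
theorem finrank_ker_coboundaryAddDisp :
    Module.finrank ℝ (LinearMap.ker D.coboundaryAddDisp) ≤ 1 := by
  obtain ⟨x, y, hx, hy, hxy⟩ := D.exists_isPrimitive_disp
  obtain ⟨e₀⟩ := D.nonempty_edge
  let t₀ : ((D.White → ℝ) × (D.Black → ℝ)) × ℝ × ℝ := ((1, 1), 0, 0)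
  have hsub : LinearMap.ker D.coboundaryAddDisp ≤ ℝ ∙ t₀ := by
    rintro ⟨⟨g, g'⟩, a, b⟩ ht
    have ht' (e : E) : g' (D.black e) - g (D.white e) + (a * D.dispX e + b * D.dispY e) = 0 :=
      congrFun (LinearMap.mem_ker.1 ht) e
    have hpair {z α : E → ℝ} (hz : D.IsPrimitive z α) :
        a * ∑ e, D.jump z e * D.dispX e + b * ∑ e, D.jump z e * D.dispY e = 0 := by
      have h1 := hz.sum_jump_mul_coboundary g g'
      have h2 : ∑ e, (D.jump z e * (g' (D.black e) - g (D.white e)) +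
          (a * (D.jump z e * D.dispX e) + b * (D.jump z e * D.dispY e))) = 0 :=
        Finset.sum_eq_zero fun e _ => by linear_combination D.jump z e * ht' e
      rwa [Finset.sum_add_distrib, h1, zero_add, Finset.sum_add_distrib, ← Finset.mul_sum,
        ← Finset.mul_sum] at h2
    have hxx := hx.sum_jump_mul_swap hx
    have hyy := hy.sum_jump_mul_swap hy
    have hyx := hy.sum_jump_mul_swap hx
    have hb := hpair hx
    have ha := hpair hy
    have hxx0 : ∑ e, D.jump x e * D.dispX e = 0 := by linarith
    have hyy0 : ∑ e, D.jump y e * D.dispY e = 0 := by linarith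
    rw [hxy, hxx0] at hb
    rw [hyx, hxy, hyy0] at ha
    obtain rfl : b = 0 := by linarith
    obtain rfl : a = 0 := by linarith
    have hgg (e : E) : g' (D.black e) = g (D.white e) := by have := ht' e; linarith
    have hconst (e : E) : g (D.white e) = g (D.white e₀) :=
      D.forall_of_invariant (P := fun e => g (D.white e) = g (D.white e₀))
        (fun e => by rw [white_rotW]) (fun e => by rw [← hgg, ← hgg, black_rotB, hgg, hgg]) rfl e
    refine Submodule.mem_span_singleton.2 ⟨g (D.white e₀), ?_⟩
    simp only [t₀, Prod.smul_mk, smul_zero, Prod.mk.injEq, and_true]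
    constructor
    · ext v
      obtain ⟨e, rfl⟩ := D.white_surjective v
      simp [hconst e]
    · ext v
      obtain ⟨e, rfl⟩ := D.black_surjective v
      simp [hgg, hconst e]
  refine (Submodule.finrank_mono hsub).trans ?_
  exact (finrank_span_le_card ({t₀} : Set _)).trans (by simp)

/-- The first cohomology of the torus is spanned by the two components of the displacement. -/
theorem range_coboundaryAddDisp :
    LinearMap.range D.coboundaryAddDisp = LinearMap.ker D.faceIntegral := by
  obtain ⟨x, y, hx, hy, hxy⟩ := D.exists_isPrimitive_disp
  refine Submodule.eq_of_le_of_finrank_le ?_ ?_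
  · rintro _ ⟨⟨⟨g, g'⟩, a, b⟩, rfl⟩
    exact ((isPrimitive_coboundary g g').add
      ((hx.smul a).add (hy.smul b))).faceIntegral_eq_zero
  -- The range has dimension at least the number of nodes plus 2 minus 1, the kernel at most the
  -- number of edges minus that of faces plus 1. Euler characteristic zero makes the two bounds
  -- equal.
  · have h1 := LinearMap.finrank_range_add_finrank_ker D.coboundaryAddDisp
    have h2 := LinearMap.finrank_range_add_finrank_ker D.faceIntegral
    have h3 := D.finrank_ker_coboundaryAddDisp
    have h4 := D.card_face_le
    have h5 : Nat.card D.White + Nat.card D.Black + Nat.card D.Face = Fintype.card E := D.euler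
    simp only [Module.finrank_prod, Module.finrank_fintype_fun_eq_card, Module.finrank_self,
      ← Nat.card_eq_fintype_card] at h1 h2 h5
    omega

/-- A closed cochain is a combination of the displacements up to a coboundary. The coefficients are
found by pairing with the cycles that are dual to the displacements. -/
theorem IsPrimitive.exists_eq {D : Dimer E} {z α : E → ℝ} (hz : D.IsPrimitive z α) :
    ∃ (g : D.White → ℝ) (g' : D.Black → ℝ), ∀ e,
      α e = D.dispX e * (∑ i, D.jump z i * D.dispY i) - D.dispY e * (∑ i, D.jump z i * D.dispX i) +
        (g' (D.black e) - g (D.white e)) := by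
  obtain ⟨x, y, hx, hy, hxy⟩ := D.exists_isPrimitive_disp
  have hmem : α ∈ LinearMap.range D.coboundaryAddDisp := by
    rw [range_coboundaryAddDisp]; exact LinearMap.mem_ker.2 hz.faceIntegral_eq_zero
  obtain ⟨⟨⟨g, g'⟩, a, b⟩, ht⟩ := hmem
  have ht' (e : E) : α e = g' (D.black e) - g (D.white e) + (a * D.dispX e + b * D.dispY e) :=
    (congrFun ht e).symm
  have hpair {u β : E → ℝ} (hu : D.IsPrimitive u β) : ∑ e, D.jump u e * α e =
      a * ∑ e, D.jump u e * D.dispX e + b * ∑ e, D.jump u e * D.dispY e := by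
    have h1 := hu.sum_jump_mul_coboundary g g'
    have h2 : ∑ e, D.jump u e * α e = ∑ e, (D.jump u e * (g' (D.black e) - g (D.white e)) +
        (a * (D.jump u e * D.dispX e) + b * (D.jump u e * D.dispY e))) :=
      Finset.sum_congr rfl fun e _ => by rw [ht' e]; ring
    rwa [Finset.sum_add_distrib, h1, zero_add, Finset.sum_add_distrib, ← Finset.mul_sum,
      ← Finset.mul_sum] at h2
  have hxx := hx.sum_jump_mul_swap hx
  have hyy := hy.sum_jump_mul_swap hy
  have hyx := hy.sum_jump_mul_swap hx
  have hb := hpair hx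
  have ha := hpair hy
  have hxx0 : ∑ e, D.jump x e * D.dispX e = 0 := by linarith
  have hyy0 : ∑ e, D.jump y e * D.dispY e = 0 := by linarith
  rw [hx.sum_jump_mul_swap hz, hxx0, hxy] at hb
  rw [hy.sum_jump_mul_swap hz, hyx, hxy, hyy0] at ha
  refine ⟨g, g', fun e => ?_⟩
  rw [ht' e]
  linear_combination D.dispX e * ha - D.dispY e * hb

end Dimer

/-! ### Crossings of matchings and zigzag paths -/

namespace Dimer

variable {E : Type*} [Fintype E] (D : Dimer E)

noncomputable instance : Fintype D.ZigzagPath := Fintype.ofFinite _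

/-- The number of times that the zigzag path runs along the edge, in either direction. -/
noncomputable def crossing (Z : D.ZigzagPath) (e : E) : ℤ :=
  (if D.zigOut e = Z then 1 else 0) + if D.zigIn e = Z then 1 else 0

/-- The displacement of a set of edges. -/
def totalDisp (M : Finset E) : ℤ × ℤ := ∑ e ∈ M, D.disp e

/-- From `e` to `rotB⁻¹ e` along a face, the path `zigIn e = zigOut (rotB⁻¹ e)` is shared and
cancels. The remaining terms are those of `zigOut e` and of `zigOut` at the next edge of the face,
so they telescope. -/
theorem isPrimitive_crossing (Z : D.ZigzagPath) :
    D.IsPrimitive (fun e => -(if D.zigOut e = Z then 1 else 0 : ℝ)) fun e => D.crossing Z e := by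
  intro e
  have h : D.zigIn (D.rotB⁻¹ e) = D.zigOut (facePerm D.rotW D.rotB e) := by
    rw [facePerm, Equiv.Perm.mul_apply, zigOut_rotW_inv]
  simp only [crossing, zigOut_rotB_inv, h]
  push_cast
  ring

/-- The jump is +1 on the edges that `Z` follows from white to black and -1 on those it follows from
black to white: the dual cycle of the crossing cochain is `Z` itself. -/
theorem sum_jump_crossing (Z : D.ZigzagPath) (β : E → ℝ) :
    ∑ e, D.jump (fun e => -(if D.zigOut e = Z then 1 else 0 : ℝ)) e * β e =
      ∑ e with D.zigOut e = Z, (β (D.rotW e) - β e) := by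
  have h1 := Equiv.sum_comp D.rotW fun e => if D.zigIn e = Z then β e else 0
  simp only [zigIn_rotW] at h1
  rw [Finset.sum_sub_distrib, Finset.sum_filter, h1, Finset.sum_filter, ← Finset.sum_sub_distrib]
  refine Finset.sum_congr rfl fun e _ => ?_
  simp only [jump, zigOut_rotW_inv]
  by_cases h1 : D.zigOut e = Z <;> by_cases h2 : D.zigIn e = Z <;> simp [h1, h2]

theorem sum_jump_crossing_dispX (Z : D.ZigzagPath) :
    ∑ e, D.jump (fun e => -(if D.zigOut e = Z then 1 else 0 : ℝ)) e * D.dispX e =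
      (D.winding Z).1 := by
  rw [sum_jump_crossing, winding, Prod.fst_sum]
  push_cast
  simp [dispX]

theorem sum_jump_crossing_dispY (Z : D.ZigzagPath) :
    ∑ e, D.jump (fun e => -(if D.zigOut e = Z then 1 else 0 : ℝ)) e * D.dispY e =
      (D.winding Z).2 := by
  rw [sum_jump_crossing, winding, Prod.snd_sum]
  push_cast
  simp [dispY]

/-- The number of crossings with a zigzag path is the intersection number with its winding, up to a
coboundary. -/
theorem exists_crossing_eq (Z : D.ZigzagPath) :
    ∃ (g : D.White → ℝ) (g' : D.Black → ℝ), ∀ e, (D.crossing Z e : ℝ) =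
      (wedge (D.disp e) (D.winding Z) : ℤ) + (g' (D.black e) - g (D.white e)) := by
  obtain ⟨g, g', h⟩ := (D.isPrimitive_crossing Z).exists_eq
  refine ⟨g, g', fun e => ?_⟩
  rw [h, sum_jump_crossing_dispX, sum_jump_crossing_dispY]
  simp [wedge, dispX, dispY]

/-- The zigzag paths together run along each edge once in either direction. -/
theorem sum_winding : ∑ Z, D.winding Z = 0 := by
  simp only [winding]
  rw [Finset.sum_fiberwise, Finset.sum_sub_distrib, Equiv.sum_comp D.rotW, sub_self]

variable {D}

theorem IsPerfectMatching.eq_of_white {M : Finset E} (h : D.IsPerfectMatching M) {e e' : E}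
    (he : e ∈ M) (he' : e' ∈ M) (hw : D.white e = D.white e') : e = e' :=
  (h.1 (D.white e)).unique ⟨he, rfl⟩ ⟨he', hw.symm⟩

theorem IsPerfectMatching.eq_of_black {M : Finset E} (h : D.IsPerfectMatching M) {e e' : E}
    (he : e ∈ M) (he' : e' ∈ M) (hw : D.black e = D.black e') : e = e' :=
  (h.2 (D.black e)).unique ⟨he, rfl⟩ ⟨he', hw.symm⟩

/-- With `sum_black`, this shows that a coboundary has the same sum over all perfect matchings. -/
theorem IsPerfectMatching.sum_white {A : Type*} [AddCommMonoid A] {M : Finset E}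
    (h : D.IsPerfectMatching M) (g : D.White → A) : ∑ e ∈ M, g (D.white e) = ∑ v, g v := by
  refine Finset.sum_nbij D.white (by simp) (fun e he e' he' => h.eq_of_white he he') ?_ (by simp)
  intro v _
  obtain ⟨e, he, -⟩ := h.1 v
  exact ⟨e, he⟩

theorem IsPerfectMatching.sum_black {A : Type*} [AddCommMonoid A] {M : Finset E}
    (h : D.IsPerfectMatching M) (g : D.Black → A) : ∑ e ∈ M, g (D.black e) = ∑ v, g v := by
  refine Finset.sum_nbij D.black (by simp) (fun e he e' he' => h.eq_of_black he he') ?_ (by simp)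
  intro v _
  obtain ⟨e, he, -⟩ := h.2 v
  exact ⟨e, he⟩

theorem IsPerfectMatching.card_white_eq_card_black {M : Finset E} (h : D.IsPerfectMatching M) :
    Nat.card D.White = Nat.card D.Black := by
  have h1 := h.sum_white fun _ => 1
  have h2 := h.sum_black fun _ => 1
  simp only [Finset.sum_const, smul_eq_mul, mul_one, Finset.card_univ] at h1 h2
  rw [Nat.card_eq_fintype_card, Nat.card_eq_fintype_card, ← h1, ← h2]

/-- The crossing cochain and the wedge with the winding differ by a coboundary, whose contribution
is the same for `M` and `M'`. -/
theorem IsPerfectMatching.sum_crossing_sub {M M' : Finset E} (h : D.IsPerfectMatching M)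
    (h' : D.IsPerfectMatching M') (Z : D.ZigzagPath) :
    ∑ e ∈ M, D.crossing Z e - ∑ e ∈ M', D.crossing Z e =
      wedge (D.totalDisp M - D.totalDisp M') (D.winding Z) := by
  obtain ⟨g, g', hg⟩ := D.exists_crossing_eq Z
  have key {N : Finset E} (hN : D.IsPerfectMatching N) : ((∑ e ∈ N, D.crossing Z e : ℤ) : ℝ) =
      (wedge (D.totalDisp N) (D.winding Z) : ℤ) + (∑ b, g' b - ∑ v, g v) := by
    rw [totalDisp, wedge_sum_left, ← hN.sum_white, ← hN.sum_black]
    push_cast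
    rw [← Finset.sum_sub_distrib, ← Finset.sum_add_distrib]
    exact Finset.sum_congr rfl fun e _ => hg e
  rw [wedge_sub_left]
  have h1 := key h
  have h2 := key h'
  rify
  push_cast at h1 h2
  linarith

namespace ProperlyOrdered

theorem crossing_eq (hD : D.ProperlyOrdered) (Z : D.ZigzagPath) (e : E) :
    D.crossing Z e = if D.zigOut e = Z ∨ D.zigIn e = Z then 1 else 0 := by
  have := hD.zigIn_ne_zigOut e
  by_cases h1 : D.zigOut e = Z
  · have h2 : D.zigIn e ≠ Z := fun h => this (h.trans h1.symm)
    simp [crossing, h1, h2]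
  · simp [crossing, h1]

/-- A perfect matching contains at most half of the edges of a zigzag path. -/
theorem sum_crossing_le (hD : D.ProperlyOrdered) {M : Finset E} (hM : D.IsPerfectMatching M)
    (Z : D.ZigzagPath) : ∑ e ∈ M, D.crossing Z e ≤ ∑ e, if D.zigOut e = Z then 1 else 0 := by
  simp only [hD.crossing_eq, Finset.sum_boole, Nat.cast_le]
  classical
  have hwhite (e : E) :
      D.white (if D.zigOut e = Z then e else D.rotW⁻¹ e) = D.white e := by
    split_ifs
    · rfl
    · exact D.white_rotW_inv e
  -- Each edge of `M` on `Z` is sent to an edge in the `zigOut` half of `Z` at the same white node.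
  -- This is injective, as `M` has one edge per white node.
  refine Finset.card_le_card_of_injOn (fun e => if D.zigOut e = Z then e else D.rotW⁻¹ e) ?_ ?_
  · intro e he
    simp only [Finset.coe_filter, Set.mem_ofPred_eq, Finset.mem_univ, true_and] at he ⊢
    split_ifs with h1
    · exact h1
    · exact he.2.resolve_left h1
  · intro e he e' he' h
    simp only [Finset.coe_filter, Set.mem_ofPred_eq] at he he'
    refine hM.eq_of_white he.1 he'.1 ?_
    rw [← hwhite e, ← hwhite e']
    exact congrArg D.white h

theorem le_sum_crossing_of_zigOut {M : Finset E} {Z : D.ZigzagPath}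
    (h : ∀ e, D.zigOut e = Z → e ∈ M) :
    ∑ e, (if D.zigOut e = Z then 1 else 0) ≤ ∑ e ∈ M, D.crossing Z e := by
  rw [← Finset.sum_subset (Finset.subset_univ M)]
  · exact Finset.sum_le_sum fun e _ => by unfold crossing; split_ifs <;> simp
  · intro e _ he
    exact if_neg fun h' => he (h e h')

theorem le_sum_crossing_of_zigIn {M : Finset E} {Z : D.ZigzagPath}
    (h : ∀ e, D.zigIn e = Z → e ∈ M) :
    ∑ e, (if D.zigOut e = Z then 1 else 0) ≤ ∑ e ∈ M, D.crossing Z e := by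
  have h1 := Equiv.sum_comp D.rotW fun e => if D.zigIn e = Z then (1 : ℤ) else 0
  simp only [zigIn_rotW] at h1
  rw [h1, ← Finset.sum_subset (Finset.subset_univ M)]
  · exact Finset.sum_le_sum fun e _ => by unfold crossing; split_ifs <;> simp
  · intro e _ he
    exact if_neg fun h' => he (h e h')

/-- The matching `M₀` has the largest possible number of edges on `Z`, and the difference of these
numbers is the wedge. -/
theorem wedge_nonneg_of_le (hD : D.ProperlyOrdered) {M M₀ : Finset E}
    (hM : D.IsPerfectMatching M) (hM₀ : D.IsPerfectMatching M₀) {Z : D.ZigzagPath}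
    (h : ∑ e, (if D.zigOut e = Z then 1 else 0) ≤ ∑ e ∈ M₀, D.crossing Z e) :
    0 ≤ wedge (D.winding Z) (D.totalDisp M - D.totalDisp M₀) := by
  have h1 := hM.sum_crossing_sub hM₀ Z
  have h2 := hD.sum_crossing_le hM Z
  rw [wedge_swap]
  linarith

theorem zigOut_mem_rayMatching (hD : D.ProperlyOrdered) {r : ℝ × ℝ} (hr : D.IsGenericRay r)
    {e : E} (h : D.IsFirstCcw r Set.univ (D.zigOut e)) : e ∈ D.rayMatching r :=
  (hD.mem_rayMatching hr).2 <|
    ((hD.ccw_or_ccw hr (hD.not_sameDir e)).resolve_left (h _ trivial)).rotate.rotate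

theorem zigIn_mem_rayMatching (hD : D.ProperlyOrdered) {r : ℝ × ℝ} (hr : D.IsGenericRay r)
    {e : E} (h : D.IsFirstCw r Set.univ (D.zigIn e)) : e ∈ D.rayMatching r :=
  (hD.mem_rayMatching hr).2 <|
    ((hD.ccw_or_ccw hr (hD.not_sameDir e)).resolve_left
      fun h' => h _ trivial h'.rotate).rotate.rotate

/-- The displacement of any perfect matching lies in the half plane to the left of the winding of the
zigzag path next to the ray, counterclockwise. -/
theorem wedge_nonneg_of_isFirstCcw (hD : D.ProperlyOrdered) {r : ℝ × ℝ} (hr : D.IsGenericRay r)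
    {Z : D.ZigzagPath} (h : D.IsFirstCcw r Set.univ Z) {M : Finset E}
    (hM : D.IsPerfectMatching M) :
    0 ≤ wedge (D.winding Z) (D.totalDisp M - D.totalDisp (D.rayMatching r)) :=
  hD.wedge_nonneg_of_le hM (hD.isPerfectMatching_rayMatching hr) <|
    le_sum_crossing_of_zigOut fun e he => hD.zigOut_mem_rayMatching hr (by rwa [he])

theorem wedge_nonneg_of_isFirstCw (hD : D.ProperlyOrdered) {r : ℝ × ℝ} (hr : D.IsGenericRay r)
    {Z : D.ZigzagPath} (h : D.IsFirstCw r Set.univ Z) {M : Finset E}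
    (hM : D.IsPerfectMatching M) :
    0 ≤ wedge (D.winding Z) (D.totalDisp M - D.totalDisp (D.rayMatching r)) :=
  hD.wedge_nonneg_of_le hM (hD.isPerfectMatching_rayMatching hr) <|
    le_sum_crossing_of_zigIn fun e he => hD.zigIn_mem_rayMatching hr (by rwa [he])

end ProperlyOrdered

end Dimer

/-! ### Rays with one winding direction between them -/

theorem Ccw.not_sameDir {u v w : ℝ × ℝ} (h : Ccw u v w) : ¬ SameDir u w := by
  rintro ⟨h0, hpos⟩
  have h1 : wedge w u = 0 := by rw [wedge_swap, h0, neg_zero]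
  have h2 : 0 < wedge u v ∧ 0 < wedge v w := by
    unfold Ccw at h; rw [h1] at h; simpa using h
  have key : (u.1 * u.1 + u.2 * u.2) * wedge v w
      = -((u.1 * w.1 + u.2 * w.2) * wedge u v) + wedge u w * (u.1 * v.1 + u.2 * v.2) := by
    simp only [wedge]; ring
  rw [h0, zero_mul, add_zero] at key
  have h3 := mul_pos hpos h2.1
  have h4 := mul_nonneg (add_nonneg (mul_self_nonneg u.1) (mul_self_nonneg u.2)) h2.2.le
  linarith

namespace Dimer

variable {E : Type*} [Fintype E] {D : Dimer E}

namespace ProperlyOrdered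

theorem ccw_of_not_between (hD : D.ProperlyOrdered) {r₁ r₂ : ℝ × ℝ} (h₁ : D.IsGenericRay r₁)
    (h₂ : D.IsGenericRay r₂) (h : ¬ SameDir r₁ r₂) {Z : D.ZigzagPath}
    (hZ : ¬ Ccw r₁ (D.windingR Z) r₂) : Ccw r₁ r₂ (D.windingR Z) :=
  (_root_.ccw_or_ccw h₁.1 (hD.windingR_ne_zero Z) h₂.1 (h₁.2 Z) h
    fun h' => h₂.2 Z h'.symm).resolve_left hZ

section Between

variable {r₁ r₂ : ℝ × ℝ} {w : ℤ × ℤ}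

/-- Turning from `r₁` to `r₂`, the ray leaves the sectors that end at `w`. The other boundary of
such a sector is not passed, because paths of equal winding do not share an edge. -/
theorem mem_rayMatching_of_zigOut (hD : D.ProperlyOrdered) (h₁ : D.IsGenericRay r₁)
    (h₂ : D.IsGenericRay r₂) (h : ∀ Z, Ccw r₁ (D.windingR Z) r₂ ↔ D.winding Z = w) {e : E}
    (he : D.winding (D.zigOut e) = w) : e ∈ D.rayMatching r₁ ∧ e ∉ D.rayMatching r₂ := by
  have hb := (h _).2 he
  have ha := hD.ccw_of_not_between h₁ h₂ hb.not_sameDir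
    fun h' => hD.winding_ne e (((h _).1 h').trans he.symm)
  rw [hD.mem_rayMatching h₁, hD.mem_rayMatching h₂]
  exact ⟨(hb.trans ha).rotate.rotate, fun h' => h'.rotate.not_swap (hb.trans_right ha).rotate⟩

/-- The ray enters the sectors that begin at `w`. -/
theorem mem_rayMatching_of_zigIn (hD : D.ProperlyOrdered) (h₁ : D.IsGenericRay r₁)
    (h₂ : D.IsGenericRay r₂) (h : ∀ Z, Ccw r₁ (D.windingR Z) r₂ ↔ D.winding Z = w) {e : E}
    (he : D.winding (D.zigIn e) = w) : e ∉ D.rayMatching r₁ ∧ e ∈ D.rayMatching r₂ := by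
  have ha := (h _).2 he
  have hb := hD.ccw_of_not_between h₁ h₂ ha.not_sameDir
    fun h' => hD.winding_ne e (he.trans ((h _).1 h').symm)
  rw [hD.mem_rayMatching h₁, hD.mem_rayMatching h₂]
  exact ⟨fun h' => h'.rotate.not_swap (ha.trans hb), ha.trans_right hb⟩

theorem mem_rayMatching_iff (hD : D.ProperlyOrdered) (h₁ : D.IsGenericRay r₁)
    (h₂ : D.IsGenericRay r₂) (hne : ¬ SameDir r₁ r₂)
    (h : ∀ Z, Ccw r₁ (D.windingR Z) r₂ ↔ D.winding Z = w) {e : E}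
    (he : D.winding (D.zigIn e) ≠ w) (he' : D.winding (D.zigOut e) ≠ w) :
    e ∈ D.rayMatching r₁ ↔ e ∈ D.rayMatching r₂ := by
  have ha := hD.ccw_of_not_between h₁ h₂ hne fun h' => he ((h _).1 h')
  have hb := hD.ccw_of_not_between h₁ h₂ hne fun h' => he' ((h _).1 h')
  rw [hD.mem_rayMatching h₁, hD.mem_rayMatching h₂]
  constructor
  · intro h'
    exact (hb.trans_right h'.rotate).rotate.rotate
  · intro h'
    rcases hD.ccw_or_ccw h₁ (hD.not_sameDir e) with h3 | h3
    · exact absurd (ha.trans_right h3) h'.rotate.not_swap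
    · exact h3.rotate.rotate

/-- Crossing the direction `w` changes the displacement by the sum of the windings of direction
`w`. -/
theorem totalDisp_sub (hD : D.ProperlyOrdered) (h₁ : D.IsGenericRay r₁)
    (h₂ : D.IsGenericRay r₂) (hw : ∃ Z, D.winding Z = w)
    (h : ∀ Z, Ccw r₁ (D.windingR Z) r₂ ↔ D.winding Z = w) :
    D.totalDisp (D.rayMatching r₂) - D.totalDisp (D.rayMatching r₁) =
      Nat.card {Z : D.ZigzagPath // D.winding Z = w} • w := by
  classical
  have hne : ¬ SameDir r₁ r₂ := by
    obtain ⟨Z, hZ⟩ := hw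
    exact ((h Z).2 hZ).not_sameDir
  have key (e : E) : (if e ∈ D.rayMatching r₂ then D.disp e else 0) -
      (if e ∈ D.rayMatching r₁ then D.disp e else 0) =
      (if D.winding (D.zigIn e) = w then D.disp e else 0) -
      (if D.winding (D.zigOut e) = w then D.disp e else 0) := by
    by_cases hb : D.winding (D.zigOut e) = w
    · have ha : D.winding (D.zigIn e) ≠ w := fun h' => hD.winding_ne e (h'.trans hb.symm)
      have := hD.mem_rayMatching_of_zigOut h₁ h₂ h hb
      rw [if_pos this.1, if_neg this.2, if_pos hb, if_neg ha]
    · by_cases ha : D.winding (D.zigIn e) = w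
      · have := hD.mem_rayMatching_of_zigIn h₁ h₂ h ha
        rw [if_neg this.1, if_pos this.2, if_neg hb, if_pos ha]
      · simp only [hD.mem_rayMatching_iff h₁ h₂ hne h ha hb, if_neg ha, if_neg hb, sub_self]
  have h1 := Equiv.sum_comp D.rotW fun e => if D.winding (D.zigIn e) = w then D.disp e else 0
  simp only [zigIn_rotW] at h1
  have h2 : ∑ Z with D.winding Z = w, D.winding Z =
      Nat.card {Z : D.ZigzagPath // D.winding Z = w} • w := by
    rw [Finset.sum_congr rfl fun Z hZ => (Finset.mem_filter.1 hZ).2, Finset.sum_const,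
      Nat.card_eq_fintype_card, Fintype.card_subtype]
  rw [← h2]
  have h3 (M : Finset E) : D.totalDisp M = ∑ e, if e ∈ M then D.disp e else 0 := by
    rw [totalDisp, Finset.sum_ite_mem, Finset.univ_inter]
  rw [h3, h3, ← Finset.sum_sub_distrib, Finset.sum_congr rfl fun e _ => key e,
    Finset.sum_sub_distrib, ← h1, ← Finset.sum_sub_distrib, Finset.sum_filter,
    ← Finset.sum_fiberwise (s := Finset.univ) (g := D.zigOut)]
  refine Finset.sum_congr rfl fun Z _ => ?_
  by_cases hZ : D.winding Z = w
  · rw [if_pos hZ, winding]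
    refine Finset.sum_congr rfl fun e he => ?_
    rw [(Finset.mem_filter.1 he).2, if_pos hZ, if_pos hZ]
  · rw [if_neg hZ]
    refine Finset.sum_eq_zero fun e he => ?_
    rw [(Finset.mem_filter.1 he).2, if_neg hZ, if_neg hZ, sub_self]

end Between

/-! ### Windings are primitive vectors -/

/-- If `k ≥ 2` divided the winding, then the crossing numbers would be a coboundary modulo `k`, and
since the path is simple this coboundary could be lifted. -/
theorem eq_one_of_winding_eq_smul (hD : D.ProperlyOrdered) {Z : D.ZigzagPath} {k : ℤ} {v : ℤ × ℤ}
    (hk : 0 < k) (h : D.winding Z = k • v) : k = 1 := by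
  by_contra hk1
  obtain ⟨g, g', hg⟩ := D.exists_crossing_eq Z
  obtain ⟨e₀, he₀⟩ := D.zigOut_surjective Z
  -- The potentials `g`, `g'` are real, so congruence to zero modulo `k` is expressed by being an
  -- integer multiple of `k`.
  let Q : ℝ → Prop := fun t => ∃ m : ℤ, t = k * m
  have hQadd {s t : ℝ} (hs : Q s) (ht : Q t) : Q (s + t) := by
    obtain ⟨m, rfl⟩ := hs
    obtain ⟨n, rfl⟩ := ht
    exact ⟨m + n, by push_cast; ring⟩
  have hQneg {s : ℝ} (hs : Q s) : Q (-s) := by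
    obtain ⟨m, rfl⟩ := hs
    exact ⟨-m, by push_cast; ring⟩
  have hQ1 : ¬ Q 1 := by
    rintro ⟨m, hm⟩
    have hm' : 1 = k * m := by exact_mod_cast hm
    exact hk1 (Int.eq_one_of_mul_eq_one_right hk.le hm'.symm)
  have hgQ (e : E) : Q (g' (D.black e) - g (D.white e) - D.crossing Z e) := by
    refine ⟨-wedge (D.disp e) v, ?_⟩
    rw [hg e, h]
    simp only [wedge, Prod.smul_fst, Prod.smul_snd, smul_eq_mul]
    push_cast
    ring
  have hout {e : E} (he : D.zigOut e = Z) : D.crossing Z e = 1 := by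
    rw [hD.crossing_eq, if_pos (Or.inl he)]
  have hin {e : E} (he : D.zigIn e = Z) : D.crossing Z e = 1 := by
    rw [hD.crossing_eq, if_pos (Or.inr he)]
  -- Each edge of `Z` is crossed exactly once. From a white node of `Z` to the next one the
  -- potential gains 1 and loses 1 modulo `k`, so it is constant modulo `k` on these nodes.
  have hstep {e : E} (he : D.zigOut e = Z) (hQe : Q (g (D.white e) - g (D.white e₀))) :
      Q (g (D.white (D.zigzagPerm e)) - g (D.white e₀)) := by
    have h1 := hgQ (D.rotW e)
    have h2 := hgQ (D.zigzagPerm e)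
    rw [hin (by rw [zigIn_rotW, he]), white_rotW] at h1
    rw [hout (by rw [zigOut_zigzagPerm, he]), zigzagPerm, Equiv.Perm.mul_apply,
      black_rotB_inv] at h2
    have h3 := hQadd (hQadd h1 (hQneg h2)) hQe
    rw [zigzagPerm, Equiv.Perm.mul_apply]
    convert h3 using 1
    ring
  have hZout {e : E} (he : D.zigOut e = Z) : Q (g (D.white e) - g (D.white e₀)) := by
    obtain ⟨n, rfl⟩ := (D.zigOut_eq_zigOut.1 (he₀.trans he.symm)).exists_nat_pow_eq
    clear he
    suffices hn : D.zigOut ((D.zigzagPerm ^ n) e₀) = Z ∧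
        Q (g (D.white ((D.zigzagPerm ^ n) e₀)) - g (D.white e₀)) from hn.2
    induction n with
    | zero => exact ⟨he₀, 0, by simp⟩
    | succ n ih =>
      rw [pow_succ', Equiv.Perm.mul_apply]
      exact ⟨by rw [zigOut_zigzagPerm, ih.1], hstep ih.1 ih.2⟩
  have hZ {e : E} (he : D.zigOut e = Z ∨ D.zigIn e = Z) : Q (g (D.white e) - g (D.white e₀)) := by
    rcases he with he | he
    · exact hZout he
    · rw [← D.white_rotW_inv e]; exact hZout he
  classical
  -- The lift: nodes congruent to the white nodes of `Z` get 0, all others 1. As `k ≠ 1`, the black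
  -- nodes of `Z` get 1, so the coboundary is 1 on `Z`. Off `Z` both ends of an edge lie in the same
  -- congruence class and it is 0.
  let G : D.White → ℝ := fun v => if Q (g v - g (D.white e₀)) then 0 else 1
  let G' : D.Black → ℝ := fun b => if Q (g' b - g (D.white e₀)) then 0 else 1
  have hG (e : E) : (D.crossing Z e : ℝ) = G' (D.black e) - G (D.white e) := by
    have h1 := hgQ e
    by_cases he : D.zigOut e = Z ∨ D.zigIn e = Z
    · rw [hD.crossing_eq, if_pos he] at h1 ⊢
      have h2 := hZ he
      have h3 : ¬ Q (g' (D.black e) - g (D.white e₀)) := fun h3 => hQ1 <| by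
        have := hQadd h3 (hQneg (hQadd h1 h2))
        convert this using 1
        push_cast; ring
      simp [G, G', h2, h3]
    · rw [hD.crossing_eq, if_neg he] at h1 ⊢
      have h4 : Q (g' (D.black e) - g (D.white e₀)) ↔ Q (g (D.white e) - g (D.white e₀)) := by
        constructor
        · intro h3
          convert hQadd h3 (hQneg h1) using 1
          push_cast; ring
        · intro h3
          convert hQadd h3 h1 using 1
          push_cast; ring
      simp [G, G', h4]
  -- An exact coboundary pairs to zero with the cycles dual to the displacements, whereas the
  -- crossing cochain pairs to the winding up to sign.
  obtain ⟨x, y, hx, hy, -⟩ := D.exists_isPrimitive_disp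
  have hx' := hx.sum_jump_mul_swap (D.isPrimitive_crossing Z)
  have hy' := hy.sum_jump_mul_swap (D.isPrimitive_crossing Z)
  simp only [hG] at hx' hy'
  rw [hx.sum_jump_mul_coboundary, sum_jump_crossing_dispX] at hx'
  rw [hy.sum_jump_mul_coboundary, sum_jump_crossing_dispY] at hy'
  refine hD.winding_ne_zero Z (Prod.ext ?_ ?_)
  · have : ((D.winding Z).1 : ℝ) = 0 := by linarith
    exact_mod_cast this
  · have : ((D.winding Z).2 : ℝ) = 0 := by linarith
    exact_mod_cast this

theorem isCoprime_winding (hD : D.ProperlyOrdered) (Z : D.ZigzagPath) :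
    IsCoprime (D.winding Z).1 (D.winding Z).2 := by
  rw [Int.isCoprime_iff_gcd_eq_one]
  have hpos : 0 < Int.gcd (D.winding Z).1 (D.winding Z).2 := by
    refine Nat.pos_of_ne_zero fun h => hD.winding_ne_zero Z ?_
    rw [Int.gcd_eq_zero_iff] at h
    exact Prod.ext h.1 h.2
  obtain ⟨a, ha⟩ := Int.gcd_dvd_left (D.winding Z).1 (D.winding Z).2
  obtain ⟨b, hb⟩ := Int.gcd_dvd_right (D.winding Z).1 (D.winding Z).2
  have := hD.eq_one_of_winding_eq_smul (Z := Z) (v := (a, b))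
    (k := Int.gcd (D.winding Z).1 (D.winding Z).2) (by exact_mod_cast hpos) (Prod.ext ha hb)
  exact_mod_cast this

end ProperlyOrdered

end Dimer

theorem exists_eq_zsmul_of_wedge_eq_zero {u w : ℤ × ℤ} (hw : IsCoprime w.1 w.2)
    (h : wedge w u = 0) : ∃ t : ℤ, u = t • w := by
  obtain ⟨a, b, hab⟩ := hw
  simp only [wedge] at h
  refine ⟨a * u.1 + b * u.2, Prod.ext ?_ ?_⟩
  · simp only [Prod.smul_fst, smul_eq_mul]
    linear_combination (-u.1) * hab - b * h
  · simp only [Prod.smul_snd, smul_eq_mul]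
    linear_combination (-u.2) * hab + a * h

theorem eq_of_sameDir {u w : ℤ × ℤ} (hu : IsCoprime u.1 u.2) (hw : IsCoprime w.1 w.2)
    (h : SameDir u w) : u = w := by
  obtain ⟨t, ht⟩ := exists_eq_zsmul_of_wedge_eq_zero hu h.1
  obtain ⟨s, hs⟩ := exists_eq_zsmul_of_wedge_eq_zero hw h.symm.1
  have hpos := h.2
  have hu0 : u ≠ 0 := by rintro rfl; simp at hpos
  have h1 := normSq_pos hu0
  rw [ht] at hpos
  simp only [Prod.smul_fst, Prod.smul_snd, smul_eq_mul] at hpos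
  have htpos : 0 < t := by
    have : 0 < t * (u.1 * u.1 + u.2 * u.2) := by linarith
    exact pos_of_mul_pos_left this h1.le
  have hst : (s * t - 1) * (u.1 * u.1 + u.2 * u.2) = 0 := by
    have e1 := congrArg Prod.fst hs
    have e2 := congrArg Prod.snd hs
    rw [ht] at e1 e2
    simp only [Prod.smul_fst, Prod.smul_snd, smul_eq_mul] at e1 e2
    linear_combination (-u.1) * e1 - u.2 * e2
  have hst' : t * s = 1 := by
    have := (mul_eq_zero.1 hst).resolve_right h1.ne'
    linarith
  have : t = 1 := Int.eq_one_of_mul_eq_one_right htpos.le hst'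
  rw [ht, this, one_smul]

/-! ### The two zigzag paths next to a ray -/

theorem eq_zero_of_wedge_eq_zero {R : Type*} [CommRing R] [IsDomain R] {u v x : R × R}
    (h : wedge u v ≠ 0) (hu : wedge u x = 0) (hv : wedge v x = 0) : x = 0 := by
  simp only [wedge] at *
  refine Prod.ext ?_ ?_
  · refine (mul_eq_zero.1 (?_ : (u.1 * v.2 - u.2 * v.1) * x.1 = 0)).resolve_left h
    linear_combination v.1 * hu - u.1 * hv
  · refine (mul_eq_zero.1 (?_ : (u.1 * v.2 - u.2 * v.1) * x.2 = 0)).resolve_left h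
    linear_combination v.2 * hu - u.2 * hv

/-- The local form of an exchange: `π` moves the chosen edge within its own node, so the node keeps
exactly one edge. It serves both colours. -/
theorem existsUnique_exchange {E N : Type*} {ν : E → N} {π : Equiv.Perm E}
    (hν : ∀ e, ν (π e) = ν e) {M A A' : E → Prop} (hA : ∀ e, A e → M e)
    (hA' : ∀ e, A' (π e) ↔ A e) {v : N} (h : ∃! e, M e ∧ ν e = v) :
    ∃! e, ((M e ∧ ¬ A e) ∨ A' e) ∧ ν e = v := by
  obtain ⟨e, ⟨he, rfl⟩, huniq⟩ := h
  have key {e'} (h1 : A' e') (h2 : ν e' = ν e) : A e ∧ e' = π e := by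
    have h3 : A (π⁻¹ e') := by rw [← hA', perm_apply_inv]; exact h1
    have h4 : π⁻¹ e' = e := huniq _ ⟨hA _ h3, by rw [← hν, perm_apply_inv, h2]⟩
    rw [h4] at h3
    exact ⟨h3, by rw [← h4, perm_apply_inv]⟩
  by_cases hAe : A e
  · refine ⟨π e, ⟨Or.inr ((hA' e).2 hAe), hν e⟩, ?_⟩
    rintro e' ⟨⟨h1, h1'⟩ | h1, h2⟩
    · exact absurd (huniq _ ⟨h1, h2⟩ ▸ hAe) h1'
    · exact (key h1 h2).2
  · refine ⟨e, ⟨Or.inl ⟨he, hAe⟩, rfl⟩, ?_⟩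
    rintro e' ⟨⟨h1, h1'⟩ | h1, h2⟩
    · exact huniq _ ⟨h1, h2⟩
    · exact absurd (key h1 h2).1 hAe

theorem exists_first_ccw {ι : Type*} [Finite ι] (r : ℝ × ℝ) (V : ι → ℝ × ℝ) {S : Set ι}
    (hS : S.Nonempty) : ∃ i ∈ S, ∀ j ∈ S, ¬ Ccw r (V j) (V i) := by
  let lt : ι → ι → Prop := fun a b => Ccw r (V a) (V b)
  have : IsTrans ι lt := ⟨fun a b c h1 h2 => Ccw.trans h1 h2⟩
  have : Std.Irrefl lt := ⟨fun a h => not_ccw_self_right _ _ h⟩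
  exact (Finite.wellFounded_of_trans_of_irrefl lt).has_min S hS

namespace Dimer

variable {E : Type*} [Fintype E] {D : Dimer E}

variable (D) in
theorem exists_isFirstCcw (r : ℝ × ℝ) : ∃ Z, D.IsFirstCcw r Set.univ Z := by
  obtain ⟨e⟩ := D.nonempty_edge
  obtain ⟨Z, -, hZ⟩ := exists_first_ccw r D.windingR ⟨D.zigOut e, Set.mem_univ _⟩
  exact ⟨Z, fun Y hY => hZ Y hY⟩

variable (D) in
theorem exists_isFirstCw (r : ℝ × ℝ) : ∃ Z, D.IsFirstCw r Set.univ Z := by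
  obtain ⟨e⟩ := D.nonempty_edge
  obtain ⟨Z, -, hZ⟩ := exists_last_ccw r D.windingR ⟨D.zigOut e, Set.mem_univ _⟩
  exact ⟨Z, fun Y hY h => hZ Y hY h.rotate.rotate⟩

namespace ProperlyOrdered

/-- The windings are not all parallel: otherwise all nodes would be bivalent. -/
theorem exists_wedge_ne_zero (hD : D.ProperlyOrdered) {u : ℤ × ℤ} (hu : u ≠ 0) :
    ∃ Z, wedge u (D.winding Z) ≠ 0 := by
  by_contra! h
  have hpar (Y Z : D.ZigzagPath) : wedge (D.windingR Y) (D.windingR Z) = 0 := by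
    have key : (u.1 * u.1 + u.2 * u.2) * wedge (D.winding Y) (D.winding Z) = 0 := by
      have hY := h Y
      have hZ := h Z
      simp only [wedge] at *
      linear_combination (u.1 * (D.winding Y).1 + u.2 * (D.winding Y).2) * hZ -
        (u.1 * (D.winding Z).1 + u.2 * (D.winding Z).2) * hY
    rw [windingR, windingR, wedge_toReal, (mul_eq_zero.1 key).resolve_left (normSq_pos hu).ne',
      Int.cast_zero]
  have hccw (X Y Z : D.ZigzagPath) : ¬ Ccw (D.windingR X) (D.windingR Y) (D.windingR Z) := by
    simp [Ccw, hpar]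
  have hW (e : E) : D.rotW (D.rotW e) = e := by
    by_contra hne
    exact hccw _ _ _ (hD.cyclicallyOrdered_white.ccw e (D.rotW (D.rotW e))
      (Equiv.Perm.SameCycle.refl _ _).apply_right.apply_right hne
      (hD.cyclicallyOrdered_white.apply_ne _))
  have hB (e : E) : D.rotB (D.rotB e) = e := by
    by_contra hne
    exact hccw _ _ _ (hD.cyclicallyOrdered_black.ccw e (D.rotB (D.rotB e))
      (Equiv.Perm.SameCycle.refl _ _).apply_right.apply_right hne
      (hD.cyclicallyOrdered_black.apply_ne _))
  -- At a bivalent node the two jumps are opposite. Since the graph is connected, the two dual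
  -- cycles are then proportional, which contradicts their pairing 1 because the pairing is
  -- alternating.
  have hjW (x : E → ℝ) (e : E) : D.jump x (D.rotW e) = -D.jump x e := by
    have : D.rotW⁻¹ e = D.rotW e := by
      conv_lhs => rw [← hW e, perm_inv_apply]
    rw [jump, jump, perm_inv_apply, this]; ring
  have hjB {x α : E → ℝ} (hx : D.IsPrimitive x α) (e : E) :
      D.jump x (D.rotB e) = -D.jump x e := by
    rw [hx.jump_eq, hx.jump_eq, hB]; ring
  obtain ⟨x, y, hx, hy, hxy⟩ := D.exists_isPrimitive_disp
  obtain ⟨e₀⟩ := D.nonempty_edge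
  have hx0 : D.jump x e₀ ≠ 0 := fun h0 => by
    have hall : ∀ e, D.jump x e = 0 := D.forall_of_invariant
      (fun e => by rw [hjW, neg_eq_zero]) (fun e => by rw [hjB hx, neg_eq_zero]) h0
    simp [hall] at hxy
  have hall : ∀ e, D.jump y e = D.jump y e₀ / D.jump x e₀ * D.jump x e := D.forall_of_invariant
    (fun e => by rw [hjW, hjW, mul_neg, neg_inj])
    (fun e => by rw [hjB hx, hjB hy, mul_neg, neg_inj]) (e := e₀) (by field_simp)
  have hxx := hx.sum_jump_mul_swap hx
  have hyx := hy.sum_jump_mul_swap hx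
  have hxx0 : ∑ e, D.jump x e * D.dispX e = 0 := by linarith
  generalize D.jump y e₀ / D.jump x e₀ = t at hall
  simp only [hall, mul_assoc] at hyx
  rw [← Finset.mul_sum, hxx0, hxy] at hyx
  linarith

/-- The windings next to a ray enclose an angle less than a half turn. -/
theorem wedge_pos_of_isFirst (hD : D.ProperlyOrdered) {r : ℝ × ℝ} (hr : D.IsGenericRay r)
    {Z₁ Z₂ : D.ZigzagPath} (h₁ : D.IsFirstCw r Set.univ Z₁) (h₂ : D.IsFirstCcw r Set.univ Z₂) :
    0 < wedge (D.winding Z₁) (D.winding Z₂) := by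
  by_contra hneg
  have hneg' : wedge (D.windingR Z₁) (D.windingR Z₂) ≤ 0 := by
    rw [windingR, windingR, wedge_toReal]; exact_mod_cast not_lt.1 hneg
  have hswap := wedge_swap (D.windingR Z₁) (D.windingR Z₂)
  -- If the angle were a half turn or more, all windings would lie in the closed half plane to the
  -- left of `Z₂`. Their sum being zero, they would all be parallel to `Z₂`.
  have hnn (Z : D.ZigzagPath) : 0 ≤ wedge (D.winding Z₂) (D.winding Z) := by
    suffices 0 ≤ wedge (D.windingR Z₂) (D.windingR Z) by
      rw [windingR, windingR, wedge_toReal] at this; exact_mod_cast this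
    by_cases hs2 : SameDir (D.windingR Z₂) (D.windingR Z)
    · exact hs2.1.ge
    have c2 := (hD.ccw_or_ccw hr hs2).resolve_right (h₂ Z trivial)
    by_cases hs1 : SameDir (D.windingR Z₁) (D.windingR Z)
    · obtain ⟨h3, h4⟩ := hs1
      have h5 := normSq_pos (hD.windingR_ne_zero Z₁)
      generalize D.windingR Z₁ = a at *
      generalize D.windingR Z₂ = b at *
      generalize D.windingR Z = c at *
      have key : (a.1 * a.1 + a.2 * a.2) * wedge b c =
          (a.1 * c.1 + a.2 * c.2) * wedge b a + wedge a c * (a.1 * b.1 + a.2 * b.2) := by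
        simp only [wedge]; ring
      rw [h3, zero_mul, add_zero] at key
      have h6 := mul_nonneg h4.le (by linarith : 0 ≤ wedge b a)
      rw [← key] at h6
      exact nonneg_of_mul_nonneg_right h6 h5
    · have c1 := (hD.ccw_or_ccw hr hs1).resolve_left fun h => h₁ Z trivial h.rotate
      have c3 := c2.trans_right c1
      unfold Ccw at c3
      rcases c3 with c3 | c3 | c3
      · exact c3.1.le
      · linarith [c3.2]
      · linarith [c3.1]
  have hsum : ∑ Z, wedge (D.winding Z₂) (D.winding Z) = 0 := by
    rw [← wedge_sum_right, sum_winding]; simp [wedge]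
  obtain ⟨Z, hZ⟩ := hD.exists_wedge_ne_zero (hD.winding_ne_zero Z₂)
  exact hZ ((Finset.sum_eq_zero_iff_of_nonneg fun Z _ => hnn Z).1 hsum Z (Finset.mem_univ _))

end ProperlyOrdered

/-! ### Exchanging the two halves of a zigzag path -/

/-- The set `A` of edges of `M` is replaced by `A'`. Both `πW` and `πB` carry `A` onto `A'`, so the
balance is kept at white and at black nodes. -/
theorem IsPerfectMatching.exchange {M : Finset E} (hM : D.IsPerfectMatching M)
    {πW πB : Equiv.Perm E} (hW : ∀ e, D.white (πW e) = D.white e)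
    (hB : ∀ e, D.black (πB e) = D.black e) {A A' : E → Prop} (hA : ∀ e, A e → e ∈ M)
    (hAW : ∀ e, A' (πW e) ↔ A e) (hAB : ∀ e, A' (πB e) ↔ A e)
    (hdisj : ∀ e, A' e → ¬ A e) :
    ∃ M' : Finset E, D.IsPerfectMatching M' ∧ ∀ f : E → ℤ × ℤ, ∀ [DecidablePred A]
      [DecidablePred A'], ∑ e ∈ M', f e =
        ∑ e ∈ M, f e + ∑ e, ((if A' e then f e else 0) - if A e then f e else 0) := by
  classical
  refine ⟨Finset.univ.filter fun e => (e ∈ M ∧ ¬ A e) ∨ A' e, ⟨fun v => ?_, fun b => ?_⟩, ?_⟩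
  · simpa using existsUnique_exchange hW hA hAW (hM.1 v)
  · simpa using existsUnique_exchange hB hA hAB (hM.2 b)
  · intro f _ _
    rw [← Finset.univ_inter M, ← Finset.sum_ite_mem, ← Finset.sum_add_distrib, Finset.sum_filter]
    refine Finset.sum_congr rfl fun e _ => ?_
    by_cases h1 : A' e
    · have h2 : e ∉ M := fun he => hdisj e h1 <| by
        have h3 : A (πW⁻¹ e) := by rw [← hAW, perm_apply_inv]; exact h1
        have h4 : πW⁻¹ e = e := hM.eq_of_white (hA _ h3) he (by rw [← hW, perm_apply_inv])
        rwa [h4] at h3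
      simp [h1, h2, hdisj e h1]
    · by_cases h2 : A e
      · simp [h1, h2, hA e h2]
      · simp [h1, h2]

theorem sum_zigIn_sub_sum_zigOut (Z : D.ZigzagPath) :
    ∑ e, ((if D.zigIn e = Z then D.disp e else 0) - if D.zigOut e = Z then D.disp e else 0) =
      D.winding Z := by
  have h1 := Equiv.sum_comp D.rotW fun e => if D.zigIn e = Z then D.disp e else 0
  simp only [zigIn_rotW] at h1
  rw [Finset.sum_sub_distrib, ← h1, winding, Finset.sum_filter, ← Finset.sum_sub_distrib]
  exact Finset.sum_congr rfl fun e _ => by split_ifs <;> simp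

namespace ProperlyOrdered

/-- The `zigOut` half of `Z` is exchanged for its `zigIn` half. The difference of their
displacements is the winding. -/
theorem exists_totalDisp_add (hD : D.ProperlyOrdered) {M : Finset E} (hM : D.IsPerfectMatching M)
    {Z : D.ZigzagPath} (h : ∀ e, D.zigOut e = Z → e ∈ M) :
    ∃ M', D.IsPerfectMatching M' ∧ D.totalDisp M' = D.totalDisp M + D.winding Z := by
  obtain ⟨M', hM', hsum⟩ := hM.exchange (A' := fun e => D.zigIn e = Z) D.white_rotW D.black_rotB h
    (fun e => by rw [zigIn_rotW]) (fun e => by rw [zigIn_rotB])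
    (fun e h1 h2 => hD.zigIn_ne_zigOut e (h1.trans h2.symm))
  exact ⟨M', hM', by rw [totalDisp, hsum, sum_zigIn_sub_sum_zigOut]; rfl⟩

theorem exists_totalDisp_sub (hD : D.ProperlyOrdered) {M : Finset E} (hM : D.IsPerfectMatching M)
    {Z : D.ZigzagPath} (h : ∀ e, D.zigIn e = Z → e ∈ M) :
    ∃ M', D.IsPerfectMatching M' ∧ D.totalDisp M' = D.totalDisp M - D.winding Z := by
  obtain ⟨M', hM', hsum⟩ := hM.exchange (A' := fun e => D.zigOut e = Z) D.white_rotW_inv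
    D.black_rotB_inv h (fun e => by rw [zigOut_rotW_inv]) (fun e => by rw [zigOut_rotB_inv])
    (fun e h1 h2 => hD.zigIn_ne_zigOut e (h2.trans h1.symm))
  refine ⟨M', hM', ?_⟩
  rw [totalDisp, hsum, ← sum_zigIn_sub_sum_zigOut, sub_eq_add_neg, ← Finset.sum_neg_distrib]
  simp only [neg_sub]
  rfl

/-! ### The matching of a ray is determined by its displacement -/

theorem ccw_zigIn_zigOut (hD : D.ProperlyOrdered) {r : ℝ × ℝ} (hr : D.IsGenericRay r) {e : E}
    (he : e ∉ D.rayMatching r) : Ccw r (D.windingR (D.zigIn e)) (D.windingR (D.zigOut e)) :=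
  (hD.ccw_or_ccw hr (hD.not_sameDir e)).resolve_right
    fun h => he ((hD.mem_rayMatching hr).2 h.rotate.rotate)

/-- At the node of `m`, turning counterclockwise from `r`, the last path met is `zigIn m`. So
`zigOut e` is either that path or is met earlier. -/
theorem eq_rotW_or_ccw (hD : D.ProperlyOrdered) {r : ℝ × ℝ} (hr : D.IsGenericRay r) {e m : E}
    (hm : m ∈ D.rayMatching r) (h : D.white e = D.white m) :
    m = D.rotW e ∨ Ccw r (D.windingR (D.zigOut e)) (D.windingR (D.zigIn m)) := by
  have h1 := (hD.mem_rayMatching hr).1 hm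
  have hs : D.rotW.SameCycle (D.rotW⁻¹ m) e :=
    D.white_eq_white.1 (by rw [white_rotW_inv, h])
  by_cases hne : D.rotW⁻¹ m = e
  · left; rw [← hne, perm_apply_inv]
  right
  have h2 := (hD.cyclicallyOrdered_white.first_of_ccw hs
    (r := r) (by simpa only [zigOut_rotW_inv, perm_apply_inv] using h1)).1
  exact (hD.ccw_or_ccw hr (hD.cyclicallyOrdered_white.not_sameDir _ _ hs hne)).resolve_left
    fun h3 => h2 h3.rotate

theorem eq_rotB_or_ccw (hD : D.ProperlyOrdered) {r : ℝ × ℝ} (hr : D.IsGenericRay r) {e m : E}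
    (hm : m ∈ D.rayMatching r) (h : D.black e = D.black m) :
    m = D.rotB e ∨ Ccw r (D.windingR (D.zigOut e)) (D.windingR (D.zigIn m)) := by
  have h1 := (hD.mem_rayMatching hr).1 hm
  have hs : D.rotB.SameCycle m (D.rotB e) :=
    D.black_eq_black.1 (by rw [black_rotB, h])
  by_cases hne : m = D.rotB e
  · exact Or.inl hne
  right
  have h2 := (hD.cyclicallyOrdered_black.first_of_ccw hs
    (r := r) (by simpa only [zigIn_rotB] using h1)).1
  have h4 := hD.cyclicallyOrdered_black.not_sameDir _ _ hs hne
  simp only [zigIn_rotB] at h2 h4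
  exact (hD.ccw_or_ccw hr h4).resolve_left fun h3 => h2 h3.rotate

/-- If a perfect matching has the same displacement as the matching of a ray but differs from it,
then the two matchings contain opposite halves of some zigzag path. -/
theorem exists_zigzag_of_totalDisp_eq (hD : D.ProperlyOrdered) {r : ℝ × ℝ}
    (hr : D.IsGenericRay r) {M : Finset E} (hM : D.IsPerfectMatching M)
    (h : D.totalDisp M = D.totalDisp (D.rayMatching r)) (hne : M ≠ D.rayMatching r) :
    ∃ Z, (∀ e, D.zigOut e = Z → e ∈ M) ∧ ∀ e, D.zigIn e = Z → e ∈ D.rayMatching r := by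
  classical
  have hM₀ := hD.isPerfectMatching_rayMatching hr
  have hmem (e : E) := hD.mem_rayMatching hr (e := e)
  have hccw (e : E) := hD.ccw_zigIn_zigOut hr (e := e)
  have hWccw (e m : E) := hD.eq_rotW_or_ccw hr (e := e) (m := m)
  have hBccw (e m : E) := hD.eq_rotB_or_ccw hr (e := e) (m := m)
  generalize D.rayMatching r = M₀ at *
  obtain ⟨m₀, hm₀⟩ : (M₀ \ M).Nonempty := by
    rw [Finset.sdiff_nonempty]
    intro hsub
    refine hne (Finset.Subset.antisymm (fun e he => ?_) hsub)
    obtain ⟨e', ⟨h1, h2⟩, -⟩ := hM₀.1 (D.white e)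
    rwa [hM.eq_of_white he (hsub h1) h2.symm]
  -- The path sought is the one whose winding is met last from `r` among all `zigIn e` with `e` in
  -- `M₀` but not in `M`.
  obtain ⟨m, hm, hmax⟩ := exists_last_ccw r (fun e => D.windingR (D.zigIn e))
    (S := {e | e ∈ M₀ \ M}) ⟨m₀, hm₀⟩
  replace hm : m ∈ M₀ \ M := hm
  replace hmax (e : E) (he : e ∈ M₀ \ M) := hmax e he
  generalize hZ : D.zigIn m = Z at hmax
  have hW {e : E} (he : e ∈ M \ M₀) : ∃ m ∈ M₀ \ M,
      m = D.rotW e ∨ Ccw r (D.windingR (D.zigOut e)) (D.windingR (D.zigIn m)) := by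
    rw [Finset.mem_sdiff] at he
    obtain ⟨m', ⟨h1, h2⟩, -⟩ := hM₀.1 (D.white e)
    refine ⟨m', Finset.mem_sdiff.2 ⟨h1, fun h3 => he.2 ?_⟩, hWccw _ _ h1 h2.symm⟩
    rwa [hM.eq_of_white he.1 h3 h2.symm]
  have hB {e : E} (he : e ∈ M \ M₀) : ∃ m ∈ M₀ \ M,
      m = D.rotB e ∨ Ccw r (D.windingR (D.zigOut e)) (D.windingR (D.zigIn m)) := by
    rw [Finset.mem_sdiff] at he
    obtain ⟨m', ⟨h1, h2⟩, -⟩ := hM₀.2 (D.black e)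
    refine ⟨m', Finset.mem_sdiff.2 ⟨h1, fun h3 => he.2 ?_⟩, hBccw _ _ h1 h2.symm⟩
    rwa [hM.eq_of_black he.1 h3 h2.symm]
  -- For an edge of `M₀`, `zigOut e` is met before `zigIn e`; for an edge outside `M₀` it is met
  -- after. Maximality of `Z` thus leaves only `zigIn` contributions here and only `zigOut`
  -- contributions in `hP`.
  have hN (e : E) (he : e ∈ M₀ \ M) : D.crossing Z e = if D.zigIn e = Z then 1 else 0 := by
    have : D.zigOut e ≠ Z := fun h' => hmax e he <| by
      rw [← h']; exact ((hmem e).1 (Finset.mem_sdiff.1 he).1).rotate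
    rw [crossing, if_neg this, zero_add]
  have hP (e : E) (he : e ∈ M \ M₀) : D.crossing Z e = if D.zigOut e = Z then 1 else 0 := by
    have : D.zigIn e ≠ Z := fun h' => by
      have h1 := hccw e (Finset.mem_sdiff.1 he).2
      rw [h'] at h1
      obtain ⟨m', hm', rfl | h2⟩ := hW he
      · exact hmax _ hm' (by rwa [zigIn_rotW])
      · exact hmax _ hm' (h1.trans h2)
    rw [crossing, if_neg this, add_zero]
  have hcount : ∑ e ∈ M \ M₀, D.crossing Z e = ∑ e ∈ M₀ \ M, D.crossing Z e := by
    have h1 := hM.sum_crossing_sub hM₀ Z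
    rw [h, sub_self, ← Finset.sum_sdiff_sub_sum_sdiff] at h1
    have h2 : wedge (0 : ℤ × ℤ) (D.winding Z) = 0 := by simp [wedge]
    linarith
  rw [Finset.sum_congr rfl hN, Finset.sum_congr rfl hP, Finset.sum_boole, Finset.sum_boole,
    Nat.cast_inj] at hcount
  -- If the edge of `M₀` at the white node were not `rotW e`, its `zigIn` would be met after `Z`.
  have hWA : ∀ e ∈ {e ∈ M \ M₀ | D.zigOut e = Z}, D.rotW e ∈ {e ∈ M₀ \ M | D.zigIn e = Z} := by
    intro e he
    rw [Finset.mem_filter] at he ⊢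
    obtain ⟨m', hm', rfl | h2⟩ := hW he.1
    · exact ⟨hm', by rw [zigIn_rotW, he.2]⟩
    · exact absurd (he.2 ▸ h2) (hmax _ hm')
  have hBA : ∀ e ∈ {e ∈ M \ M₀ | D.zigOut e = Z}, D.rotB e ∈ {e ∈ M₀ \ M | D.zigIn e = Z} := by
    intro e he
    rw [Finset.mem_filter] at he ⊢
    obtain ⟨m', hm', rfl | h2⟩ := hB he.1
    · exact ⟨hm', by rw [zigIn_rotB, he.2]⟩
    · exact absurd (he.2 ▸ h2) (hmax _ hm')
  have hA₀ : m ∈ {e ∈ M₀ \ M | D.zigIn e = Z} := Finset.mem_filter.2 ⟨hm, hZ⟩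
  generalize hAdef : {e ∈ M \ M₀ | D.zigOut e = Z} = A at *
  generalize hA₀def : {e ∈ M₀ \ M | D.zigIn e = Z} = A₀ at *
  have hsurj (π : Equiv.Perm E) (hπ : ∀ e ∈ A, π e ∈ A₀) {e' : E} (he' : e' ∈ A₀) :
      π⁻¹ e' ∈ A := by
    have h1 : A.map π.toEmbedding = A₀ := Finset.eq_of_subset_of_card_le
      (fun x hx => by
        obtain ⟨e, he, rfl⟩ := Finset.mem_map.1 hx
        exact hπ e he) (by rw [Finset.card_map, hcount])
    rw [← h1] at he'
    obtain ⟨e, he, rfl⟩ := Finset.mem_map.1 he'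
    rwa [Equiv.coe_toEmbedding, perm_inv_apply]
  -- By equal cardinality both rotations are bijections from `A` to `A₀`. Alternating `rotW` with
  -- `rotB⁻¹`, starting from `rotW⁻¹ m`, then walks along all of `Z`.
  have hAall {e : E} (he : D.zigOut e = Z) : e ∈ A := by
    have h1 := hsurj D.rotW hWA hA₀
    have h2 : D.zigOut (D.rotW⁻¹ m) = D.zigOut e := by rw [zigOut_rotW_inv, hZ, he]
    obtain ⟨n, rfl⟩ := (D.zigOut_eq_zigOut.1 h2).exists_nat_pow_eq
    clear h2 he
    induction n with
    | zero => exact h1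
    | succ n ih =>
      rw [pow_succ', Equiv.Perm.mul_apply, zigzagPerm, Equiv.Perm.mul_apply]
      exact hsurj D.rotB hBA (hWA _ ih)
  refine ⟨Z, fun e he => ?_, fun e he => ?_⟩
  · have h1 := hAall he
    rw [← hAdef, Finset.mem_filter, Finset.mem_sdiff] at h1
    exact h1.1.1
  · have h1 := hWA _ (hAall (e := D.rotW⁻¹ e) he)
    rw [perm_apply_inv, ← hA₀def, Finset.mem_filter, Finset.mem_sdiff] at h1
    exact h1.1.1

/-- Otherwise two exchanges would move the common displacement by plus and minus a winding, and both
results would lie in the strictly convex cone cut out by the neighbours of the ray. -/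
theorem eq_rayMatching_of_totalDisp_eq (hD : D.ProperlyOrdered) {r : ℝ × ℝ}
    (hr : D.IsGenericRay r) {M : Finset E} (hM : D.IsPerfectMatching M)
    (h : D.totalDisp M = D.totalDisp (D.rayMatching r)) : M = D.rayMatching r := by
  by_contra hne
  obtain ⟨Z, h1, h2⟩ := hD.exists_zigzag_of_totalDisp_eq hr hM h hne
  obtain ⟨M₁, hM₁, e₁⟩ := hD.exists_totalDisp_add hM h1
  obtain ⟨M₂, hM₂, e₂⟩ := hD.exists_totalDisp_sub (hD.isPerfectMatching_rayMatching hr) h2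
  obtain ⟨Z₁, hZ₁⟩ := D.exists_isFirstCw r
  obtain ⟨Z₂, hZ₂⟩ := D.exists_isFirstCcw r
  have a₁ := hD.wedge_nonneg_of_isFirstCw hr hZ₁ hM₁
  have a₂ := hD.wedge_nonneg_of_isFirstCw hr hZ₁ hM₂
  have b₁ := hD.wedge_nonneg_of_isFirstCcw hr hZ₂ hM₁
  have b₂ := hD.wedge_nonneg_of_isFirstCcw hr hZ₂ hM₂
  rw [e₁, h, add_sub_cancel_left] at a₁ b₁
  rw [e₂, wedge_sub_right, wedge_sub_right] at a₂ b₂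
  refine hD.winding_ne_zero Z (eq_zero_of_wedge_eq_zero
    (hD.wedge_pos_of_isFirst hr hZ₁ hZ₂).ne' ?_ ?_) <;> linarith

end ProperlyOrdered

end Dimer

/-! ### The determinant of the Kasteleyn matrix -/

namespace Dimer

variable {E : Type*} [Fintype E] {D : Dimer E}

-- The Leibniz formula, with each matrix entry expanded into edges: the terms are choices of one
-- edge per column.
open Classical in
theorem coeff_kasteleynDet (gw gz : ℤ × ℤ) (c : E → ℂ) (φ : D.White ≃ D.Black) (q : ℤ × ℤ) :
    (D.kasteleynDet gw gz c φ).coeff q = ∑ σ : Equiv.Perm D.White,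
      ∑ p ∈ Fintype.piFinset fun v => {e : E | D.white e = σ v ∧ D.black e = φ v}.toFinset,
        if ∑ v, D.exponent gw gz (p v) = q then Equiv.Perm.sign σ • ∏ v, c (p v) else 0 := by
  rw [kasteleynDet, Matrix.det_apply, AddMonoidAlgebra.coeff_sum, Finset.sum_apply']
  refine Finset.sum_congr rfl fun σ _ => ?_
  have h1 : ∏ v, (D.kasteleyn gw gz c).submatrix id φ (σ v) v =
      ∑ p ∈ Fintype.piFinset fun v => {e : E | D.white e = σ v ∧ D.black e = φ v}.toFinset,
        AddMonoidAlgebra.single (∑ v, D.exponent gw gz (p v)) (∏ v, c (p v)) := by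
    simp only [← AddMonoidAlgebra.prod_single]
    refine Eq.trans (Finset.prod_congr rfl fun v _ => ?_) (Finset.prod_univ_sum _
      fun _ e => AddMonoidAlgebra.single (D.exponent gw gz e) (c e))
    rw [Matrix.submatrix_apply, id, kasteleyn]
    refine Finset.sum_congr ?_ fun _ _ => rfl
    ext e; simp
  rw [h1, Finset.smul_sum, AddMonoidAlgebra.coeff_sum, Finset.sum_apply']
  refine Finset.sum_congr rfl fun p _ => ?_
  rcases Int.units_eq_one_or (Equiv.Perm.sign σ) with h | h <;>
    by_cases h2 : ∑ v, D.exponent gw gz (p v) = q <;>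
    simp [h, h2, AddMonoidAlgebra.coeff_single]

/-- The choice of an edge for each pair of a row and a column is a perfect matching. -/
theorem isPerfectMatching_image [DecidableEq E] {φ : D.White ≃ D.Black}
    {σ : Equiv.Perm D.White} {p : D.White → E}
    (hp : ∀ v, D.white (p v) = σ v ∧ D.black (p v) = φ v) :
    D.IsPerfectMatching (Finset.univ.image p) := by
  constructor
  · intro v
    refine ⟨p (σ⁻¹ v), ⟨by simp, by rw [(hp _).1, perm_apply_inv]⟩, ?_⟩
    rintro e ⟨he, rfl⟩
    obtain ⟨u, -, rfl⟩ := Finset.mem_image.1 he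
    rw [(hp u).1, perm_inv_apply]
  · intro b
    refine ⟨p (φ.symm b), ⟨by simp, by rw [(hp _).2, Equiv.apply_symm_apply]⟩, ?_⟩
    rintro e ⟨he, rfl⟩
    obtain ⟨u, -, rfl⟩ := Finset.mem_image.1 he
    rw [(hp u).2, Equiv.symm_apply_apply]

theorem point_image [DecidableEq E] (gw gz : ℤ × ℤ) {φ : D.White ≃ D.Black}
    {p : D.White → E} (hp : ∀ v, D.black (p v) = φ v) :
    D.point gw gz (Finset.univ.image p) = ∑ v, D.exponent gw gz (p v) := by
  rw [point, Finset.sum_image]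
  intro v _ v' _ h
  exact φ.injective (by rw [← hp, ← hp, h])

theorem exists_isPerfectMatching_of_coeff_ne_zero {gw gz : ℤ × ℤ} {c : E → ℂ}
    {φ : D.White ≃ D.Black} {q : ℤ × ℤ} (h : (D.kasteleynDet gw gz c φ).coeff q ≠ 0) :
    ∃ M, D.IsPerfectMatching M ∧ D.point gw gz M = q := by
  classical
  rw [coeff_kasteleynDet] at h
  obtain ⟨σ, -, h1⟩ := Finset.exists_ne_zero_of_sum_ne_zero h
  obtain ⟨p, hp, h2⟩ := Finset.exists_ne_zero_of_sum_ne_zero h1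
  simp only [Fintype.mem_piFinset, Set.mem_toFinset, Set.mem_ofPred_eq] at hp
  refine ⟨_, isPerfectMatching_image hp, ?_⟩
  rw [point_image gw gz fun v => (hp v).2]
  by_contra h3
  exact h2 (if_neg h3)

/-- A single term of the expansion has this exponent, so no cancellation is possible. -/
theorem coeff_kasteleynDet_ne_zero {gw gz : ℤ × ℤ} {c : E → ℂ} (hc : ∀ e, c e ≠ 0)
    (φ : D.White ≃ D.Black) {M : Finset E} (hM : D.IsPerfectMatching M)
    (huniq : ∀ M', D.IsPerfectMatching M' → D.point gw gz M' = D.point gw gz M → M' = M) :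
    (D.kasteleynDet gw gz c φ).coeff (D.point gw gz M) ≠ 0 := by
  classical
  choose p hp hpu using fun v => hM.2 (φ v)
  have hinj : Function.Injective fun v => D.white (p v) := fun v v' h => by
    have h1 : p v = p v' := hM.eq_of_white (hp v).1 (hp v').1 h
    exact φ.injective (by rw [← (hp v).2, ← (hp v').2, h1])
  let σ : Equiv.Perm D.White := Equiv.ofBijective _ (Finite.injective_iff_bijective.1 hinj)
  have hσ (v : D.White) : D.white (p v) = σ v ∧ D.black (p v) = φ v := ⟨rfl, (hp v).2⟩
  have himage : Finset.univ.image p = M := by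
    ext e
    constructor
    · intro he
      obtain ⟨v, -, rfl⟩ := Finset.mem_image.1 he
      exact (hp v).1
    · intro he
      refine Finset.mem_image.2 ⟨φ.symm (D.black e), Finset.mem_univ _, ?_⟩
      exact (hpu _ e ⟨he, (φ.apply_symm_apply _).symm⟩).symm
  have key {σ' : Equiv.Perm D.White} {p' : D.White → E}
      (hp' : ∀ v, D.white (p' v) = σ' v ∧ D.black (p' v) = φ v)
      (hsum : ∑ v, D.exponent gw gz (p' v) = D.point gw gz M) : σ' = σ ∧ p' = p := by
    have h1 := huniq _ (isPerfectMatching_image hp')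
      ((point_image gw gz fun v => (hp' v).2).trans hsum)
    have h2 : p' = p := funext fun v => hpu v _
      ⟨by rw [← h1]; exact Finset.mem_image_of_mem _ (Finset.mem_univ v), (hp' v).2⟩
    subst h2
    exact ⟨Equiv.ext fun v => (hp' v).1.symm.trans (hσ v).1, rfl⟩
  rw [coeff_kasteleynDet, Finset.sum_eq_single σ, Finset.sum_eq_single p]
  · rw [if_pos (by rw [← point_image gw gz fun v => (hp v).2, himage])]
    have : ∏ v, c (p v) ≠ 0 := Finset.prod_ne_zero_iff.2 fun v _ => hc _
    rcases Int.units_eq_one_or (Equiv.Perm.sign σ) with h | h <;> simpa [h] using this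
  · intro p' hp' hne
    simp only [Fintype.mem_piFinset, Set.mem_toFinset, Set.mem_ofPred_eq] at hp'
    exact if_neg fun h => hne (key hp' h).2
  · intro h
    refine absurd ?_ h
    simpa only [Fintype.mem_piFinset, Set.mem_toFinset, Set.mem_ofPred_eq] using hσ
  · intro σ' _ hne
    refine Finset.sum_eq_zero fun p' hp' => ?_
    simp only [Fintype.mem_piFinset, Set.mem_toFinset, Set.mem_ofPred_eq] at hp'
    exact if_neg fun h => hne (key hp' h).1
  · intro h
    exact absurd (Finset.mem_univ _) h

end Dimer

/-! ### The plane of displacements and the plane of exponents -/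

/-- The exponent that belongs to a displacement. -/
def expVec (gw gz d : ℤ × ℤ) : ℤ × ℤ := (wedge d gw, wedge d gz)

/-- The wedge product of a vector `u` in the plane of displacements and a vector `y` in the plane of
exponents, the latter being transported to the plane of displacements. -/
def expPairing (gw gz : ℤ × ℤ) (u y : ℝ × ℝ) : ℝ :=
  (wedge gw gz : ℤ) * (y.2 * wedge u (toReal gw) - y.1 * wedge u (toReal gz))

section ExpPairing

variable {gw gz : ℤ × ℤ}

theorem expVec_sub (d d' : ℤ × ℤ) : expVec gw gz (d - d') = expVec gw gz d - expVec gw gz d' := by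
  simp [expVec, wedge_sub_left]

theorem expVec_nsmul (n : ℕ) (d : ℤ × ℤ) : expVec gw gz (n • d) = n • expVec gw gz d := by
  ext <;> simp [expVec, wedge] <;> ring

theorem expVec_zsmul (n : ℤ) (d : ℤ × ℤ) : expVec gw gz (n • d) = n • expVec gw gz d := by
  ext <;> simp [expVec, wedge] <;> ring

theorem expPairing_add (u y y' : ℝ × ℝ) :
    expPairing gw gz u (y + y') = expPairing gw gz u y + expPairing gw gz u y' := by
  simp only [expPairing, Prod.fst_add, Prod.snd_add]; ring

theorem expPairing_sub (u y y' : ℝ × ℝ) :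
    expPairing gw gz u (y - y') = expPairing gw gz u y - expPairing gw gz u y' := by
  simp only [expPairing, Prod.fst_sub, Prod.snd_sub]; ring

theorem expPairing_smul (u : ℝ × ℝ) (t : ℝ) (y : ℝ × ℝ) :
    expPairing gw gz u (t • y) = t * expPairing gw gz u y := by
  simp only [expPairing, Prod.smul_fst, Prod.smul_snd, smul_eq_mul]; ring

/-- Cramer's rule for the first argument of the pairing. -/
theorem wedge_mul_expPairing (a b u y : ℝ × ℝ) :
    wedge a b * expPairing gw gz u y =
      wedge u b * expPairing gw gz a y + wedge a u * expPairing gw gz b y := by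
  simp only [expPairing, wedge]; ring

theorem sq_wedge_eq_one (hg : wedge gw gz = 1 ∨ wedge gw gz = -1) :
    ((wedge gw gz : ℤ) : ℝ) * (wedge gw gz : ℤ) = 1 := by
  rcases hg with h | h <;> simp [h]

/-- The sign in `expPairing` cancels the determinant of the change of coordinates, so bases of
either orientation are treated alike. -/
theorem expPairing_expVec (hg : wedge gw gz = 1 ∨ wedge gw gz = -1) (u : ℝ × ℝ) (d : ℤ × ℤ) :
    expPairing gw gz u (toReal (expVec gw gz d)) = wedge u (toReal d) := by
  have h : expPairing gw gz u (toReal (expVec gw gz d)) =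
      ((wedge gw gz : ℤ) : ℝ) * (wedge gw gz : ℤ) * wedge u (toReal d) := by
    simp only [expPairing, expVec, wedge, toReal]; push_cast; ring
  rw [h, sq_wedge_eq_one hg, one_mul]

/-- The wedge product of exponents in terms of the pairing. -/
theorem expPairing_normal (hg : wedge gw gz = 1 ∨ wedge gw gz = -1) (d : ℤ × ℤ) (y : ℝ × ℝ) :
    expPairing gw gz (toReal (d.2 • gw + (-d.1) • gz)) y = wedge (toReal d) y := by
  have h : expPairing gw gz (toReal (d.2 • gw + (-d.1) • gz)) y =
      ((wedge gw gz : ℤ) : ℝ) * (wedge gw gz : ℤ) * wedge (toReal d) y := by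
    simp only [expPairing, wedge, toReal, Prod.fst_add, Prod.snd_add, Prod.smul_fst, Prod.smul_snd,
      smul_eq_mul]
    push_cast; ring
  rw [h, sq_wedge_eq_one hg, one_mul]

theorem expVec_normal (d : ℤ × ℤ) :
    expVec gw gz (d.2 • gw + (-d.1) • gz) = wedge gw gz • d := by
  ext <;> simp [expVec, wedge] <;> ring

theorem expVec_injective (hg : wedge gw gz = 1 ∨ wedge gw gz = -1) :
    Function.Injective (expVec gw gz) := by
  intro d d' h
  have key (u : ℝ × ℝ) : wedge u (toReal d) = wedge u (toReal d') := by
    rw [← expPairing_expVec hg, ← expPairing_expVec hg, h]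
  refine toReal_injective (Prod.ext ?_ ?_)
  · simpa [wedge] using key (0, -1)
  · simpa [wedge] using key (1, 0)

theorem isCoprime_expVec (hg : wedge gw gz = 1 ∨ wedge gw gz = -1) {d : ℤ × ℤ}
    (hd : IsCoprime d.1 d.2) : IsCoprime (expVec gw gz d).1 (expVec gw gz d).2 := by
  obtain ⟨a, b, hab⟩ := hd
  refine ⟨wedge gw gz * -(a * gz.1 + b * gz.2), wedge gw gz * (a * gw.1 + b * gw.2), ?_⟩
  have hs : wedge gw gz * wedge gw gz = 1 := by rcases hg with h | h <;> simp [h]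
  simp only [expVec, wedge] at *
  linear_combination (a * d.1 + b * d.2) * hs + hab

theorem eq_zero_of_expPairing_eq_zero (hg : wedge gw gz = 1 ∨ wedge gw gz = -1)
    {a b y : ℝ × ℝ} (hab : wedge a b ≠ 0) (ha : expPairing gw gz a y = 0)
    (hb : expPairing gw gz b y = 0) : y = 0 := by
  have hs : ((wedge gw gz : ℤ) : ℝ) ≠ 0 := by rcases hg with h | h <;> simp [h]
  have key (k : ℝ × ℝ) : expPairing gw gz k y =
      (wedge gw gz : ℤ) * wedge k (y.2 • toReal gw - y.1 • toReal gz) := by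
    simp only [expPairing, wedge, Prod.fst_sub, Prod.snd_sub, Prod.smul_fst, Prod.smul_snd,
      smul_eq_mul]
    ring
  rw [key] at ha hb
  have h0 := eq_zero_of_wedge_eq_zero hab ((mul_eq_zero.1 ha).resolve_left hs)
    ((mul_eq_zero.1 hb).resolve_left hs)
  have h1 := congrArg Prod.fst h0
  have h2 := congrArg Prod.snd h0
  simp only [Prod.fst_sub, Prod.snd_sub, Prod.smul_fst, Prod.smul_snd, smul_eq_mul, Prod.fst_zero,
    Prod.snd_zero, toReal] at h1 h2
  rw [wedge] at hs
  push_cast at hs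
  refine Prod.ext ((mul_eq_zero.1 (?_ : _ * y.1 = 0)).resolve_left hs)
    ((mul_eq_zero.1 (?_ : _ * y.2 = 0)).resolve_left hs)
  · linear_combination (gw.2 : ℝ) * h1 - gw.1 * h2
  · linear_combination (gz.2 : ℝ) * h1 - gz.1 * h2

theorem exists_expPairing_eq (hg : wedge gw gz = 1 ∨ wedge gw gz = -1) (f : (ℝ × ℝ) →ₗ[ℝ] ℝ) :
    ∃ u, ∀ y, f y = expPairing gw gz u y := by
  have hf (y : ℝ × ℝ) : f y = y.1 * f (1, 0) + y.2 * f (0, 1) := by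
    have : y = y.1 • ((1, 0) : ℝ × ℝ) + y.2 • ((0, 1) : ℝ × ℝ) := by ext <;> simp
    conv_lhs => rw [this, map_add, map_smul, map_smul, smul_eq_mul, smul_eq_mul]
  refine ⟨-(f (1, 0) • toReal gw + f (0, 1) • toReal gz), fun y => ?_⟩
  have h : expPairing gw gz (-(f (1, 0) • toReal gw + f (0, 1) • toReal gz)) y =
      ((wedge gw gz : ℤ) : ℝ) * (wedge gw gz : ℤ) * (y.1 * f (1, 0) + y.2 * f (0, 1)) := by
    simp only [expPairing, wedge, toReal, Prod.fst_add, Prod.snd_add, Prod.smul_fst, Prod.smul_snd,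
      smul_eq_mul, Prod.fst_neg, Prod.snd_neg]
    push_cast; ring
  rw [h, sq_wedge_eq_one hg, one_mul, hf]

end ExpPairing

namespace Dimer

variable {E : Type*} [Fintype E] {D : Dimer E}

theorem point_eq (gw gz : ℤ × ℤ) (M : Finset E) :
    D.point gw gz M = expVec gw gz (D.totalDisp M) := by
  rw [point, expVec, totalDisp, wedge_sum_left, wedge_sum_left]
  ext <;> simp [exponent, Prod.fst_sum, Prod.snd_sum]

namespace ProperlyOrdered

/-! ### Generic rays next to a given winding -/

theorem eq_of_sameDir (hD : D.ProperlyOrdered) {Y Z : D.ZigzagPath}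
    (h : SameDir (D.windingR Y) (D.windingR Z)) : D.winding Y = D.winding Z :=
  _root_.eq_of_sameDir (hD.isCoprime_winding Y) (hD.isCoprime_winding Z) (sameDir_toReal.1 h)

/-- The winding is tilted slightly to both sides. Wedges of windings are integers, so a perturbation
smaller than 1 cannot pass a winding that is not parallel. Parallel windings of the same direction
coincide by primitivity. -/
theorem exists_rays (hD : D.ProperlyOrdered) (Z : D.ZigzagPath) :
    ∃ r₁ r₂, D.IsGenericRay r₁ ∧ D.IsGenericRay r₂ ∧
      ∀ Y, Ccw r₁ (D.windingR Y) r₂ ↔ D.winding Y = D.winding Z := by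
  let w := D.winding Z
  let dot : D.ZigzagPath → ℤ := fun Y => w.1 * (D.winding Y).1 + w.2 * (D.winding Y).2
  obtain ⟨K, hK⟩ : ∃ K : ℝ, ∀ Y, |(dot Y : ℝ)| < K := by
    refine ⟨∑ Y, |(dot Y : ℝ)| + 1, fun Y => ?_⟩
    have := Finset.single_le_sum (f := fun Y => |(dot Y : ℝ)|) (fun Y _ => abs_nonneg _)
      (Finset.mem_univ Y)
    linarith
  have hKpos : 0 < K := (abs_nonneg _).trans_lt (hK Z)
  have hw : 0 < (w.1 : ℝ) * w.1 + w.2 * w.2 := by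
    exact_mod_cast normSq_pos (hD.winding_ne_zero Z)
  -- This is `w` turned by a right angle and scaled so that, by the bound `K` on the scalar
  -- products, tilting changes every wedge by less than 1.
  let p : ℝ × ℝ := (-K⁻¹ * w.2, K⁻¹ * w.1)
  have hε : 0 < K⁻¹ := inv_pos.2 hKpos
  have hsmall (Y : D.ZigzagPath) : |K⁻¹ * (dot Y : ℝ)| < 1 := by
    rw [abs_mul, abs_of_pos hε, inv_mul_lt_iff₀ hKpos, mul_one]; exact hK Y
  have hw₁ (Y : D.ZigzagPath) : wedge (toReal w - p) (D.windingR Y) =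
      (wedge w (D.winding Y) : ℤ) + K⁻¹ * dot Y := by
    simp only [wedge, windingR, toReal, p, dot, Prod.fst_sub, Prod.snd_sub]; push_cast; ring
  have hw₂ (Y : D.ZigzagPath) : wedge (toReal w + p) (D.windingR Y) =
      (wedge w (D.winding Y) : ℤ) - K⁻¹ * dot Y := by
    simp only [wedge, windingR, toReal, p, dot, Prod.fst_add, Prod.snd_add]; push_cast; ring
  have hr : 0 < wedge (toReal w - p) (toReal w + p) := by
    have : wedge (toReal w - p) (toReal w + p) = 2 * K⁻¹ * (w.1 * w.1 + w.2 * w.2) := by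
      simp only [wedge, toReal, p, Prod.fst_add, Prod.snd_add, Prod.fst_sub, Prod.snd_sub]; ring
    rw [this]; positivity
  have hcase (Y : D.ZigzagPath) : (wedge w (D.winding Y) = 0 ∧ dot Y ≠ 0) ∨
      1 ≤ |((wedge w (D.winding Y) : ℤ) : ℝ)| := by
    by_cases h0 : wedge w (D.winding Y) = 0
    · refine Or.inl ⟨h0, fun h1 => ?_⟩
      have h2 := mul_pos (normSq_pos (hD.winding_ne_zero Z)) (normSq_pos (hD.winding_ne_zero Y))
      have key : (w.1 * w.1 + w.2 * w.2) * ((D.winding Y).1 * (D.winding Y).1 +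
          (D.winding Y).2 * (D.winding Y).2) = dot Y ^ 2 + wedge w (D.winding Y) ^ 2 := by
        simp only [wedge, dot]; ring
      change 0 < (w.1 * w.1 + w.2 * w.2) * _ at h2
      rw [key, h0, h1] at h2
      simp at h2
    · right
      exact_mod_cast Int.one_le_abs h0
  refine ⟨toReal w - p, toReal w + p, ⟨fun h => ?_, fun Y hY => ?_⟩, ⟨fun h => ?_, fun Y hY => ?_⟩,
    fun Y => ⟨fun h => ?_, fun h => ?_⟩⟩
  · rw [h] at hr; simp [wedge] at hr
  · have h1 := hY.1
    rw [hw₁] at h1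
    rcases hcase Y with ⟨h2, h3⟩ | h2
    · rw [h2, Int.cast_zero, zero_add, mul_eq_zero] at h1
      rcases h1 with h1 | h1
      · exact hε.ne' h1
      · exact h3 (by exact_mod_cast h1)
    · rw [eq_neg_of_add_eq_zero_left h1, abs_neg] at h2
      exact absurd (hsmall Y) (not_lt.2 h2)
  · rw [h] at hr; simp [wedge] at hr
  · have h1 := hY.1
    rw [hw₂] at h1
    rcases hcase Y with ⟨h2, h3⟩ | h2
    · rw [h2, Int.cast_zero, zero_sub, neg_eq_zero, mul_eq_zero] at h1
      rcases h1 with h1 | h1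
      · exact hε.ne' h1
      · exact h3 (by exact_mod_cast h1)
    · rw [sub_eq_zero.1 h1] at h2
      exact absurd (hsmall Y) (not_lt.2 h2)
  · obtain ⟨h1, h2⟩ := h.wedge_pos hr
    rw [hw₁] at h1
    rw [wedge_swap, hw₂] at h2
    have h3 := abs_lt.1 (hsmall Y)
    rcases hcase Y with ⟨h4, h5⟩ | h4
    · refine hD.eq_of_sameDir (sameDir_toReal.2 (SameDir.symm ⟨h4, ?_⟩))
      rw [h4, Int.cast_zero, zero_add] at h1
      have := pos_of_mul_pos_right h1 hε.le
      exact_mod_cast this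
    · rcases le_abs.1 h4 with h4 | h4 <;> linarith
  · left
    rw [wedge_swap (toReal w + p), hw₁, hw₂, h]
    have h0 : wedge w (D.winding Z) = 0 := wedge_self _
    have h1 : (dot Y : ℝ) = w.1 * w.1 + w.2 * w.2 := by
      simp only [dot, h]; push_cast; rfl
    rw [h0, h1, Int.cast_zero, zero_add, zero_sub, neg_neg]
    exact ⟨by positivity, by positivity⟩

theorem isFirstCcw_of_between {r₁ r₂ : ℝ × ℝ} {w : ℤ × ℤ}
    (h : ∀ Z, Ccw r₁ (D.windingR Z) r₂ ↔ D.winding Z = w) {Z : D.ZigzagPath}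
    (hZ : D.winding Z = w) : D.IsFirstCcw r₁ Set.univ Z := fun Y _ hY => by
  have h1 := (h Y).1 (hY.trans ((h Z).2 hZ))
  rw [windingR, windingR, h1, hZ] at hY
  exact not_ccw_self_right _ _ hY

theorem isFirstCw_of_between {r₁ r₂ : ℝ × ℝ} {w : ℤ × ℤ}
    (h : ∀ Z, Ccw r₁ (D.windingR Z) r₂ ↔ D.winding Z = w) {Z : D.ZigzagPath}
    (hZ : D.winding Z = w) : D.IsFirstCw r₂ Set.univ Z := fun Y _ hY => by
  have h1 := (h Y).1 (((h Z).2 hZ).rotate.rotate.trans hY.rotate.rotate).rotate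
  rw [windingR, windingR, h1, hZ] at hY
  exact not_ccw_self_left _ _ hY

/-! ### The toric diagram -/

section ToricDiagram

variable {gw gz : ℤ × ℤ} {c : E → ℂ} {φ : D.White ≃ D.Black}

/-- Every exponent of the determinant is the point of a perfect matching, and a half plane is
convex. -/
theorem expPairing_nonneg_of_forall (hg : wedge gw gz = 1 ∨ wedge gw gz = -1) {Z : D.ZigzagPath}
    {M₀ : Finset E} (h : ∀ M, D.IsPerfectMatching M →
      0 ≤ wedge (D.winding Z) (D.totalDisp M - D.totalDisp M₀))
    {x : ℝ × ℝ} (hx : x ∈ D.toricDiagram gw gz c φ) :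
    0 ≤ expPairing gw gz (D.windingR Z) (x - toReal (D.point gw gz M₀)) := by
  have hconv : Convex ℝ {x : ℝ × ℝ | 0 ≤ expPairing gw gz (D.windingR Z)
      (x - toReal (D.point gw gz M₀))} := by
    intro x hx y hy a b ha hb hab
    simp only [Set.mem_ofPred_eq] at hx hy ⊢
    have : a • x + b • y - toReal (D.point gw gz M₀) =
        a • (x - toReal (D.point gw gz M₀)) + b • (y - toReal (D.point gw gz M₀)) := by
      rw [smul_sub, smul_sub, sub_add_sub_comm, ← add_smul, hab, one_smul]
    rw [this, expPairing_add, expPairing_smul, expPairing_smul]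
    positivity
  refine convexHull_min ?_ hconv hx
  rintro _ ⟨q, hq, rfl⟩
  obtain ⟨M, hM, rfl⟩ := exists_isPerfectMatching_of_coeff_ne_zero (Finsupp.mem_support_iff.1 hq)
  have h1 := h M hM
  simp only [Set.mem_ofPred_eq]
  rw [← toReal_sub, point_eq, point_eq, ← expVec_sub, expPairing_expVec hg, windingR, wedge_toReal]
  exact_mod_cast h1

theorem expPairing_nonneg_of_isFirstCw (hD : D.ProperlyOrdered)
    (hg : wedge gw gz = 1 ∨ wedge gw gz = -1) {r : ℝ × ℝ} (hr : D.IsGenericRay r)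
    {Z : D.ZigzagPath} (h : D.IsFirstCw r Set.univ Z) {x : ℝ × ℝ}
    (hx : x ∈ D.toricDiagram gw gz c φ) :
    0 ≤ expPairing gw gz (D.windingR Z) (x - toReal (D.point gw gz (D.rayMatching r))) :=
  expPairing_nonneg_of_forall hg (fun _ hM => hD.wedge_nonneg_of_isFirstCw hr h hM) hx

theorem expPairing_nonneg_of_isFirstCcw (hD : D.ProperlyOrdered)
    (hg : wedge gw gz = 1 ∨ wedge gw gz = -1) {r : ℝ × ℝ} (hr : D.IsGenericRay r)
    {Z : D.ZigzagPath} (h : D.IsFirstCcw r Set.univ Z) {x : ℝ × ℝ}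
    (hx : x ∈ D.toricDiagram gw gz c φ) :
    0 ≤ expPairing gw gz (D.windingR Z) (x - toReal (D.point gw gz (D.rayMatching r))) :=
  expPairing_nonneg_of_forall hg (fun _ hM => hD.wedge_nonneg_of_isFirstCcw hr h hM) hx

theorem point_mem_toricDiagram (hD : D.ProperlyOrdered)
    (hg : wedge gw gz = 1 ∨ wedge gw gz = -1) (hc : ∀ e, c e ≠ 0) {r : ℝ × ℝ}
    (hr : D.IsGenericRay r) :
    toReal (D.point gw gz (D.rayMatching r)) ∈ D.toricDiagram gw gz c φ := by
  refine subset_convexHull ℝ _ ⟨_, Finsupp.mem_support_iff.2 (coeff_kasteleynDet_ne_zero hc φ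
    (hD.isPerfectMatching_rayMatching hr) fun M hM h => ?_), rfl⟩
  rw [point_eq, point_eq] at h
  exact hD.eq_rayMatching_of_totalDisp_eq hr hM (expVec_injective hg h)

theorem windingR_wedge_pos (hD : D.ProperlyOrdered) {r : ℝ × ℝ} (hr : D.IsGenericRay r)
    {Z₁ Z₂ : D.ZigzagPath} (h₁ : D.IsFirstCw r Set.univ Z₁) (h₂ : D.IsFirstCcw r Set.univ Z₂) :
    0 < wedge (D.windingR Z₁) (D.windingR Z₂) := by
  rw [windingR, windingR, wedge_toReal]
  exact_mod_cast hD.wedge_pos_of_isFirst hr h₁ h₂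

/-- The matching of a ray is the only point of the toric diagram at which the linear form given by
the ray is minimal. -/
theorem expPairing_ray_nonneg (hD : D.ProperlyOrdered)
    (hg : wedge gw gz = 1 ∨ wedge gw gz = -1) {r : ℝ × ℝ} (hr : D.IsGenericRay r) {x : ℝ × ℝ}
    (hx : x ∈ D.toricDiagram gw gz c φ) :
    0 ≤ expPairing gw gz r (x - toReal (D.point gw gz (D.rayMatching r))) ∧
      (expPairing gw gz r (x - toReal (D.point gw gz (D.rayMatching r))) = 0 →
        x = toReal (D.point gw gz (D.rayMatching r))) := by
  obtain ⟨Z₁, h₁⟩ := D.exists_isFirstCw r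
  obtain ⟨Z₂, h₂⟩ := D.exists_isFirstCcw r
  have hpos := hD.windingR_wedge_pos hr h₁ h₂
  have a₁ := hD.expPairing_nonneg_of_isFirstCw hg hr h₁ hx
  have a₂ := hD.expPairing_nonneg_of_isFirstCcw hg hr h₂ hx
  have hns : ¬ SameDir (D.windingR Z₁) (D.windingR Z₂) := fun h => hpos.ne' h.1
  have hccw : Ccw (D.windingR Z₁) r (D.windingR Z₂) :=
    ((hD.ccw_or_ccw hr hns).resolve_left (h₂ _ trivial)).rotate.rotate
  obtain ⟨b₁, b₂⟩ := hccw.wedge_pos hpos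
  -- The ray is a positive combination of its two neighbours. If its form vanishes, both of theirs
  -- do, and only the apex of the cone remains.
  have key := wedge_mul_expPairing (gw := gw) (gz := gz) (D.windingR Z₁) (D.windingR Z₂) r
    (x - toReal (D.point gw gz (D.rayMatching r)))
  have n₁ := mul_nonneg b₂.le a₁
  have n₂ := mul_nonneg b₁.le a₂
  refine ⟨?_, fun h0 => ?_⟩
  · refine nonneg_of_mul_nonneg_right ?_ hpos
    rw [key]; linarith
  · rw [h0, mul_zero] at key
    have z₁ := (mul_eq_zero.1 (le_antisymm (by linarith) n₁)).resolve_left b₂.ne'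
    have z₂ := (mul_eq_zero.1 (le_antisymm (by linarith) n₂)).resolve_left b₁.ne'
    exact sub_eq_zero.1 (eq_zero_of_expPairing_eq_zero hg hpos.ne' z₁ z₂)

/-- Every linear form on the toric diagram is minimal at the matching of some ray. -/
theorem exists_ray_forall_expPairing_nonneg (hD : D.ProperlyOrdered)
    (hg : wedge gw gz = 1 ∨ wedge gw gz = -1) {u : ℝ × ℝ} (hu : u ≠ 0) :
    ∃ r, D.IsGenericRay r ∧ ∀ x ∈ D.toricDiagram gw gz c φ,
      0 ≤ expPairing gw gz u (x - toReal (D.point gw gz (D.rayMatching r))) := by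
  by_cases hgen : D.IsGenericRay u
  · exact ⟨u, hgen, fun x hx => (hD.expPairing_ray_nonneg hg hgen hx).1⟩
  -- A nongeneric `u` is a positive multiple of a winding; the matching of the ray just before that
  -- winding minimizes its form.
  obtain ⟨Z, hZ⟩ : ∃ Z, SameDir u (D.windingR Z) := by
    by_contra! h
    exact hgen ⟨hu, h⟩
  obtain ⟨r₁, r₂, h₁, h₂, h⟩ := hD.exists_rays Z
  refine ⟨r₁, h₁, fun x hx => ?_⟩
  have a := hD.expPairing_nonneg_of_isFirstCcw hg h₁ (isFirstCcw_of_between h rfl) hx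
  obtain ⟨h3, h4⟩ := hZ
  have h5 := normSq_pos (hD.windingR_ne_zero Z)
  generalize D.windingR Z = w at *
  generalize x - toReal (D.point gw gz (D.rayMatching r₁)) = y at *
  have key : (w.1 * w.1 + w.2 * w.2) * expPairing gw gz u y =
      (u.1 * w.1 + u.2 * w.2) * expPairing gw gz w y +
        wedge u w * (expPairing gw gz (w.2, -w.1) y) := by
    simp only [expPairing, wedge]; ring
  rw [h3, zero_mul, add_zero] at key
  have h6 := mul_nonneg h4.le a
  rw [← key] at h6
  exact nonneg_of_mul_nonneg_right h6 h5

/-- A point outside the hull would be separated from it by a linear form, which nevertheless attains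
its minimum over the diagram at some ray matching. -/
theorem toricDiagram_eq_convexHull (hD : D.ProperlyOrdered)
    (hg : wedge gw gz = 1 ∨ wedge gw gz = -1) (hc : ∀ e, c e ≠ 0) :
    D.toricDiagram gw gz c φ = convexHull ℝ
      {p | ∃ r, D.IsGenericRay r ∧ p = toReal (D.point gw gz (D.rayMatching r))} := by
  refine Set.Subset.antisymm (fun x hx => ?_) (convexHull_min ?_ (convex_convexHull ℝ _))
  · by_contra hx'
    have hfin : {p | ∃ r, D.IsGenericRay r ∧
        p = toReal (D.point gw gz (D.rayMatching r))}.Finite := by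
      refine (Set.finite_range fun M : Finset E => toReal (D.point gw gz M)).subset ?_
      rintro _ ⟨r, -, rfl⟩
      exact ⟨_, rfl⟩
    obtain ⟨f, t, hft, hfb⟩ := geometric_hahn_banach_point_closed (convex_convexHull ℝ _)
      (hfin.isClosed_convexHull ℝ) hx'
    obtain ⟨u, hfu⟩ := exists_expPairing_eq hg f.toLinearMap
    replace hfu (y : ℝ × ℝ) : f y = expPairing gw gz u y := hfu y
    have hu : u ≠ 0 := by
      rintro rfl
      obtain ⟨Z⟩ : Nonempty D.ZigzagPath := D.nonempty_edge.map D.zigOut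
      obtain ⟨r, -, hr, -, -⟩ := hD.exists_rays Z
      have := hfb _ (subset_convexHull ℝ _ ⟨r, hr, rfl⟩)
      rw [hfu] at hft this
      simp only [expPairing, wedge, Prod.fst_zero, Prod.snd_zero, zero_mul, sub_self,
        mul_zero] at hft this
      linarith
    obtain ⟨r, hr, hmin⟩ := hD.exists_ray_forall_expPairing_nonneg (c := c) (φ := φ) hg hu
    have h1 := hmin x hx
    have h2 := hfb _ (subset_convexHull ℝ _ ⟨r, hr, rfl⟩)
    rw [expPairing_sub, ← hfu, ← hfu] at h1
    linarith
  · rintro _ ⟨r, hr, rfl⟩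
    exact hD.point_mem_toricDiagram hg hc hr

theorem convex_toricDiagram : Convex ℝ (D.toricDiagram gw gz c φ) := convex_convexHull ℝ _

/-- A linear form that is nonnegative at both ends of a segment and vanishes at an inner point
vanishes at the ends. -/
theorem expPairing_eq_zero_of_mem_openSegment {u q x y z : ℝ × ℝ}
    (hx : 0 ≤ expPairing gw gz u (x - q)) (hy : 0 ≤ expPairing gw gz u (y - q))
    (hz : expPairing gw gz u (z - q) = 0) (h : z ∈ openSegment ℝ x y) :
    expPairing gw gz u (x - q) = 0 := by
  obtain ⟨a, b, ha, hb, hab, rfl⟩ := h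
  have : a • x + b • y - q = a • (x - q) + b • (y - q) := by
    rw [smul_sub, smul_sub, sub_add_sub_comm, ← add_smul, hab, one_smul]
  rw [this, expPairing_add, expPairing_smul, expPairing_smul] at hz
  have h1 := mul_nonneg ha.le hx
  have h2 := mul_nonneg hb.le hy
  exact (mul_eq_zero.1 (by linarith : a * _ = 0)).resolve_left ha.ne'

theorem extremePoints_toricDiagram (hD : D.ProperlyOrdered)
    (hg : wedge gw gz = 1 ∨ wedge gw gz = -1) (hc : ∀ e, c e ≠ 0) :
    (D.toricDiagram gw gz c φ).extremePoints ℝ =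
      {p | ∃ r, D.IsGenericRay r ∧ p = toReal (D.point gw gz (D.rayMatching r))} := by
  refine Set.Subset.antisymm ?_ ?_
  · rw [hD.toricDiagram_eq_convexHull hg hc]
    exact extremePoints_convexHull_subset
  · rintro _ ⟨r, hr, rfl⟩
    refine ⟨hD.point_mem_toricDiagram hg hc hr, fun x hx y hy h => ?_⟩
    refine (hD.expPairing_ray_nonneg hg hr hx).2 (expPairing_eq_zero_of_mem_openSegment
      (hD.expPairing_ray_nonneg hg hr hx).1 (hD.expPairing_ray_nonneg hg hr hy).1 ?_ h)
    simp [expPairing]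

end ToricDiagram

end ProperlyOrdered

end Dimer

namespace Dimer

variable {E : Type*} [Fintype E] {D : Dimer E}

namespace ProperlyOrdered

variable {gw gz : ℤ × ℤ} {c : E → ℂ} {φ : D.White ≃ D.Black}

/-! ### The edges of the toric diagram -/

section Edge

variable {r₁ r₂ : ℝ × ℝ} {w : ℤ × ℤ}

theorem point_sub (hD : D.ProperlyOrdered) (h₁ : D.IsGenericRay r₁) (h₂ : D.IsGenericRay r₂)
    (hw : ∃ Z, D.winding Z = w) (h : ∀ Z, Ccw r₁ (D.windingR Z) r₂ ↔ D.winding Z = w) :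
    D.point gw gz (D.rayMatching r₂) - D.point gw gz (D.rayMatching r₁) =
      Nat.card {Z : D.ZigzagPath // D.winding Z = w} • expVec gw gz w := by
  rw [point_eq, point_eq, ← expVec_sub, hD.totalDisp_sub h₁ h₂ hw h, expVec_nsmul]

theorem toReal_point_eq (hD : D.ProperlyOrdered) (h₁ : D.IsGenericRay r₁)
    (h₂ : D.IsGenericRay r₂) (hw : ∃ Z, D.winding Z = w)
    (h : ∀ Z, Ccw r₁ (D.windingR Z) r₂ ↔ D.winding Z = w) :
    toReal (D.point gw gz (D.rayMatching r₂)) = toReal (D.point gw gz (D.rayMatching r₁)) +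
      (Nat.card {Z : D.ZigzagPath // D.winding Z = w} : ℝ) • toReal (expVec gw gz w) := by
  rw [← toReal_nsmul, ← hD.point_sub h₁ h₂ hw h, ← toReal_add, add_sub_cancel]

theorem expPairing_expVec_self (hg : wedge gw gz = 1 ∨ wedge gw gz = -1) (w : ℤ × ℤ) :
    expPairing gw gz (toReal w) (toReal (expVec gw gz w)) = 0 := by
  rw [expPairing_expVec hg, wedge_self]

theorem toReal_expVec_ne_zero (hg : wedge gw gz = 1 ∨ wedge gw gz = -1) (hw : w ≠ 0) :
    toReal (expVec gw gz w) ≠ 0 :=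
  toReal_ne_zero fun h => hw (expVec_injective hg (by rw [h]; ext <;> simp [expVec, wedge]))

/-- The points of the toric diagram on the supporting line in the direction `w` form the edge
between the two corners. -/
theorem mem_edge (hD : D.ProperlyOrdered) (hg : wedge gw gz = 1 ∨ wedge gw gz = -1)
    (h₁ : D.IsGenericRay r₁) (h₂ : D.IsGenericRay r₂) (hw : ∃ Z, D.winding Z = w)
    (h : ∀ Z, Ccw r₁ (D.windingR Z) r₂ ↔ D.winding Z = w) {x : ℝ × ℝ}
    (hx : x ∈ D.toricDiagram gw gz c φ)
    (h0 : expPairing gw gz (toReal w) (x - toReal (D.point gw gz (D.rayMatching r₁))) = 0) :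
    ∃ t : ℝ, 0 ≤ t ∧ t ≤ Nat.card {Z : D.ZigzagPath // D.winding Z = w} ∧
      x = toReal (D.point gw gz (D.rayMatching r₁)) + t • toReal (expVec gw gz w) := by
  obtain ⟨Z, rfl⟩ := hw
  have heq := hD.toReal_point_eq (gw := gw) (gz := gz) h₁ h₂ ⟨Z, rfl⟩ h
  -- The half plane of the winding before `r₁` bounds the edge at `t = 0`, that of the winding after
  -- `r₂` at `t = n`.
  obtain ⟨Z₀, hZ₀⟩ := D.exists_isFirstCw r₁
  obtain ⟨Z₃, hZ₃⟩ := D.exists_isFirstCcw r₂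
  have p₁ := hD.windingR_wedge_pos h₁ hZ₀ (isFirstCcw_of_between h rfl)
  have p₂ := hD.windingR_wedge_pos h₂ (isFirstCw_of_between h rfl) hZ₃
  have a₁ := hD.expPairing_nonneg_of_isFirstCw hg h₁ hZ₀ hx
  have a₂ := hD.expPairing_nonneg_of_isFirstCcw hg h₂ hZ₃ hx
  rw [heq] at a₂
  generalize toReal (D.point gw gz (D.rayMatching r₁)) = q at *
  generalize (Nat.card {Y : D.ZigzagPath // D.winding Y = D.winding Z} : ℝ) = n at *
  obtain ⟨t, ht⟩ : ∃ t : ℝ, x - q = t • toReal (expVec gw gz (D.winding Z)) := by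
    refine ⟨expPairing gw gz (D.windingR Z₀) (x - q) / wedge (D.windingR Z₀) (D.windingR Z), ?_⟩
    refine sub_eq_zero.1 (eq_zero_of_expPairing_eq_zero (gw := gw) (gz := gz) hg
      (a := D.windingR Z₀) (b := D.windingR Z) p₁.ne' ?_ ?_)
    · rw [expPairing_sub _ (x - q), expPairing_smul, expPairing_expVec hg]
      change _ - _ * wedge (D.windingR Z₀) (D.windingR Z) = 0
      field_simp
      ring
    · rw [expPairing_sub _ (x - q), expPairing_smul]
      change expPairing gw gz (toReal (D.winding Z)) (x - q) - _ *
        expPairing gw gz (toReal (D.winding Z)) _ = 0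
      rw [h0, expPairing_expVec_self hg, mul_zero, sub_zero]
  refine ⟨t, ?_, ?_, ?_⟩
  · rw [ht, expPairing_smul, expPairing_expVec hg] at a₁
    exact nonneg_of_mul_nonneg_left a₁ p₁
  · rw [← sub_sub, ht, ← sub_smul, expPairing_smul, expPairing_expVec hg, wedge_swap] at a₂
    change 0 ≤ (t - n) * -wedge (D.windingR Z) (D.windingR Z₃) at a₂
    by_contra hlt
    have := mul_pos (sub_pos.2 (not_le.1 hlt)) p₂
    linarith
  · rw [← ht, add_sub_cancel]

theorem mem_segment_edge (hD : D.ProperlyOrdered) (h₁ : D.IsGenericRay r₁)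
    (h₂ : D.IsGenericRay r₂) (hw : ∃ Z, D.winding Z = w)
    (h : ∀ Z, Ccw r₁ (D.windingR Z) r₂ ↔ D.winding Z = w) {t : ℝ} (ht : 0 ≤ t)
    (htn : t ≤ Nat.card {Z : D.ZigzagPath // D.winding Z = w}) :
    toReal (D.point gw gz (D.rayMatching r₁)) + t • toReal (expVec gw gz w) ∈
      segment ℝ (toReal (D.point gw gz (D.rayMatching r₁)))
        (toReal (D.point gw gz (D.rayMatching r₂))) := by
  rw [hD.toReal_point_eq h₁ h₂ hw h]
  have hpos : 0 < (Nat.card {Z : D.ZigzagPath // D.winding Z = w} : ℝ) := by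
    have : Nonempty {Z : D.ZigzagPath // D.winding Z = w} := hw.elim fun Z hZ => ⟨Z, hZ⟩
    exact_mod_cast Nat.card_pos
  generalize (Nat.card {Z : D.ZigzagPath // D.winding Z = w} : ℝ) = n at *
  rw [segment_eq_image']
  refine ⟨t / n, ⟨by positivity, (div_le_one hpos).2 htn⟩, ?_⟩
  simp only [add_sub_cancel_left, smul_smul]
  rw [div_mul_cancel₀ _ hpos.ne']

theorem isExtreme_edge (hD : D.ProperlyOrdered) (hg : wedge gw gz = 1 ∨ wedge gw gz = -1)
    (hc : ∀ e, c e ≠ 0) (h₁ : D.IsGenericRay r₁) (h₂ : D.IsGenericRay r₂)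
    (hw : ∃ Z, D.winding Z = w) (h : ∀ Z, Ccw r₁ (D.windingR Z) r₂ ↔ D.winding Z = w) :
    IsExtreme ℝ (D.toricDiagram gw gz c φ)
      (segment ℝ (toReal (D.point gw gz (D.rayMatching r₁)))
        (toReal (D.point gw gz (D.rayMatching r₂)))) := by
  refine ⟨convex_toricDiagram.segment_subset (hD.point_mem_toricDiagram hg hc h₁)
    (hD.point_mem_toricDiagram hg hc h₂), fun x hx y hy z hz hzo => ?_⟩
  have hnn {x : ℝ × ℝ} (hx : x ∈ D.toricDiagram gw gz c φ) :
      0 ≤ expPairing gw gz (toReal w) (x - toReal (D.point gw gz (D.rayMatching r₁))) := by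
    obtain ⟨Z, rfl⟩ := hw
    exact hD.expPairing_nonneg_of_isFirstCcw hg h₁ (isFirstCcw_of_between h rfl) hx
  have hz0 : expPairing gw gz (toReal w) (z - toReal (D.point gw gz (D.rayMatching r₁))) = 0 := by
    rw [segment_eq_image', hD.toReal_point_eq h₁ h₂ hw h] at hz
    obtain ⟨θ, -, rfl⟩ := hz
    simp only [add_sub_cancel_left, expPairing_smul, expPairing_expVec_self hg, mul_zero]
  obtain ⟨t, ht, htn, rfl⟩ := hD.mem_edge hg h₁ h₂ hw h hx
    (expPairing_eq_zero_of_mem_openSegment (hnn hx) (hnn hy) hz0 hzo)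
  exact hD.mem_segment_edge h₁ h₂ hw h ht htn

end Edge

/-! ### The legs of the toric diagram -/

/-- The vector in the plane of displacements whose coordinates with respect to `gw` and `gz` are given
by the leg. -/
def legWinding {Δ : Set (ℝ × ℝ)} (gw gz : ℤ × ℤ) (l : Leg Δ) : ℤ × ℤ :=
  l.vec.1 • gw + l.vec.2 • gz

section Leg

theorem expVec_legWinding {Δ : Set (ℝ × ℝ)} (l : Leg Δ) :
    expVec gw gz (legWinding gw gz l) = wedge gw gz • (l.tgt - l.src) :=
  expVec_normal (l.tgt - l.src)

theorem tgt_eq (hg : wedge gw gz = 1 ∨ wedge gw gz = -1) {Δ : Set (ℝ × ℝ)} (l : Leg Δ) :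
    l.tgt = l.src + wedge gw gz • expVec gw gz (legWinding gw gz l) := by
  have hs : wedge gw gz * wedge gw gz = 1 := by rcases hg with h | h <;> simp [h]
  rw [expVec_legWinding, smul_smul, hs, one_smul, add_sub_cancel]

theorem legWinding_boundary (hg : wedge gw gz = 1 ∨ wedge gw gz = -1) {Δ : Set (ℝ × ℝ)}
    (l : Leg Δ) {x : ℝ × ℝ} (hx : x ∈ Δ) :
    0 ≤ expPairing gw gz (toReal (legWinding gw gz l)) (x - toReal l.src) := by
  have h := expPairing_normal hg (l.tgt - l.src) (x - toReal l.src)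
  have h' := l.boundary x hx
  rw [← toReal_sub, ← h] at h'
  exact h'

/-- If the vector had no winding direction it would be a generic ray, whose form has a unique
minimum, yet both ends of the leg attain it. Its length is then fixed by the absence of inner
lattice points. -/
theorem exists_winding_eq_legWinding (hD : D.ProperlyOrdered)
    (hg : wedge gw gz = 1 ∨ wedge gw gz = -1) (hc : ∀ e, c e ≠ 0)
    (l : Leg (D.toricDiagram gw gz c φ)) : ∃ Z, D.winding Z = legWinding gw gz l := by
  have hs : wedge gw gz * wedge gw gz = 1 := by rcases hg with h | h <;> simp [h]
  have htgt := tgt_eq hg l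
  have hu0 : legWinding gw gz l ≠ 0 := fun h0 => l.ne <| by
    rw [h0] at htgt
    rw [htgt]; simp [expVec, wedge]
  have htgt0 :
      expPairing gw gz (toReal (legWinding gw gz l)) (toReal l.tgt - toReal l.src) = 0 := by
    rw [htgt, toReal_add, add_sub_cancel_left, toReal_zsmul, expPairing_smul,
      expPairing_expVec_self hg, mul_zero]
  obtain ⟨Z, hZ⟩ : ∃ Z, SameDir (toReal (legWinding gw gz l)) (D.windingR Z) := by
    by_contra! hall
    have hr : D.IsGenericRay (toReal (legWinding gw gz l)) := ⟨toReal_ne_zero hu0, hall⟩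
    have h1 := hD.expPairing_ray_nonneg hg hr l.src_mem
    have h2 := hD.expPairing_ray_nonneg hg hr l.tgt_mem
    have h3 := legWinding_boundary hg l (hD.point_mem_toricDiagram hg hc hr)
    rw [expPairing_sub] at h1 h2 h3 htgt0
    refine l.ne (toReal_injective ((h1.2 ?_).trans (h2.2 ?_).symm)) <;> linarith [h1.1, h2.1]
  rw [windingR, sameDir_toReal] at hZ
  obtain ⟨t, ht⟩ := exists_eq_zsmul_of_wedge_eq_zero (hD.isCoprime_winding Z) hZ.symm.1
  have hw0 := hD.winding_ne_zero Z
  have htpos : 0 < t := by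
    have h1 := hZ.2
    rw [ht] at h1
    simp only [Prod.smul_fst, Prod.smul_snd, smul_eq_mul] at h1
    have h2 : 0 < t * ((D.winding Z).1 * (D.winding Z).1 + (D.winding Z).2 * (D.winding Z).2) := by
      linarith
    exact pos_of_mul_pos_left h2 (normSq_pos hw0).le
  refine ⟨Z, ?_⟩
  have hv0 : expVec gw gz (D.winding Z) ≠ 0 := fun h =>
    toReal_expVec_ne_zero hg hw0 (by rw [h]; ext <;> simp [toReal])
  have hsv0 (k : ℤ) (hk : k ≠ 0) : (k * wedge gw gz) • expVec gw gz (D.winding Z) ≠ 0 :=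
    smul_ne_zero (mul_ne_zero hk (by rcases hg with h | h <;> simp [h])) hv0
  have htgt' : l.tgt = l.src + (t * wedge gw gz) • expVec gw gz (D.winding Z) := by
    rw [htgt, ht, expVec_zsmul, smul_smul, mul_comm]
  -- One primitive step from the source stays on the segment, so it must end at the target.
  have hmid := l.consecutive (l.src + (1 * wedge gw gz) • expVec gw gz (D.winding Z)) <| by
    rw [segment_eq_image', htgt']
    have htR : (1 : ℝ) ≤ t := by exact_mod_cast htpos
    refine ⟨(t : ℝ)⁻¹, ⟨by positivity, inv_le_one_of_one_le₀ htR⟩, ?_⟩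
    simp only [toReal_add, add_sub_cancel_left, toReal_zsmul, smul_smul]
    congr 2
    push_cast
    field_simp
  rcases hmid with hmid | hmid
  · exact absurd (add_eq_left.1 hmid) (hsv0 1 one_ne_zero)
  · rw [htgt', add_right_inj, ← sub_eq_zero, ← sub_smul, ← sub_mul] at hmid
    have : (1 : ℤ) - t = 0 := by
      by_contra hne
      exact hsv0 _ hne hmid
    rw [ht, show t = 1 by omega, one_smul]

theorem normal_expVec (hg : wedge gw gz = 1 ∨ wedge gw gz = -1) {w d : ℤ × ℤ}
    (hd : d = wedge gw gz • expVec gw gz w) : d.2 • gw + (-d.1) • gz = w := by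
  have hs : wedge gw gz * wedge gw gz = 1 := by rcases hg with h | h <;> simp [h]
  subst hd
  simp only [expVec, wedge] at *
  ext
  · simp only [Prod.fst_add, Prod.smul_fst, Prod.smul_snd, smul_eq_mul]
    linear_combination w.1 * hs
  · simp only [Prod.snd_add, Prod.smul_fst, Prod.smul_snd, smul_eq_mul]
    linear_combination w.2 * hs

/-! ### Unit lattice segments on an edge of the polygon -/

section Segments

variable {Δ : Set (ℝ × ℝ)} {q w : ℤ × ℤ} {n : ℕ}

/-- The sign `wedge gw gz` gives the direction of the leg: for a negative basis the edge vector of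
`w` runs clockwise along the boundary, so the leg goes from `j` to `j - 1`. -/
theorem exists_leg_of_edge (hg : wedge gw gz = 1 ∨ wedge gw gz = -1)
    (hw : IsCoprime w.1 w.2)
    (hnn : ∀ x ∈ Δ, 0 ≤ expPairing gw gz (toReal w) (x - toReal q))
    (hsub : ∀ t : ℝ, 0 ≤ t → t ≤ n → toReal q + t • toReal (expVec gw gz w) ∈ Δ)
    {j : ℤ} (h0 : 0 ≤ j) (hn : j ≤ n) (h0' : 0 ≤ j + wedge gw gz) (hn' : j + wedge gw gz ≤ n) :
    ∃ l : Leg Δ, legWinding gw gz l = w ∧ l.src = q + j • expVec gw gz w := by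
  have hs : wedge gw gz ≠ 0 := by rcases hg with h | h <;> simp [h]
  have hw0 : w ≠ 0 := by
    rintro rfl
    exact not_isCoprime_zero_zero hw
  have hvR := toReal_expVec_ne_zero hg hw0
  have hv : expVec gw gz w ≠ 0 := fun h => hvR (by rw [h]; ext <;> simp [toReal])
  have hd : q + (j + wedge gw gz) • expVec gw gz w - (q + j • expVec gw gz w) =
      wedge gw gz • expVec gw gz w := by
    rw [add_sub_add_left_eq_sub, ← sub_smul, add_sub_cancel_left]
  have hnormal := normal_expVec hg hd
  refine ⟨⟨q + j • expVec gw gz w, q + (j + wedge gw gz) • expVec gw gz w, ?_, ?_, ?_, ?_, ?_⟩,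
    hnormal, rfl⟩
  · rw [toReal_add, toReal_zsmul]
    exact hsub _ (by exact_mod_cast h0) (by exact_mod_cast hn)
  · rw [toReal_add, toReal_zsmul]
    exact hsub _ (by exact_mod_cast h0') (by exact_mod_cast hn')
  · intro heq
    rw [← heq, sub_self] at hd
    exact smul_ne_zero hs hv hd.symm
  · intro x hx
    rw [← toReal_sub, ← expPairing_normal hg, hnormal, toReal_add, ← sub_sub, toReal_zsmul,
      expPairing_sub, expPairing_smul, expPairing_expVec_self hg, mul_zero, sub_zero]
    exact hnn x hx
  · intro p hp
    rw [segment_eq_image', ← toReal_sub, hd, toReal_zsmul] at hp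
    obtain ⟨θ, ⟨hθ0, hθ1⟩, hp⟩ := hp
    have hp' : toReal (p - (q + j • expVec gw gz w)) =
        (θ * (wedge gw gz : ℤ)) • toReal (expVec gw gz w) := by
      rw [toReal_sub, ← hp]
      simp only [add_sub_cancel_left, smul_smul]
    have hwedge : wedge (expVec gw gz w) (p - (q + j • expVec gw gz w)) = 0 := by
      have : wedge (toReal (expVec gw gz w)) (toReal (p - (q + j • expVec gw gz w))) = 0 := by
        rw [hp', wedge_smul_right, wedge_self, mul_zero]
      rw [wedge_toReal] at this
      exact_mod_cast this
    obtain ⟨t, ht⟩ := exists_eq_zsmul_of_wedge_eq_zero (isCoprime_expVec hg hw) hwedge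
    rw [ht, toReal_zsmul] at hp'
    have htθ : (t : ℝ) = θ * (wedge gw gz : ℤ) := smul_left_injective ℝ hvR hp'
    have ht' : t = 0 ∨ t = wedge gw gz := by
      rcases hg with h | h
      · rw [h, Int.cast_one, mul_one] at htθ
        have h1 : 0 ≤ t := by exact_mod_cast htθ ▸ hθ0
        have h2 : t ≤ 1 := by exact_mod_cast htθ ▸ hθ1
        omega
      · rw [h, Int.cast_neg, Int.cast_one, mul_neg, mul_one] at htθ
        have h1 : -t ≤ 1 := by
          have : -(t : ℝ) ≤ 1 := by linarith
          exact_mod_cast this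
        have h2 : 0 ≤ -t := by
          have : 0 ≤ -(t : ℝ) := by linarith
          exact_mod_cast this
        omega
    rw [sub_eq_iff_eq_add] at ht
    rcases ht' with rfl | rfl
    · left; rw [ht, zero_smul, zero_add]
    · right; rw [ht, add_smul]; abel

theorem exists_src_eq_of_edge (hg : wedge gw gz = 1 ∨ wedge gw gz = -1)
    (hw : IsCoprime w.1 w.2) (hq : toReal q ∈ Δ)
    (hnn : ∀ x ∈ Δ, 0 ≤ expPairing gw gz (toReal w) (x - toReal q))
    (hedge : ∀ x ∈ Δ, expPairing gw gz (toReal w) (x - toReal q) = 0 →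
      ∃ t : ℝ, 0 ≤ t ∧ t ≤ n ∧ x = toReal q + t • toReal (expVec gw gz w))
    (l : Leg Δ) (hl : legWinding gw gz l = w) :
    ∃ j : ℤ, 0 ≤ j ∧ j ≤ n ∧ 0 ≤ j + wedge gw gz ∧ j + wedge gw gz ≤ n ∧
      l.src = q + j • expVec gw gz w := by
  have hw0 : w ≠ 0 := by
    rintro rfl
    exact not_isCoprime_zero_zero hw
  have hvR := toReal_expVec_ne_zero hg hw0
  have htgt := tgt_eq hg l
  have h1 := legWinding_boundary hg l hq
  rw [hl] at htgt h1
  have hsrc0 : expPairing gw gz (toReal w) (toReal l.src - toReal q) = 0 := by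
    have h2 := hnn _ l.src_mem
    rw [expPairing_sub] at h1 h2 ⊢
    linarith
  have htgt0 : expPairing gw gz (toReal w) (toReal l.tgt - toReal q) = 0 := by
    rw [htgt, toReal_add, toReal_zsmul, add_sub_right_comm, expPairing_add, expPairing_smul,
      expPairing_expVec_self hg, hsrc0, mul_zero, add_zero]
  have key {p : ℤ × ℤ} (hp : toReal p ∈ Δ)
      (hp0 : expPairing gw gz (toReal w) (toReal p - toReal q) = 0) :
      ∃ j : ℤ, 0 ≤ j ∧ j ≤ n ∧ p = q + j • expVec gw gz w := by
    obtain ⟨t, ht0, htn, ht⟩ := hedge _ hp hp0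
    have hp' : toReal (p - q) = t • toReal (expVec gw gz w) := by
      rw [toReal_sub, ht, add_sub_cancel_left]
    have hwedge : wedge (expVec gw gz w) (p - q) = 0 := by
      have : wedge (toReal (expVec gw gz w)) (toReal (p - q)) = 0 := by
        rw [hp', wedge_smul_right, wedge_self, mul_zero]
      rw [wedge_toReal] at this
      exact_mod_cast this
    obtain ⟨j, hj⟩ := exists_eq_zsmul_of_wedge_eq_zero (isCoprime_expVec hg hw) hwedge
    rw [hj, toReal_zsmul] at hp'
    have hjt : (j : ℝ) = t := smul_left_injective ℝ hvR hp'
    refine ⟨j, by exact_mod_cast hjt ▸ ht0, by exact_mod_cast hjt ▸ htn, ?_⟩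
    rw [← hj, add_sub_cancel]
  obtain ⟨j, hj0, hjn, hj⟩ := key l.src_mem hsrc0
  obtain ⟨k, hk0, hkn, hk⟩ := key l.tgt_mem htgt0
  have hkj : k = j + wedge gw gz := by
    rw [hj, hk, add_assoc, add_right_inj, ← add_smul] at htgt
    have h3 := congrArg toReal htgt
    rw [toReal_zsmul, toReal_zsmul] at h3
    exact_mod_cast smul_left_injective ℝ hvR h3
  subst hkj
  exact ⟨j, hj0, hjn, hk0, hkn, hj⟩

end Segments

/-- The legs that belong to a winding are the unit segments of an edge of the toric diagram. -/
theorem nonempty_fin_equiv_leg (hD : D.ProperlyOrdered)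
    (hg : wedge gw gz = 1 ∨ wedge gw gz = -1) (hc : ∀ e, c e ≠ 0) (Z : D.ZigzagPath) :
    Nonempty (Fin (Nat.card {Y : D.ZigzagPath // D.winding Y = D.winding Z}) ≃
      {l : Leg (D.toricDiagram gw gz c φ) // legWinding gw gz l = D.winding Z}) := by
  obtain ⟨r₁, r₂, h₁, h₂, h⟩ := hD.exists_rays Z
  have hnn : ∀ x ∈ D.toricDiagram gw gz c φ, 0 ≤ expPairing gw gz (toReal (D.winding Z))
      (x - toReal (D.point gw gz (D.rayMatching r₁))) := fun x hx =>
    hD.expPairing_nonneg_of_isFirstCcw hg h₁ (isFirstCcw_of_between h rfl) hx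
  have hmk {j : ℤ} := exists_leg_of_edge (j := j) hg (hD.isCoprime_winding Z) hnn
    fun t ht htn => (hD.isExtreme_edge hg hc h₁ h₂ ⟨Z, rfl⟩ h).subset
      (hD.mem_segment_edge h₁ h₂ ⟨Z, rfl⟩ h ht htn)
  have hsrc := exists_src_eq_of_edge hg (hD.isCoprime_winding Z)
    (hD.point_mem_toricDiagram hg hc h₁) hnn
    fun x hx hx0 => hD.mem_edge (c := c) (φ := φ) hg h₁ h₂ ⟨Z, rfl⟩ h hx hx0
  have hvR := toReal_expVec_ne_zero hg (hD.winding_ne_zero Z)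
  generalize D.point gw gz (D.rayMatching r₁) = q at *
  generalize Nat.card {Y : D.ZigzagPath // D.winding Y = D.winding Z} = n at *
  -- Sources sit at positions 0 to n - 1 for a positive basis and 1 to n for a negative one; `a` is
  -- this shift.
  obtain ⟨a, ha⟩ : ∃ a : ℤ, (a = 0 ∧ wedge gw gz = 1) ∨ (a = 1 ∧ wedge gw gz = -1) := by
    rcases hg with h | h
    · exact ⟨0, Or.inl ⟨rfl, h⟩⟩
    · exact ⟨1, Or.inr ⟨rfl, h⟩⟩
  have hmk' (i : Fin n) : ∃ l : Leg (D.toricDiagram gw gz c φ), legWinding gw gz l = D.winding Z ∧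
      l.src = q + ((i : ℤ) + a) • expVec gw gz (D.winding Z) := by
    have := i.2
    exact hmk (by omega) (by omega) (by omega) (by omega)
  choose f hf hfsrc using hmk'
  refine ⟨Equiv.ofBijective (fun i => ⟨f i, hf i⟩) ⟨fun i i' hii => ?_, fun ⟨l, hl⟩ => ?_⟩⟩
  · have h1 : f i = f i' := congrArg Subtype.val hii
    have h2 := hfsrc i
    rw [h1, hfsrc i', add_right_inj] at h2
    have h3 := congrArg toReal h2
    rw [toReal_zsmul, toReal_zsmul] at h3
    have h4 : ((i' : ℤ) + a) = (i : ℤ) + a := by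
      exact_mod_cast smul_left_injective ℝ hvR h3
    exact Fin.ext (by omega)
  · obtain ⟨j, hj0, hjn, hk0, hkn, hj⟩ := hsrc l hl
    refine ⟨⟨(j - a).toNat, by omega⟩, Subtype.ext ?_⟩
    have hs : (f ⟨(j - a).toNat, by omega⟩).src = l.src := by
      rw [hfsrc, hj]
      congr 2
      simp only
      omega
    exact Leg.ext hs (by rw [tgt_eq hg, tgt_eq hg l, hf, hl, hs])

/-- The bijections are glued over all vectors. A vector that is not a winding has an empty fibre on
both sides. -/
theorem exists_equiv_leg (hD : D.ProperlyOrdered)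
    (hg : wedge gw gz = 1 ∨ wedge gw gz = -1) (hc : ∀ e, c e ≠ 0) :
    ∃ Φ : D.ZigzagPath ≃ Leg (D.toricDiagram gw gz c φ),
      ∀ Z, D.winding Z = legWinding gw gz (Φ Z) := by
  have hfib (w : ℤ × ℤ) : Nonempty ({Z : D.ZigzagPath // D.winding Z = w} ≃
      {l : Leg (D.toricDiagram gw gz c φ) // legWinding gw gz l = w}) := by
    by_cases hw : ∃ Z, D.winding Z = w
    · obtain ⟨Z, rfl⟩ := hw
      obtain ⟨Ψ⟩ := hD.nonempty_fin_equiv_leg (c := c) (φ := φ) hg hc Z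
      exact ⟨(Finite.equivFin _).trans Ψ⟩
    · have h1 : IsEmpty {Z : D.ZigzagPath // D.winding Z = w} := ⟨fun Z => hw ⟨Z.1, Z.2⟩⟩
      have h2 : IsEmpty {l : Leg (D.toricDiagram gw gz c φ) // legWinding gw gz l = w} :=
        ⟨fun l => hw ((hD.exists_winding_eq_legWinding hg hc l.1).imp fun Z hZ => hZ.trans l.2)⟩
      exact ⟨Equiv.equivOfIsEmpty _ _⟩
  exact ⟨Equiv.ofFiberEquiv fun w => (hfib w).some, fun Z => (Equiv.ofFiberEquiv_map _ Z).symm⟩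

end Leg

end ProperlyOrdered

end Dimer

/-! ### Assembly of the theorem -/

theorem mainTheorem2 {E : Type*} [Fintype E] (D : Dimer E) (hD : D.ProperlyOrdered)
    (gw gz : ℤ × ℤ) (hg : wedge gw gz = 1 ∨ wedge gw gz = -1)
    (c : E → ℂ) (hc : ∀ e, c e ≠ 0) :
    -- the Kasteleyn matrix is square
    Nat.card D.White = Nat.card D.Black ∧
    ∀ φ : D.White ≃ D.Black,
      -- zigzag paths correspond to legs, and windings (in the basis `gw`, `gz`) to leg vectors
      (∃ Φ : D.ZigzagPath ≃ Leg (D.toricDiagram gw gz c φ),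
        ∀ Z, D.winding Z = (Φ Z).vec.1 • gw + (Φ Z).vec.2 • gz) ∧
      -- the sets of edges attached to rays are perfect matchings
      (∀ r, D.IsGenericRay r → D.IsPerfectMatching (D.rayMatching r)) ∧
      -- they lie at the corners of the toric diagram, and every corner arises in this way
      (D.toricDiagram gw gz c φ).extremePoints ℝ =
        {p | ∃ r, D.IsGenericRay r ∧ p = toReal (D.point gw gz (D.rayMatching r))} ∧
      -- rays with just one winding direction between them yield consecutive corners, which differ
      -- by the rotated sum of the windings of the zigzag paths of that direction
      (∀ r₁ r₂ w, D.IsGenericRay r₁ → D.IsGenericRay r₂ → (∃ Z, D.winding Z = w) →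
        (∀ Z, Ccw r₁ (D.windingR Z) r₂ ↔ D.winding Z = w) →
        D.point gw gz (D.rayMatching r₁) ≠ D.point gw gz (D.rayMatching r₂) ∧
        IsExtreme ℝ (D.toricDiagram gw gz c φ)
          (segment ℝ (toReal (D.point gw gz (D.rayMatching r₁)))
            (toReal (D.point gw gz (D.rayMatching r₂)))) ∧
        D.point gw gz (D.rayMatching r₂) - D.point gw gz (D.rayMatching r₁) =
          Nat.card {Z : D.ZigzagPath // D.winding Z = w} • (wedge w gw, wedge w gz)) := by
  obtain ⟨Z₀⟩ : Nonempty D.ZigzagPath := D.nonempty_edge.map D.zigOut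
  obtain ⟨r₀, -, hr₀, -, -⟩ := hD.exists_rays Z₀
  refine ⟨(hD.isPerfectMatching_rayMatching hr₀).card_white_eq_card_black, fun φ =>
    ⟨hD.exists_equiv_leg hg hc, fun r hr => hD.isPerfectMatching_rayMatching hr,
      hD.extremePoints_toricDiagram hg hc, fun r₁ r₂ w h₁ h₂ hw h => ⟨fun heq => ?_,
        hD.isExtreme_edge hg hc h₁ h₂ hw h, hD.point_sub h₁ h₂ hw h⟩⟩⟩
  have hsub := hD.point_sub (gw := gw) (gz := gz) h₁ h₂ hw h
  have : Nonempty {Z : D.ZigzagPath // D.winding Z = w} := hw.elim fun Z hZ => ⟨Z, hZ⟩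
  obtain ⟨Z, rfl⟩ := hw
  -- Equal points would make n times the winding zero, although n is positive and the winding
  -- nonzero.
  rw [heq, sub_self, eq_comm, ← expVec_nsmul] at hsub
  have h0 := expVec_injective hg (hsub.trans (by ext <;> simp [expVec, wedge] :
    (0 : ℤ × ℤ) = expVec gw gz 0))
  exact (smul_ne_zero Nat.card_pos.ne' (hD.winding_ne_zero Z)) h0
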